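/- **Setting.** Let $I\subset\mathbb R$ be an interval and $f\colon I\to I$ a map with countably many branches (that is, $I$ is a countable union of Borel sets on each of which $f$ is injective), and let $\mu$ be an $f$-invariant ergodic Borel probability measure on $I$. Write $\|\varphi\|_{BV}=\operatorname{var}\varphi+\sup|\varphi|$, and let $BV$ be the space of functions on $I$ for which this is finite. Assume: * *Exponential decay of correlations, $BV$ against $L^\infty$.* There are $C,\tau>0$ such that $\bigl|\int\varphi_1\cdot\varphi_2\circ f^j\,d\mu-\int\varphi_1\,d\mu\int\varphi_2\,d\mu\bigr|\le Ce^{-\tau j}\|\varphi_1\|_{BV}\sup|\varphi_2|$ for all $j\ge 0$, $\varphi_1\in BV$ and bounded measurable $\varphi_2$. * *Gibbs measure.* There are a measurable weight $g\colon I\to[0,\infty)$ (with potential $\log g$) satisfying $\sum_{f(y)=x}g(y)<\infty$ for every $x$, a number $\lambda>0$ and a probability measure $\nu$ which is conformal, i.e. $\nu(f(E))=\int_E\lambda g^{-1}\,d\nu$ for every measurable $E$ on which $f$ is injective (with $\lambda/0=\infty$), such that $\mu=h\,\nu$ with $h\ge0$, $h\in BV$. * *Spectral gap.* The transfer operator $\mathcal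 L\psi(x)=\sum_{f(y)=x}g(y)\psi(y)$ satisfies $\mathcal Lh=\lambda h$, has a spectral gap on $BV$, and $h$ is, up to scalar multiples, its only eigenfunction for an eigenvalue of maximal modulus. That is, there are $C$ and $0\le\rho<\lambda$ such that for every $\psi\in BV$ there is $a\in\mathbb R$ with $\|\mathcal L^n\psi-\lambda^n a\,h\|_{BV}\le C\rho^n\|\psi\|_{BV}$ for all $n\ge0$. Let $\tilde x\in I$ be a hyperbolic periodic point of (prime) period $q$: $f$ is continuous at the points of the orbit of $\tilde x$, $f^q$ is $C^1$ in a neighbourhood of $\tilde x$ (so $|(f^q)'(\tilde x)|<\infty$), and $|(f^q)'(\tilde x)|\neq1$. Assume that $h$ is bounded away from $0$ $\nu$-almost everywhere in a neighbourhood of $\tilde x$, and that $g$ is bounded away from $0$ in a neighbourhood of each point of the orbit of $\tilde x$. Let $\psi\colon[0,\infty)\to[-\infty,\infty]$ be continuous and strictly decreasing with $\psi(y)\to\infty$ as $y\to0$, let $\phi(x)=\psi(|x-\tilde x|)$ and $M_n=\max_{0\le k\le n-1}\phi\circ f^k$. Let $r_n>0$ $(n\ge1)$, $r_n\to0$, and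 put $B_n=\{x\in I:|x-\tilde x|<r_n\}=\{\phi>\psi(r_n)\}$. Suppose that $n\mapsto n\mu(B_n)$ is non-decreasing, and that for $$\theta_n=\frac{\mu\bigl(B_n\cap\bigcap_{k=1}^{q}f^{-k}(B_n^{\complement})\bigr)}{\mu(B_n)}$$ there are $\theta\ne0$ (the extremal index) and $\hat\sigma>0$ with $|\theta_n-\theta|=O(n^{-\hat\sigma})$ (in particular $\mu(B_n)>0$ for large $n$). Let $$\mathcal H_{\mathrm{ea}}=\bigcup_{n\ge1}\bigcap_{m\ge n}\bigcup_{k=0}^{m-1}f^{-k}(B_m).$$ **Theorem.** Under these assumptions: 1. If $\sum_{n\ge1}\mu(B_n)e^{-n\theta\mu(B_n)}<\infty$, then $\mu(\mathcal H_{\mathrm{ea}})=\mu\bigl(\psi(r_n)\le M_n\text{ for all sufficiently large }n\bigr)=1$. 2. If $\sum_{n\ge1}\mu(B_n)e^{-n\theta\mu(B_n)}=\infty$, then $\mu(\mathcal H_{\mathrm{ea}})=\mu\bigl(\psi(r_n)\le M_n\text{ for all sufficiently large }n\bigr)=0$. -/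

import Mathlib

open MeasureTheory Filter Topology Set
open scoped ENNReal

namespace EAH

/-- The norm `‖φ‖_BV = var φ + sup |φ|` of a function on `I ⊆ ℝ`, as an extended real. -/
noncomputable def eBVNorm {I : Set ℝ} (φ : I → ℝ) : ℝ≥0∞ :=
  eVariationOn φ univ + ⨆ x, ‖φ x‖ₑ

/-- Functions of bounded variation: those with finite `BV` norm. -/
def IsBV {I : Set ℝ} (φ : I → ℝ) : Prop := eBVNorm φ ≠ ⊤

/-- Exponential decay of correlations for `BV` observables against bounded observables. -/
def ExpDecayOfCorrelations {I : Set ℝ} (f : I → I) (μ : Measure I) : Prop :=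
  ∃ C τ : ℝ, 0 < C ∧ 0 < τ ∧
    ∀ φ₁ : I → ℝ, IsBV φ₁ → ∀ φ₂ : I → ℝ, Measurable φ₂ → ∀ M : ℝ, (∀ x, |φ₂ x| ≤ M) →
      ∀ j : ℕ, |∫ x, φ₁ x * φ₂ (f^[j] x) ∂μ - (∫ x, φ₁ x ∂μ) * ∫ x, φ₂ x ∂μ|
        ≤ C * Real.exp (-τ * j) * (eBVNorm φ₁).toReal * M

/-- `f` has countably many branches: `I` is a countable union of measurable sets on each of which
`f` is injective (hence, `I` being a Borel set, a measurable isomorphism onto its image). -/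
def HasCountablyManyBranches {I : Set ℝ} (f : I → I) : Prop :=
  ∃ E : ℕ → Set I, (∀ i, MeasurableSet (E i) ∧ InjOn f (E i)) ∧ ⋃ i, E i = univ

/-- `ν` is conformal for the `[0,∞]`-valued function `J`: `ν (f E) = ∫_E J dν` for every measurable
set `E` on which `f` is injective. -/
def IsConformal {I : Set ℝ} (f : I → I) (J : I → ℝ≥0∞) (ν : Measure I) : Prop :=
  ∀ E : Set I, MeasurableSet E → InjOn f E → ν (f '' E) = ∫⁻ x in E, J x ∂ν

/-- A weight `g = exp (potential)` for which the transfer operator makes sense: measurable,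
nonnegative, and summable over every fibre of `f`. -/
structure IsWeight {I : Set ℝ} (f : I → I) (g : I → ℝ) : Prop where
  measurable : Measurable g
  nonneg : ∀ x, 0 ≤ g x
  summable : ∀ x, Summable fun y : f ⁻¹' {x} => g y

/-- The transfer operator `(𝓛 ψ)(x) = ∑_{f y = x} g y * ψ y`. -/
noncomputable def transfer {I : Set ℝ} (f : I → I) (g : I → ℝ) (ψ : I → ℝ) : I → ℝ :=
  fun x => ∑' y : f ⁻¹' {x}, g y * ψ y

/-- The transfer operator acts on `BV` with a spectral gap, and `h ∈ BV` is, up to scalar multiples,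
its unique eigenfunction for an eigenvalue of maximal modulus, this eigenvalue being `lam`. That is,
`𝓛 = lam • Π + N` on `BV` with `Π` the projection `ψ ↦ a(ψ) h` onto the line spanned by `h`, with
`Π N = N Π = 0`, and with `N` of spectral radius `< lam`; equivalently
`‖𝓛ⁿ ψ - lamⁿ a(ψ) h‖_BV ≤ C ρⁿ ‖ψ‖_BV` for some `ρ < lam`. -/
def HasSpectralGap {I : Set ℝ} (f : I → I) (g : I → ℝ) (lam : ℝ) (h : I → ℝ) : Prop :=
  IsBV h ∧ transfer f g h = lam • h ∧
    ∃ C ρ : ℝ, 0 ≤ ρ ∧ ρ < lam ∧ ∀ ψ : I → ℝ, IsBV ψ → ∃ a : ℝ, ∀ n : ℕ,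
      eBVNorm ((transfer f g)^[n] ψ - (lam ^ n * a) • h)
        ≤ ENNReal.ofReal (C * ρ ^ n) * eBVNorm ψ

/-- `x` is a hyperbolic periodic point of `f` of (prime) period `q`: `f` is continuous at the points
of the orbit, `f^q` is `C¹` near `x` (relative to `I`), so that `(f^q)'(x)` is finite, and
`|(f^q)'(x)| ≠ 1`. -/
structure IsHyperbolicPeriodicPt {I : Set ℝ} (f : I → I) (q : ℕ) (x : I) : Prop where
  pos : 0 < q
  period : Function.minimalPeriod f x = q
  continuousAt : ∀ i < q, ContinuousAt f (f^[i] x)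
  hyperbolic : ∃ F : ℝ → ℝ, ContDiffAt ℝ 1 F x ∧
    (∀ᶠ y : I in 𝓝 x, ((f^[q] y : I) : ℝ) = F y) ∧ |deriv F x| ≠ 1

/-- The points of `U` that do not return to `U` within `q` iterates. -/
def escapeSet {I : Set ℝ} (f : I → I) (q : ℕ) (U : Set I) : Set I :=
  U ∩ ⋂ k ∈ Icc 1 q, (f^[k] ⁻¹' U)ᶜ

/-- The proportion of points of `U` that do not return to `U` within `q` iterates. -/
noncomputable def escapeRatio {I : Set ℝ} (f : I → I) (μ : Measure I) (q : ℕ) (U : Set I) : ℝ :=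
  μ.real (escapeSet f q U) / μ.real U

/-- The maximum process `M_n(x) = max_{0 ≤ k ≤ n - 1} φ (f^k x)`. -/
noncomputable def maxProcess {I : Set ℝ} (f : I → I) (φ : I → EReal) (n : ℕ) (x : I) : EReal :=
  (Finset.range n).sup fun k => φ (f^[k] x)

/-- The eventually always hitting set `⋃_{n ≥ 1} ⋂_{m ≥ n} ⋃_{k < m} f^{-k} (B_m)`. -/
def eventuallyAlwaysHitting {I : Set ℝ} (f : I → I) (B : ℕ → Set I) : Set I :=
  ⋃ n ≥ 1, ⋂ m ≥ n, ⋃ k < m, f^[k] ⁻¹' B m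

end EAH

/-! A point fails the eventually-always-hitting property exactly when it lies in infinitely many of
the events `avoid f (B n) n`, so everything rests on the measure and correlations of these events.
Heuristically `avoid f (B n) n` has measure `exp (-θ n μ(B n))`. The factor `θ` appears because
visits to `B n` come in clusters along the periodic orbit, and only the last visit of each cluster,
a visit to the escape set `A n`, should be counted.

To prove this, the spectral gap and conformality give exponential mixing of an indicator of bounded
`BV` norm against an arbitrary measurable set. The indicator of `A n` qualifies uniformly: `A n` is
a ball minus an order-connected set. An orbit leaving `A n` cannot return until the expansion has
carried it to macroscopic distance, about `log (1 / r n)` steps; by then mixing makes the remaining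
short returns negligible relative to a power of `μ(B n)`. An attracting orbit is excluded by `θ ≠
0`. A blocking argument with block length `t²`, gap `t` and `t ≈ n^(1/4)` turns these estimates into
`HittingEstimates.exists_poisson`: the exponential law up to constant factors and an error `n^(-γ)`,
valid as long as `n μ(B m) ≤ log n`.

If the series converges, the indices are cut into blocks `[N, N + N / a(N))`, where `a(N)` is `N μ(B
N)` capped at a multiple of `log N`. All failures within one block lie in a single avoidance event
of measure `O(exp (-θ a(N)))`, these bounds are summable, and Borel–Cantelli concludes
(`ae_eventually_notMem_avoid`).

If it diverges, a greedily thinned sequence of indices keeps the divergence while making the events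
nearly independent in pairs. A second-moment bound gives infinitely many failures with positive
probability (`pos_measure_frequently_avoid`). The hitting set is forward invariant up to a null set,
so ergodicity makes its measure 0 or 1, and hence 0. -/

namespace EAH

/-! ### Calculus of the `BV` norm. -/

section BV

variable {I : Set ℝ}

theorem enorm_le_eBVNorm (φ : I → ℝ) (x : I) : ‖φ x‖ₑ ≤ eBVNorm φ :=
  (le_iSup (fun x => ‖φ x‖ₑ) x).trans le_add_self

theorem IsBV.abs_le {φ : I → ℝ} (hφ : IsBV φ) (x : I) : |φ x| ≤ (eBVNorm φ).toReal := by
  have := ENNReal.toReal_mono hφ (enorm_le_eBVNorm φ x)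
  simpa using this

theorem eVariationOn_add_le {α : Type*} [LinearOrder α] (φ χ : α → ℝ) (s : Set α) :
    eVariationOn (φ + χ) s ≤ eVariationOn φ s + eVariationOn χ s := by
  apply iSup_le
  rintro ⟨n, ⟨u, u_mono, u_mem⟩⟩
  refine (Finset.sum_le_sum fun i _ =>
    edist_add_add_le (φ (u (i + 1))) (χ (u (i + 1))) (φ (u i)) (χ (u i))).trans ?_
  rw [Finset.sum_add_distrib]
  gcongr
  · exact eVariationOn.sum_le_of_monotoneOn_Iic (u_mono.monotoneOn _) (fun i _ ↦ u_mem i)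
  · exact eVariationOn.sum_le_of_monotoneOn_Iic (u_mono.monotoneOn _) (fun i _ ↦ u_mem i)

theorem eBVNorm_add_le (φ χ : I → ℝ) : eBVNorm (φ + χ) ≤ eBVNorm φ + eBVNorm χ := by
  have h1 := eVariationOn_add_le φ χ univ
  have h2 : (⨆ x, ‖(φ + χ) x‖ₑ) ≤ (⨆ x, ‖φ x‖ₑ) + ⨆ x, ‖χ x‖ₑ :=
    iSup_le fun x => (enorm_add_le _ _).trans
      (add_le_add (le_iSup (fun x => ‖φ x‖ₑ) x) (le_iSup (fun x => ‖χ x‖ₑ) x))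
  calc eBVNorm (φ + χ) ≤ _ := add_le_add h1 h2
    _ = eBVNorm φ + eBVNorm χ := by unfold eBVNorm; ring

theorem eBVNorm_mul_le (φ χ : I → ℝ) : eBVNorm (φ * χ) ≤ eBVNorm φ * eBVNorm χ := by
  set A := ⨆ x, ‖φ x‖ₑ
  set B := ⨆ x, ‖χ x‖ₑ
  have h1 : eVariationOn (φ * χ) univ ≤ A * eVariationOn χ univ + B * eVariationOn φ univ :=
    eVariation_mul_le (fun x _ => le_iSup (fun x => ‖φ x‖ₑ) x)
      (fun x _ => le_iSup (fun x => ‖χ x‖ₑ) x)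
  have h2 : (⨆ x, ‖(φ * χ) x‖ₑ) ≤ A * B :=
    iSup_le fun x => by
      rw [Pi.mul_apply, enorm_mul]
      exact mul_le_mul' (le_iSup (fun x => ‖φ x‖ₑ) x) (le_iSup (fun x => ‖χ x‖ₑ) x)
  calc eBVNorm (φ * χ) ≤ (A * eVariationOn χ univ + B * eVariationOn φ univ) + A * B :=
        add_le_add h1 h2
    _ ≤ (A * eVariationOn χ univ + B * eVariationOn φ univ) + A * B
          + eVariationOn φ univ * eVariationOn χ univ := le_self_add
    _ = (eVariationOn φ univ + A) * (eVariationOn χ univ + B) := by ring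

theorem eBVNorm_const_le (c : ℝ) : eBVNorm (fun _ : I => c) ≤ ‖c‖ₑ := by
  have h1 : eVariationOn (fun _ : I => c) univ = 0 :=
    eVariationOn.constant_on ((subsingleton_singleton (a := c)).anti (by rintro _ ⟨_, _, rfl⟩; rfl))
  unfold eBVNorm
  rw [h1, zero_add]
  exact iSup_le fun _ => le_rfl

theorem eBVNorm_smul_le (c : ℝ) (φ : I → ℝ) : eBVNorm (c • φ) ≤ ‖c‖ₑ * eBVNorm φ := by
  have : c • φ = (fun _ => c) * φ := by ext x; simp
  rw [this]
  exact (eBVNorm_mul_le _ _).trans (mul_le_mul' (eBVNorm_const_le c) le_rfl)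

theorem IsBV.add {φ χ : I → ℝ} (hφ : IsBV φ) (hχ : IsBV χ) : IsBV (φ + χ) :=
  ne_top_of_le_ne_top (ENNReal.add_ne_top.2 ⟨hφ, hχ⟩) (eBVNorm_add_le _ _)

theorem IsBV.mul {φ χ : I → ℝ} (hφ : IsBV φ) (hχ : IsBV χ) : IsBV (φ * χ) :=
  ne_top_of_le_ne_top (ENNReal.mul_ne_top hφ hχ) (eBVNorm_mul_le _ _)

theorem IsBV.smul (c : ℝ) {φ : I → ℝ} (hφ : IsBV φ) : IsBV (c • φ) :=
  ne_top_of_le_ne_top (ENNReal.mul_ne_top enorm_ne_top hφ) (eBVNorm_smul_le _ _)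

theorem IsBV.measurable {φ : I → ℝ} (hφ : IsBV φ) : Measurable φ := by
  have hb : BoundedVariationOn φ univ := ne_top_of_le_ne_top hφ le_self_add
  obtain ⟨p, s, hp, hs, rfl⟩ :=
    hb.locallyBoundedVariationOn.exists_monotoneOn_sub_monotoneOn
  exact (monotoneOn_univ.1 hp).measurable.sub (monotoneOn_univ.1 hs).measurable

theorem eBVNorm_le_two_of_monotone {φ : I → ℝ} (hφ : Monotone φ ∨ Antitone φ)
    (h0 : ∀ x, 0 ≤ φ x) (h1 : ∀ x, φ x ≤ 1) : eBVNorm φ ≤ 2 := by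
  have hsup : (⨆ x, ‖φ x‖ₑ) ≤ 1 := iSup_le fun x => by
    rw [Real.enorm_eq_ofReal (h0 x)]
    simpa using ENNReal.ofReal_le_ofReal (h1 x)
  have hmono : ∀ {χ : I → ℝ}, Monotone χ → (∀ x, 0 ≤ χ x) → (∀ x, χ x ≤ 1) →
      eVariationOn χ univ ≤ 1 := by
    intro χ hχ h0 h1
    rw [eVariationOn.eq_biSup_inter_Icc]
    refine iSup₂_le fun p hp => ?_
    refine (MonotoneOn.eVariationOn_eq (hχ.monotoneOn _) hp.1 hp.2.1).le.trans ?_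
    have : χ p.2 - χ p.1 ≤ 1 := by linarith [h0 p.1, h1 p.2]
    simpa using ENNReal.ofReal_le_ofReal this
  have hvar : eVariationOn φ univ ≤ 1 := by
    rcases hφ with hφ | hφ
    · exact hmono hφ h0 h1
    · have h2 : eVariationOn (fun z => 1 - φ z) univ ≤ 1 :=
        hmono (fun x y hxy => sub_le_sub_left (hφ hxy) _) (fun x => by simpa using h1 x)
          (fun x => by simpa using h0 x)
      refine le_trans (le_of_eq ?_) h2
      have he : ∀ x y, edist (φ x) (φ y) =
          edist ((fun z => 1 - φ z) x) ((fun z => 1 - φ z) y) :=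
        fun x y => (edist_sub_left _ _ _).symm
      simp only [eVariationOn, he]
  calc eBVNorm φ ≤ 1 + 1 := add_le_add hvar hsup
    _ = 2 := one_add_one_eq_two

/-- The indicator of an order-connected set is the product of the indicators of its upper and lower
closures, one monotone and one antitone. Each has norm at most 2, and the norm is submultiplicative.
-/
theorem eBVNorm_indicator_le {S : Set I} (hS : S.OrdConnected) :
    eBVNorm (S.indicator fun _ => (1 : ℝ)) ≤ 4 := by
  classical
  have h : (S.indicator fun _ => (1 : ℝ)) =
      ((upperClosure S : Set I).indicator fun _ => (1 : ℝ)) *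
        ((lowerClosure S : Set I).indicator fun _ => (1 : ℝ)) := by
    ext x
    rw [Pi.mul_apply, ← inter_indicator_mul]
    have : ((upperClosure S : Set I) ∩ lowerClosure S) = S := by
      ext y
      constructor
      · rintro ⟨⟨a, ha, hay⟩, ⟨b, hb, hyb⟩⟩
        exact hS.out ha hb ⟨hay, hyb⟩
      · intro hy
        exact ⟨subset_upperClosure hy, subset_lowerClosure hy⟩
    rw [this]
    simp
  rw [h]
  have h01 : ∀ T : Set I, (∀ x, 0 ≤ T.indicator (fun _ => (1 : ℝ)) x) ∧
      ∀ x, T.indicator (fun _ => (1 : ℝ)) x ≤ 1 := fun T =>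
    ⟨fun x => indicator_nonneg (fun _ _ => zero_le_one) x,
      fun x => indicator_le_self' (fun _ _ => zero_le_one) x⟩
  refine (eBVNorm_mul_le _ _).trans ?_
  have hU : Monotone ((upperClosure S : Set I).indicator fun _ => (1 : ℝ)) := by
    intro x y hxy
    by_cases hx : x ∈ (upperClosure S : Set I)
    · have hy : y ∈ (upperClosure S : Set I) := (upperClosure S).upper hxy hx
      rw [indicator_of_mem hx, indicator_of_mem hy]
    · rw [indicator_of_notMem hx]; exact (h01 _).1 y
  have hL : Antitone ((lowerClosure S : Set I).indicator fun _ => (1 : ℝ)) := by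
    intro x y hxy
    by_cases hx : y ∈ (lowerClosure S : Set I)
    · have hy : x ∈ (lowerClosure S : Set I) := (lowerClosure S).lower hxy hx
      rw [indicator_of_mem hx, indicator_of_mem hy]
    · rw [indicator_of_notMem hx]; exact (h01 _).1 x
  calc _ ≤ (2 : ℝ≥0∞) * 2 := mul_le_mul'
        (eBVNorm_le_two_of_monotone (.inl hU) (h01 _).1 (h01 _).2)
        (eBVNorm_le_two_of_monotone (.inr hL) (h01 _).1 (h01 _).2)
    _ = 4 := by norm_num

theorem eBVNorm_indicator_compl_le (S : Set I) :
    eBVNorm (Sᶜ.indicator fun _ => (1 : ℝ)) ≤ 1 + eBVNorm (S.indicator fun _ => (1 : ℝ)) := by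
  have h : (Sᶜ.indicator fun _ => (1 : ℝ)) =
      (fun _ => (1 : ℝ)) + (-1 : ℝ) • (S.indicator fun _ => (1 : ℝ)) := by
    ext x
    by_cases hx : x ∈ S <;> simp [hx]
  rw [h]
  refine (eBVNorm_add_le _ _).trans (add_le_add ?_ ?_)
  · simpa using eBVNorm_const_le (I := I) 1
  · refine (eBVNorm_smul_le _ _).trans ?_
    simp

theorem eBVNorm_indicator_inter_le (S T : Set I) :
    eBVNorm ((S ∩ T).indicator fun _ => (1 : ℝ)) ≤
      eBVNorm (S.indicator fun _ => (1 : ℝ)) * eBVNorm (T.indicator fun _ => (1 : ℝ)) := by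
  refine le_trans (le_of_eq ?_) (eBVNorm_mul_le _ _)
  congr 1
  ext x
  by_cases hx : x ∈ S <;> by_cases hy : x ∈ T <;> simp [hx, hy]

end BV


/-! ### Conformality as duality for the transfer operator. -/

section Transfer

variable {I : Set ℝ} {f : I → I}

theorem HasCountablyManyBranches.exists_disjoint (hbr : HasCountablyManyBranches f) :
    ∃ E : ℕ → Set I, (∀ i, MeasurableSet (E i)) ∧ (∀ i, InjOn f (E i)) ∧
      Pairwise (Function.onFun Disjoint E) ∧ ⋃ i, E i = univ := by
  obtain ⟨E, hE, hU⟩ := hbr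
  exact ⟨disjointed E, MeasurableSet.disjointed fun i => (hE i).1,
    fun i => (hE i).2.mono (disjointed_subset E i), disjoint_disjointed E,
    (iUnion_disjointed).trans hU⟩

/-- Change of variables along a single injective branch. The `Function.extend` is `w` transported to
the image of the branch and set to 0 elsewhere, that is, one summand of a fibre sum. -/
theorem IsConformal.setLIntegral_extend {J : I → ℝ≥0∞} {ν : Measure I} (hν : IsConformal f J ν)
    (hI : MeasurableSet I) (hf : Measurable f) (hJ : Measurable J)
    {E : Set I} (hE : MeasurableSet E) (hinj : InjOn f E) (w : I → ℝ≥0∞) (hw : Measurable w)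
    {D : Set I} (hD : MeasurableSet D) :
    ∫⁻ x in D, Function.extend (fun y : E => f y) (fun y : E => w y) 0 x ∂ν =
      ∫⁻ y in f ⁻¹' D, E.indicator (fun y => J y * w y) y ∂ν := by
  have : StandardBorelSpace I := hI.standardBorel
  have : StandardBorelSpace E := hE.standardBorel
  have he : MeasurableEmbedding fun y : E => f y :=
    (hf.comp measurable_subtype_coe).measurableEmbedding (injOn_iff_injective.1 hinj)
  have hm : Measurable (Function.extend (fun y : E => f y) (fun y : E => w y) 0) :=
    he.measurable_extend (hw.comp measurable_subtype_coe) measurable_zero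
  set v := Function.extend (fun y : E => f y) (fun y : E => w y) 0 with hv
  have hvE : ∀ y ∈ E, v (f y) = w y := fun y hy => he.injective.extend_apply _ _ ⟨y, hy⟩
  have hv0 : ∀ x ∉ f '' E, v x = 0 := by
    intro x hx
    rw [hv, Function.extend_apply']
    · rfl
    · rintro ⟨y, rfl⟩; exact hx ⟨y, y.2, rfl⟩
  have hfE : MeasurableSet (f '' E) := hE.image_of_measurable_injOn hf hinj
  -- This is conformality read as an identity of measures: the branch pushes `J ν` to `ν` on its
  -- image.
  have hmap : ((ν.withDensity J).restrict E).map f = ν.restrict (f '' E) := by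
    ext S hS
    rw [Measure.map_apply hf hS, Measure.restrict_apply (hf hS), Measure.restrict_apply hS,
      withDensity_apply _ ((hf hS).inter hE), ← hν _ ((hf hS).inter hE)
        (hinj.mono inter_subset_right), image_preimage_inter]
  calc ∫⁻ x in D, v x ∂ν = ∫⁻ x in D, v x ∂(ν.restrict (f '' E)) := by
        rw [Measure.restrict_restrict hD, ← lintegral_indicator hD,
          ← lintegral_indicator (hD.inter hfE)]
        congr 1
        ext x
        by_cases hx : x ∈ f '' E
        · by_cases hxD : x ∈ D <;> simp only [indicator, mem_inter_iff, hx, hxD, and_true]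
        · simp only [indicator, mem_inter_iff, hx, and_false, hv0 x hx, ite_self]
    _ = ∫⁻ y in f ⁻¹' D, v (f y) ∂((ν.withDensity J).restrict E) := by
        rw [← hmap, setLIntegral_map hD hm hf]
    _ = ∫⁻ y in f ⁻¹' D ∩ E, w y ∂(ν.withDensity J) := by
        rw [Measure.restrict_restrict (hf hD)]
        exact setLIntegral_congr_fun ((hf hD).inter hE) fun y hy => hvE y hy.2
    _ = ∫⁻ y in f ⁻¹' D ∩ E, J y * w y ∂ν := by
        rw [setLIntegral_withDensity_eq_setLIntegral_mul _ hJ hw ((hf hD).inter hE)]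
        rfl
    _ = _ := by rw [setLIntegral_indicator hE, inter_comm]

/-- Each branch meets a fibre in at most one point, so a sum over the fibre can be rearranged as a
sum over branches. -/
theorem tsum_fiber_eq {E : ℕ → Set I} (hinj : ∀ i, InjOn f (E i))
    (hdisj : Pairwise (Function.onFun Disjoint E)) (hU : ⋃ i, E i = univ)
    (w : I → ℝ≥0∞) (x : I) :
    ∑' y : f ⁻¹' {x}, w y =
      ∑' i, Function.extend (fun y : E i => f y) (fun y : E i => w y) 0 x := by
  have h1 : ∀ y : I, w y = ∑' i, (E i).indicator w y := by
    intro y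
    have hy : y ∈ ⋃ i, E i := hU ▸ mem_univ y
    obtain ⟨i, hi⟩ := mem_iUnion.1 hy
    rw [tsum_eq_single i, indicator_of_mem hi]
    intro j hj
    exact indicator_of_notMem (fun hyj => (hdisj hj).le_bot ⟨hyj, hi⟩) _
  calc ∑' y : f ⁻¹' {x}, w y = ∑' y : f ⁻¹' {x}, ∑' i, (E i).indicator w y :=
        tsum_congr fun y => h1 y
    _ = ∑' i, ∑' y : f ⁻¹' {x}, (E i).indicator w y := ENNReal.tsum_comm
    _ = _ := tsum_congr fun i => ?_
  have hinj' := injOn_iff_injective.1 (hinj i)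
  by_cases hx : x ∈ f '' E i
  · obtain ⟨y, hy, rfl⟩ := hx
    rw [show Function.extend (fun y : E i => f y) (fun y : E i => w y) 0 (f y) = w y from
      hinj'.extend_apply _ _ ⟨y, hy⟩, tsum_eq_single ⟨y, rfl⟩]
    · exact indicator_of_mem hy _
    · rintro ⟨z, hz⟩ hne
      refine indicator_of_notMem (fun hzE => hne ?_) _
      exact Subtype.ext (hinj i hzE hy hz)
  · rw [Function.extend_apply']
    · refine ENNReal.tsum_eq_zero.2 fun y => indicator_of_notMem (fun hy => hx ⟨y, hy, y.2⟩) _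
    · rintro ⟨y, rfl⟩; exact hx ⟨y, y.2, rfl⟩

theorem IsConformal.setLIntegral_tsum_fiber {J : I → ℝ≥0∞} {ν : Measure I}
    (hν : IsConformal f J ν) (hI : MeasurableSet I) (hf : Measurable f)
    (hbr : HasCountablyManyBranches f) (hJ : Measurable J)
    (w : I → ℝ≥0∞) (hw : Measurable w) {D : Set I} (hD : MeasurableSet D) :
    ∫⁻ x in D, ∑' y : f ⁻¹' {x}, w y ∂ν = ∫⁻ y in f ⁻¹' D, J y * w y ∂ν := by
  obtain ⟨E, hE, hinj, hdisj, hU⟩ := hbr.exists_disjoint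
  have : StandardBorelSpace I := hI.standardBorel
  simp_rw [tsum_fiber_eq hinj hdisj hU]
  rw [lintegral_tsum]
  · simp_rw [fun i => hν.setLIntegral_extend hI hf hJ (hE i) (hinj i) w hw hD]
    have hm : ∀ i, AEMeasurable ((E i).indicator fun y => J y * w y) (ν.restrict (f ⁻¹' D)) :=
      fun i => ((hJ.mul hw).indicator (hE i)).aemeasurable
    rw [← lintegral_tsum hm]
    congr 1
    ext y
    have hy : y ∈ ⋃ i, E i := hU ▸ mem_univ y
    obtain ⟨i, hi⟩ := mem_iUnion.1 hy
    rw [tsum_eq_single i, indicator_of_mem hi]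
    intro j hj
    exact indicator_of_notMem (fun hyj => (hdisj hj).le_bot ⟨hyj, hi⟩) _
  · intro i
    have : StandardBorelSpace (E i) := (hE i).standardBorel
    have he : MeasurableEmbedding fun y : E i => f y :=
      (hf.comp measurable_subtype_coe).measurableEmbedding (injOn_iff_injective.1 (hinj i))
    exact (he.measurable_extend (hw.comp measurable_subtype_coe) measurable_zero).aemeasurable

/-- Where `g` vanishes the Jacobian is `lam / 0 = ∞`, so a piece of positive mass inside one branch
would have an image of infinite measure. -/
theorem IsConformal.ae_pos {g : I → ℝ} {lam : ℝ} (hlam : 0 < lam) {ν : Measure I}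
    [IsProbabilityMeasure ν]
    (hν : IsConformal f (fun x => ENNReal.ofReal lam / ENNReal.ofReal (g x)) ν)
    (hbr : HasCountablyManyBranches f) (hg : Measurable g) :
    ∀ᵐ x ∂ν, 0 < g x := by
  obtain ⟨E, hE, hinj, -, hU⟩ := hbr.exists_disjoint
  have h : ∀ i, ν (E i ∩ {x | g x ≤ 0}) = 0 := by
    intro i
    by_contra hne
    have hm : MeasurableSet (E i ∩ {x | g x ≤ 0}) :=
      (hE i).inter (measurableSet_le hg measurable_const)
    have h1 := hν _ hm ((hinj i).mono inter_subset_left)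
    rw [setLIntegral_congr_fun (g := fun _ => ⊤) hm] at h1
    · rw [setLIntegral_const, ENNReal.top_mul hne] at h1
      exact measure_ne_top _ _ h1
    · intro x hx
      have hx2 : g x ≤ 0 := hx.2
      simp only [ENNReal.ofReal_of_nonpos hx2]
      exact ENNReal.div_zero (by simpa using hlam)
  rw [ae_iff]
  have : {x | ¬ 0 < g x} ⊆ ⋃ i, E i ∩ {x | g x ≤ 0} := by
    intro x hx
    have hy : x ∈ ⋃ i, E i := hU ▸ mem_univ x
    obtain ⟨i, hi⟩ := mem_iUnion.1 hy
    exact mem_iUnion.2 ⟨i, hi, not_lt.1 hx⟩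
  exact measure_mono_null this (measure_iUnion_null h)

theorem IsWeight.summable_mul {g : I → ℝ} (hg : IsWeight f g) {u : I → ℝ} {M : ℝ}
    (hu : ∀ x, |u x| ≤ M) (x : I) : Summable fun y : f ⁻¹' {x} => g y * u y := by
  refine Summable.of_norm_bounded ((hg.summable x).mul_right M) fun _ => ?_
  rw [norm_mul, Real.norm_of_nonneg (hg.nonneg _)]
  exact mul_le_mul_of_nonneg_left (hu _) (hg.nonneg _)

theorem ofReal_transfer {g : I → ℝ} (hg : IsWeight f g) {u : I → ℝ} {M : ℝ}
    (hu0 : ∀ x, 0 ≤ u x) (hu : ∀ x, |u x| ≤ M) (x : I) :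
    ENNReal.ofReal (transfer f g u x) =
      ∑' y : f ⁻¹' {x}, ENNReal.ofReal (g y) * ENNReal.ofReal (u y) := by
  unfold transfer
  rw [ENNReal.ofReal_tsum_of_nonneg (fun _ => mul_nonneg (hg.nonneg _) (hu0 _))
    (hg.summable_mul hu x)]
  exact tsum_congr fun y => ENNReal.ofReal_mul (hg.nonneg _)

theorem transfer_nonneg {g : I → ℝ} (hg : IsWeight f g) {u : I → ℝ}
    (hu0 : ∀ x, 0 ≤ u x) (x : I) : 0 ≤ transfer f g u x :=
  tsum_nonneg fun _ => mul_nonneg (hg.nonneg _) (hu0 _)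

/-- The Jacobian `lam / g` cancels the weight `g` almost everywhere, which says that `ν` is an
eigenmeasure of the dual operator with eigenvalue `lam`. -/
theorem setLIntegral_transfer {g : I → ℝ} {lam : ℝ} (hlam : 0 < lam) {ν : Measure I}
    [IsProbabilityMeasure ν] (hI : MeasurableSet I) (hf : Measurable f)
    (hν : IsConformal f (fun x => ENNReal.ofReal lam / ENNReal.ofReal (g x)) ν)
    (hbr : HasCountablyManyBranches f) (hg : IsWeight f g) {u : I → ℝ} {M : ℝ}
    (hu0 : ∀ x, 0 ≤ u x) (hu : ∀ x, |u x| ≤ M) (hum : Measurable u)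
    {D : Set I} (hD : MeasurableSet D) :
    ∫⁻ x in D, ENNReal.ofReal (transfer f g u x) ∂ν =
      ENNReal.ofReal lam * ∫⁻ x in f ⁻¹' D, ENNReal.ofReal (u x) ∂ν := by
  have hg' : Measurable fun x => ENNReal.ofReal (g x) := hg.measurable.ennreal_ofReal
  simp_rw [ofReal_transfer hg hu0 hu]
  rw [hν.setLIntegral_tsum_fiber hI hf hbr (measurable_const.div hg')
    (fun y => ENNReal.ofReal (g y) * ENNReal.ofReal (u y)) (hg'.mul hum.ennreal_ofReal) hD,
    ← lintegral_const_mul _ hum.ennreal_ofReal]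
  refine lintegral_congr_ae (ae_restrict_of_ae ?_)
  filter_upwards [hν.ae_pos hlam hbr hg.measurable] with x hx
  have h0 : ENNReal.ofReal (g x) ≠ 0 := by simpa using hx
  rw [← mul_assoc, ENNReal.div_mul_cancel h0 ENNReal.ofReal_ne_top]

end Transfer


/-! ### Mixing from the spectral gap. -/

/-- A Gibbs measure `μ = h ν` for the weight `g`: the measure `ν` is conformal, and the transfer
operator has a spectral gap with leading eigenvalue `lam` and eigenfunction `h`. -/
structure IsGibbs {I : Set ℝ} (f : I → I) (g h : I → ℝ) (lam : ℝ) (μ ν : Measure I) : Prop where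
  measurableSet : MeasurableSet I
  measurable : Measurable f
  branches : HasCountablyManyBranches f
  lam_pos : 0 < lam
  weight : IsWeight f g
  conformal : IsConformal f (fun x => ENNReal.ofReal lam / ENNReal.ofReal (g x)) ν
  nonneg : ∀ x, 0 ≤ h x
  density : μ = ν.withDensity fun x => ENNReal.ofReal (h x)
  gap : HasSpectralGap f g lam h

section Gibbs

variable {I : Set ℝ} {f : I → I} {g h : I → ℝ} {lam : ℝ} {μ ν : Measure I}

theorem IsBV.integrable {u : I → ℝ} (hu : IsBV u) (ν : Measure I) [IsFiniteMeasure ν] :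
    Integrable u ν :=
  Integrable.of_bound hu.measurable.aestronglyMeasurable _
    (Eventually.of_forall fun x => hu.abs_le x)

theorem isBV_transfer_iterate (hgap : HasSpectralGap f g lam h) {u : I → ℝ} (hu : IsBV u)
    (n : ℕ) : IsBV ((transfer f g)^[n] u) := by
  obtain ⟨hh, -, C, ρ, -, -, H⟩ := hgap
  obtain ⟨a, ha⟩ := H u hu
  have h1 : IsBV ((transfer f g)^[n] u - (lam ^ n * a) • h) :=
    ne_top_of_le_ne_top (ENNReal.mul_ne_top ENNReal.ofReal_ne_top hu) (ha n)
  have := h1.add (hh.smul (lam ^ n * a))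
  rwa [sub_add_cancel] at this

theorem transfer_iterate_nonneg (hg : IsWeight f g) {u : I → ℝ} (hu0 : ∀ x, 0 ≤ u x) (n : ℕ) :
    ∀ x, 0 ≤ (transfer f g)^[n] u x := by
  induction n with
  | zero => exact hu0
  | succ n ih =>
    rw [Function.iterate_succ_apply']
    exact transfer_nonneg hg ih

namespace IsGibbs

theorem real_eq_setIntegral (G : IsGibbs f g h lam μ ν) {D : Set I} (hD : MeasurableSet D) :
    μ.real D = ∫ x in D, h x ∂ν := by
  have hm : Measurable h := G.gap.1.measurable
  rw [measureReal_def, G.density, withDensity_apply _ hD,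
    integral_eq_lintegral_of_nonneg_ae (Eventually.of_forall G.nonneg) hm.aestronglyMeasurable]

theorem setIntegral_transfer [IsProbabilityMeasure ν] (G : IsGibbs f g h lam μ ν) {u : I → ℝ}
    (hu : IsBV u) (hu0 : ∀ x, 0 ≤ u x) {D : Set I} (hD : MeasurableSet D) :
    ∫ x in D, transfer f g u x ∂ν = lam * ∫ x in f ⁻¹' D, u x ∂ν := by
  have hL : IsBV (transfer f g u) := isBV_transfer_iterate G.gap hu 1
  rw [integral_eq_lintegral_of_nonneg_ae
      (Eventually.of_forall (transfer_nonneg G.weight hu0)) hL.measurable.aestronglyMeasurable,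
    integral_eq_lintegral_of_nonneg_ae (Eventually.of_forall hu0)
      hu.measurable.aestronglyMeasurable,
    setLIntegral_transfer G.lam_pos G.measurableSet G.measurable G.conformal G.branches G.weight
      hu0 hu.abs_le hu.measurable hD, ENNReal.toReal_mul, ENNReal.toReal_ofReal G.lam_pos.le]

theorem setIntegral_transfer_iterate [IsProbabilityMeasure ν] (G : IsGibbs f g h lam μ ν)
    {u : I → ℝ} (hu : IsBV u) (hu0 : ∀ x, 0 ≤ u x) (n : ℕ) {D : Set I} (hD : MeasurableSet D) :
    ∫ x in D, (transfer f g)^[n] u x ∂ν = lam ^ n * ∫ x in f^[n] ⁻¹' D, u x ∂ν := by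
  induction n generalizing D with
  | zero => simp
  | succ n ih =>
    rw [Function.iterate_succ_apply', G.setIntegral_transfer (isBV_transfer_iterate G.gap hu n)
      (transfer_iterate_nonneg G.weight hu0 n) hD, ih (G.measurable hD), ← preimage_comp,
      ← Function.iterate_succ', pow_succ]
    ring

/-- Identifies the coefficient of the spectral projection: integrating the gap estimate against `ν`,
where `∫ h dν = 1`, and letting `n → ∞` forces it to be `∫ u dν`. -/
theorem exists_gap_bound [IsProbabilityMeasure μ] [IsProbabilityMeasure ν]
    (G : IsGibbs f g h lam μ ν) :
    ∃ K κ : ℝ, 0 ≤ K ∧ 0 < κ ∧ κ < 1 ∧ ∀ u : I → ℝ, IsBV u → (∀ x, 0 ≤ u x) → ∀ n : ℕ,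
      eBVNorm ((transfer f g)^[n] u - (lam ^ n * ∫ x, u x ∂ν) • h) ≤
        ENNReal.ofReal (lam ^ n * (K * κ ^ n)) * eBVNorm u := by
  have hlam := G.lam_pos
  obtain ⟨hh, -, C, ρ, hρ0, hρ, H⟩ := G.gap
  -- The value `1 / 2` only keeps the rate strictly positive when `ρ = 0`.
  have hκ : max (ρ / lam) (1 / 2) < 1 := max_lt ((div_lt_one hlam).2 hρ) (by norm_num)
  have hκ0 : 0 < max (ρ / lam) (1 / 2) := lt_max_of_lt_right (by norm_num)
  set κ := max (ρ / lam) (1 / 2)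
  refine ⟨max C 0, κ, le_max_right _ _, hκ0, hκ, fun u hu hu0 => ?_⟩
  obtain ⟨a, ha⟩ := H u hu
  have hb : ∀ n : ℕ, C * ρ ^ n ≤ lam ^ n * (max C 0 * κ ^ n) := by
    intro n
    have h1 : ρ ^ n ≤ lam ^ n * κ ^ n := by
      rw [← mul_pow]
      refine pow_le_pow_left₀ hρ0 ?_ n
      calc ρ = lam * (ρ / lam) := by field_simp
        _ ≤ lam * κ := mul_le_mul_of_nonneg_left (le_max_left _ _) hlam.le
    calc C * ρ ^ n ≤ max C 0 * ρ ^ n :=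
          mul_le_mul_of_nonneg_right (le_max_left _ _) (pow_nonneg hρ0 n)
      _ ≤ max C 0 * (lam ^ n * κ ^ n) := mul_le_mul_of_nonneg_left h1 (le_max_right _ _)
      _ = _ := by ring
  have ha' : ∀ n : ℕ, eBVNorm ((transfer f g)^[n] u - (lam ^ n * a) • h) ≤
      ENNReal.ofReal (lam ^ n * (max C 0 * κ ^ n)) * eBVNorm u := fun n =>
    (ha n).trans (mul_le_mul' (ENNReal.ofReal_le_ofReal (hb n)) le_rfl)
  have hint : ∫ x, h x ∂ν = 1 := by
    have := G.real_eq_setIntegral (D := univ) MeasurableSet.univ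
    simpa using this.symm
  have hlim : ∀ n : ℕ, |(∫ x, u x ∂ν) - a| ≤ max C 0 * κ ^ n * (eBVNorm u).toReal := by
    intro n
    have hfin : ENNReal.ofReal (lam ^ n * (max C 0 * κ ^ n)) * eBVNorm u ≠ ⊤ :=
      ENNReal.mul_ne_top ENNReal.ofReal_ne_top hu
    have hBV : IsBV ((transfer f g)^[n] u - (lam ^ n * a) • h) :=
      ne_top_of_le_ne_top hfin (ha' n)
    have hpt : ∀ x, ‖((transfer f g)^[n] u - (lam ^ n * a) • h) x‖ ≤
        lam ^ n * (max C 0 * κ ^ n) * (eBVNorm u).toReal := by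
      intro x
      rw [Real.norm_eq_abs]
      refine (hBV.abs_le x).trans ((ENNReal.toReal_mono hfin (ha' n)).trans ?_)
      rw [ENNReal.toReal_mul, ENNReal.toReal_ofReal (by positivity)]
    have h1 : ∫ x, ((transfer f g)^[n] u - (lam ^ n * a) • h) x ∂ν =
        lam ^ n * ((∫ x, u x ∂ν) - a) := by
      have e1 := G.setIntegral_transfer_iterate hu hu0 n (D := univ) MeasurableSet.univ
      simp only [preimage_univ, setIntegral_univ] at e1
      simp only [Pi.sub_apply, Pi.smul_apply, smul_eq_mul]
      rw [integral_sub ((isBV_transfer_iterate G.gap hu n).integrable ν)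
        ((hh.integrable ν).const_mul _), e1, integral_const_mul, hint]
      ring
    have h2 := norm_integral_le_of_norm_le_const (μ := ν) (Eventually.of_forall hpt)
    rw [h1, Real.norm_eq_abs, abs_mul, abs_of_pos (pow_pos hlam n), probReal_univ, mul_one,
      mul_assoc] at h2
    exact le_of_mul_le_mul_left h2 (pow_pos hlam n)
  have h0 : |(∫ x, u x ∂ν) - a| ≤ 0 := by
    refine ge_of_tendsto' (x := atTop) ?_ hlim
    have := (tendsto_pow_atTop_nhds_zero_of_lt_one hκ0.le hκ).const_mul (max C 0)
    simpa using this.mul_const (eBVNorm u).toReal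
  have hau : ∫ x, u x ∂ν = a := by
    have := abs_nonpos_iff.1 h0
    linarith
  rw [hau]
  exact ha'

/-- The gap bound is uniform in the point, so it can be integrated over `D`. The error then carries
the factor `ν(D)`, which matters later when `D` is itself a small target. -/
theorem exists_mixing [IsProbabilityMeasure μ] [IsProbabilityMeasure ν]
    (G : IsGibbs f g h lam μ ν) :
    ∃ K κ : ℝ, 0 ≤ K ∧ 0 < κ ∧ κ < 1 ∧ ∀ u : I → ℝ, IsBV u → (∀ x, 0 ≤ u x) →
      ∀ (j : ℕ) (D : Set I), MeasurableSet D →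
        |(∫ x in f^[j] ⁻¹' D, u x ∂ν) - (∫ x, u x ∂ν) * μ.real D| ≤
          K * κ ^ j * (eBVNorm u).toReal * ν.real D := by
  obtain ⟨K, κ, hK, hκ0, hκ, H⟩ := G.exists_gap_bound
  refine ⟨K, κ, hK, hκ0, hκ, fun u hu hu0 j D hD => ?_⟩
  have hlam := G.lam_pos
  have hfin : ENNReal.ofReal (lam ^ j * (K * κ ^ j)) * eBVNorm u ≠ ⊤ :=
    ENNReal.mul_ne_top ENNReal.ofReal_ne_top hu
  have hBV := ne_top_of_le_ne_top hfin (H u hu hu0 j)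
  have hpt : ∀ x, ‖((transfer f g)^[j] u - (lam ^ j * ∫ x, u x ∂ν) • h) x‖ ≤
      lam ^ j * (K * κ ^ j) * (eBVNorm u).toReal := by
    intro x
    rw [Real.norm_eq_abs]
    refine (IsBV.abs_le hBV x).trans ((ENNReal.toReal_mono hfin (H u hu hu0 j)).trans ?_)
    rw [ENNReal.toReal_mul, ENNReal.toReal_ofReal (by positivity)]
  have h1 : ∫ x in D, ((transfer f g)^[j] u - (lam ^ j * ∫ x, u x ∂ν) • h) x ∂ν =
      lam ^ j * ((∫ x in f^[j] ⁻¹' D, u x ∂ν) - (∫ x, u x ∂ν) * μ.real D) := by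
    have e1 := G.setIntegral_transfer_iterate hu hu0 j hD
    simp only [Pi.sub_apply, Pi.smul_apply, smul_eq_mul]
    rw [integral_sub ((isBV_transfer_iterate G.gap hu j).integrable _)
      ((G.gap.1.integrable _).const_mul _), e1, integral_const_mul, G.real_eq_setIntegral hD]
    ring
  have h2 := norm_integral_le_of_norm_le_const (μ := ν.restrict D) (Eventually.of_forall hpt)
  rw [h1, Real.norm_eq_abs, abs_mul, abs_of_pos (pow_pos hlam j), measureReal_restrict_apply_univ,
    mul_assoc, mul_assoc] at h2
  have h3 := le_of_mul_le_mul_left h2 (pow_pos hlam j)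
  linarith

theorem exists_mixing_indicator [IsProbabilityMeasure μ] [IsProbabilityMeasure ν]
    (G : IsGibbs f g h lam μ ν) :
    ∃ K κ : ℝ, 0 ≤ K ∧ 0 < κ ∧ κ < 1 ∧ ∀ A : Set I, MeasurableSet A →
      IsBV (A.indicator fun _ => (1 : ℝ)) → ∀ (j : ℕ) (D : Set I), MeasurableSet D →
        |μ.real (A ∩ f^[j] ⁻¹' D) - μ.real A * μ.real D| ≤
          K * κ ^ j * (eBVNorm (A.indicator fun _ => (1 : ℝ))).toReal * ν.real D := by
  obtain ⟨K, κ, hK, hκ0, hκ, H⟩ := G.exists_mixing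
  refine ⟨K * (eBVNorm h).toReal, κ, by positivity, hκ0, hκ, fun A hA hBV j D hD => ?_⟩
  have h1 := H _ (hBV.mul G.gap.1) (fun x => mul_nonneg
    (indicator_nonneg (fun _ _ => zero_le_one) x) (G.nonneg x)) j D hD
  have hAh : (A.indicator fun _ => (1 : ℝ)) * h = A.indicator h := by
    ext x
    by_cases hx : x ∈ A <;> simp [hx]
  rw [hAh] at h1
  rw [setIntegral_indicator hA, integral_indicator hA, ← G.real_eq_setIntegral hA,
    ← G.real_eq_setIntegral ((G.measurable.iterate j hD).inter hA), inter_comm] at h1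
  refine h1.trans ?_
  have h2 : (eBVNorm (A.indicator h)).toReal ≤
      (eBVNorm (A.indicator fun _ => (1 : ℝ))).toReal * (eBVNorm h).toReal := by
    rw [← ENNReal.toReal_mul, ← hAh]
    exact ENNReal.toReal_mono (ENNReal.mul_ne_top hBV G.gap.1) (eBVNorm_mul_le _ _)
  have h3 : K * κ ^ j * (eBVNorm (A.indicator h)).toReal ≤ K * κ ^ j *
      ((eBVNorm (A.indicator fun _ => (1 : ℝ))).toReal * (eBVNorm h).toReal) :=
    mul_le_mul_of_nonneg_left h2 (by positivity)
  calc _ ≤ K * κ ^ j * ((eBVNorm (A.indicator fun _ => (1 : ℝ))).toReal *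
        (eBVNorm h).toReal) * ν.real D := mul_le_mul_of_nonneg_right h3 measureReal_nonneg
    _ = _ := by ring

end IsGibbs

end Gibbs

/-! ### Avoidance events and their mixing. -/

/-- The points whose first `l` iterates `x, f x, …, f^(l-1) x` stay outside `S`. -/
def avoid {α : Type*} (f : α → α) (S : Set α) (l : ℕ) : Set α := {x | ∀ i < l, f^[i] x ∉ S}

section Avoid

variable {α : Type*} {f : α → α} {S : Set α}

theorem avoid_add (f : α → α) (S : Set α) (a b : ℕ) :
    avoid f S (a + b) = avoid f S a ∩ f^[a] ⁻¹' avoid f S b := by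
  ext x
  simp only [avoid, mem_ofPred_eq, mem_inter_iff, mem_preimage, ← Function.iterate_add_apply]
  constructor
  · exact fun H => ⟨fun i hi => H i (by omega), fun i hi => H (i + a) (by omega)⟩
  · rintro ⟨H1, H2⟩ i hi
    rcases lt_or_ge i a with h | h
    · exact H1 i h
    · have := H2 (i - a) (by omega)
      rwa [Nat.sub_add_cancel h] at this

theorem avoid_one (f : α → α) (S : Set α) : avoid f S 1 = Sᶜ := by
  ext x; simp [avoid]

theorem avoid_anti {a b : ℕ} (hab : a ≤ b) : avoid f S b ⊆ avoid f S a :=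
  fun _ hx i hi => hx i (hi.trans_le hab)

theorem avoid_subset_avoid {T : Set α} (hST : S ⊆ T) (l : ℕ) : avoid f T l ⊆ avoid f S l :=
  fun _ hx i hi h => hx i hi (hST h)

theorem measurableSet_avoid [MeasurableSpace α] (hf : Measurable f) (hS : MeasurableSet S)
    (l : ℕ) : MeasurableSet (avoid f S l) := by
  have : avoid f S l = ⋂ i, ⋂ _ : i < l, f^[i] ⁻¹' Sᶜ := by
    ext x; simp [avoid]
  rw [this]
  exact MeasurableSet.iInter fun i => MeasurableSet.iInter fun _ => hf.iterate i hS.compl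

end Avoid

namespace IsGibbs

variable {I : Set ℝ} {f : I → I} {g h : I → ℝ} {lam : ℝ} {μ ν : Measure I}

/-- Iterates of the twisted operator `v ↦ 𝓛(1_{Sᶜ} v)` applied to `h` encode avoidance of `S`. Their
`BV` norm grows at most geometrically in `m`, after which a gap of `j` steps gains `κ ^ j`. The
bound is crude, but effective when `j` is much larger than `m`. -/
theorem exists_avoid_mixing [IsProbabilityMeasure μ] [IsProbabilityMeasure ν]
    (G : IsGibbs f g h lam μ ν) {R : ℝ≥0∞} (hR : R ≠ ⊤) :
    ∃ K κ : ℝ, 1 ≤ K ∧ 0 < κ ∧ κ < 1 ∧ ∀ S : Set I, MeasurableSet S →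
      eBVNorm (Sᶜ.indicator fun _ => (1 : ℝ)) ≤ R →
      ∀ (m j : ℕ) (D : Set I), MeasurableSet D →
        |μ.real (avoid f S m ∩ f^[m + j] ⁻¹' D) - μ.real (avoid f S m) * μ.real D| ≤
          K ^ (m + 1) * κ ^ j := by
  have hlam := G.lam_pos
  obtain ⟨K₁, κ₁, hK₁, hκ₁0, hκ₁, H₁⟩ := G.exists_gap_bound
  obtain ⟨K, κ, hK, hκ0, hκ, H⟩ := G.exists_mixing
  set M : ℝ≥0∞ := ENNReal.ofReal (lam ^ 1 * (K₁ * κ₁ ^ 1)) + ENNReal.ofReal lam * eBVNorm h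
    with hM
  have hMtop : M ≠ ⊤ := ENNReal.add_ne_top.2 ⟨ENNReal.ofReal_ne_top,
    ENNReal.mul_ne_top ENNReal.ofReal_ne_top G.gap.1⟩
  -- On nonnegative functions one application of `𝓛` is bounded in `BV`: use the gap bound at `n =
  -- 1` and add back the projection term.
  have hstep : ∀ u : I → ℝ, IsBV u → (∀ x, 0 ≤ u x) →
      eBVNorm (transfer f g u) ≤ M * eBVNorm u := by
    intro u hu hu0
    have h1 := H₁ u hu hu0 1
    have h2 : eBVNorm ((lam ^ 1 * ∫ x, u x ∂ν) • h) ≤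
        ENNReal.ofReal lam * eBVNorm h * eBVNorm u := by
      refine (eBVNorm_smul_le _ _).trans ?_
      have hi : ‖lam ^ 1 * ∫ x, u x ∂ν‖ₑ ≤ ENNReal.ofReal lam * eBVNorm u := by
        rw [pow_one, enorm_mul, Real.enorm_eq_ofReal hlam.le]
        refine mul_le_mul' le_rfl ((enorm_integral_le_lintegral_enorm _).trans ?_)
        refine (lintegral_mono fun x => enorm_le_eBVNorm u x).trans ?_
        simp
      calc _ ≤ ENNReal.ofReal lam * eBVNorm u * eBVNorm h := mul_le_mul' hi le_rfl
        _ = _ := by ring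
    have h3 := eBVNorm_add_le ((transfer f g)^[1] u - (lam ^ 1 * ∫ x, u x ∂ν) • h)
      ((lam ^ 1 * ∫ x, u x ∂ν) • h)
    rw [sub_add_cancel] at h3
    refine h3.trans ((add_le_add h1 h2).trans (le_of_eq ?_))
    rw [hM]; ring
  set K' : ℝ := max 1 (max (K * (eBVNorm h).toReal) ((M * R).toReal / lam)) with hK'
  have hK'1 : 1 ≤ K' := le_max_left _ _
  refine ⟨K', κ, hK'1, hκ0, hκ, fun S hS hSR m j D hD => ?_⟩
  set T : (I → ℝ) → I → ℝ := fun v => transfer f g ((Sᶜ.indicator fun _ => (1 : ℝ)) * v)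
    with hT
  have h01 : ∀ x, 0 ≤ Sᶜ.indicator (fun _ => (1 : ℝ)) x :=
    fun x => indicator_nonneg (fun _ _ => zero_le_one) x
  have hSBV : IsBV (Sᶜ.indicator fun _ => (1 : ℝ)) := ne_top_of_le_ne_top hR hSR
  have hTm : ∀ m, IsBV (T^[m] h) ∧ (∀ x, 0 ≤ T^[m] h x) ∧
      eBVNorm (T^[m] h) ≤ (M * R) ^ m * eBVNorm h := by
    intro m
    induction m with
    | zero => exact ⟨G.gap.1, G.nonneg, by simp⟩
    | succ m ih =>
      obtain ⟨i1, i2, i3⟩ := ih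
      rw [Function.iterate_succ_apply']
      have e1 := hSBV.mul i1
      have e2 : ∀ x, 0 ≤ ((Sᶜ.indicator fun _ => (1 : ℝ)) * T^[m] h) x :=
        fun x => mul_nonneg (h01 x) (i2 x)
      refine ⟨isBV_transfer_iterate G.gap e1 1, transfer_nonneg G.weight e2,
        (hstep _ e1 e2).trans ?_⟩
      calc _ ≤ M * (R * ((M * R) ^ m * eBVNorm h)) := mul_le_mul' le_rfl
            ((eBVNorm_mul_le _ _).trans (mul_le_mul' hSR i3))
        _ = _ := by rw [pow_succ]; ring
  obtain ⟨t1, t2, t3⟩ := hTm m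
  -- The `m`-th twisted iterate of `h` has, up to `lam ^ m`, the `ν`-integral over `D` equal to the
  -- `μ`-mass of the points that avoid `S` for `m` steps and land in `D`.
  have hint : ∀ (m : ℕ) (D : Set I), MeasurableSet D →
      ∫ x in D, T^[m] h x ∂ν = lam ^ m * μ.real (avoid f S m ∩ f^[m] ⁻¹' D) := by
    intro m
    induction m with
    | zero =>
      intro D hD
      simp [avoid, G.real_eq_setIntegral hD]
    | succ m ih =>
      intro D hD
      obtain ⟨i1, i2, -⟩ := hTm m
      have hind : (Sᶜ.indicator fun _ => (1 : ℝ)) * T^[m] h = Sᶜ.indicator (T^[m] h) := by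
        ext x
        by_cases hx : x ∈ S <;> simp [hx]
      rw [Function.iterate_succ_apply', hT, G.setIntegral_transfer (hSBV.mul i1)
        (fun x => mul_nonneg (h01 x) (i2 x)) hD, hind, setIntegral_indicator hS.compl,
        ih _ ((G.measurable hD).inter hS.compl), avoid_add, avoid_one, preimage_inter,
        ← preimage_comp, ← Function.iterate_succ', inter_assoc, inter_comm (f^[m] ⁻¹' Sᶜ)]
      ring
  have h1 := H _ t1 t2 j D hD
  rw [hint _ _ (G.measurable.iterate j hD), ← setIntegral_univ, hint _ _ MeasurableSet.univ,
    preimage_univ, inter_univ, ← preimage_comp, ← Function.iterate_add, add_comm j m, mul_assoc,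
    ← mul_sub, abs_mul, abs_of_pos (pow_pos hlam m)] at h1
  have h2 : (eBVNorm (T^[m] h)).toReal ≤ (M * R).toReal ^ m * (eBVNorm h).toReal := by
    have := ENNReal.toReal_mono (ENNReal.mul_ne_top (ENNReal.pow_ne_top
      (ENNReal.mul_ne_top hMtop hR)) G.gap.1) t3
    rwa [ENNReal.toReal_mul, ENNReal.toReal_pow] at this
  have h3 : (M * R).toReal ^ m ≤ lam ^ m * K' ^ m := by
    rw [← mul_pow]
    refine pow_le_pow_left₀ ENNReal.toReal_nonneg ?_ m
    calc (M * R).toReal = lam * ((M * R).toReal / lam) := by field_simp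
      _ ≤ lam * K' := mul_le_mul_of_nonneg_left
          ((le_max_right _ _).trans (le_max_right _ _)) hlam.le
  have h4 : K * (eBVNorm h).toReal ≤ K' := (le_max_left _ _).trans (le_max_right _ _)
  refine le_of_mul_le_mul_left (h1.trans ?_) (pow_pos hlam m)
  calc K * κ ^ j * (eBVNorm (T^[m] h)).toReal * ν.real D
      ≤ K * κ ^ j * (eBVNorm (T^[m] h)).toReal * 1 :=
        mul_le_mul_of_nonneg_left measureReal_le_one (by positivity)
    _ ≤ K * κ ^ j * ((lam ^ m * K' ^ m) * (eBVNorm h).toReal) := by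
        rw [mul_one]
        refine mul_le_mul_of_nonneg_left (h2.trans ?_) (by positivity)
        exact mul_le_mul_of_nonneg_right h3 ENNReal.toReal_nonneg
    _ = K * (eBVNorm h).toReal * (lam ^ m * K' ^ m * κ ^ j) := by ring
    _ ≤ K' * (lam ^ m * K' ^ m * κ ^ j) := mul_le_mul_of_nonneg_right h4 (by positivity)
    _ = _ := by ring

end IsGibbs


/-! ### Power laws from geometric scaling. -/

section RealLemmas

/-- The exponent `β = log C / log Λ` solves `Λ ^ β = C`, so the doubling inequality carries the
lower bound from scale `Λ r` to scale `r`. The induction starts from the scales between `δ / Λ` and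
`δ`. -/
theorem exists_rpow_le_of_doubling {φ : ℝ → ℝ} {Λ C δ : ℝ} (hmono : Monotone φ)
    (hpos : ∀ r, 0 < r → 0 < φ r) (hΛ : 1 < Λ) (hC : 1 < C) (hδ : 0 < δ)
    (hφ : ∀ r, 0 < r → r ≤ δ → φ (Λ * r) ≤ C * φ r) :
    ∃ β c : ℝ, 0 < β ∧ 0 < c ∧ ∀ r, 0 < r → r ≤ δ → c * r ^ β ≤ φ r := by
  have hΛ0 : 0 < Λ := by linarith
  have hC0 : 0 < C := by linarith
  have hβ : 0 < Real.log C / Real.log Λ := div_pos (Real.log_pos hC) (Real.log_pos hΛ)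
  have hΛβ : Λ ^ (Real.log C / Real.log Λ) = C := by
    rw [Real.rpow_def_of_pos hΛ0, mul_div_cancel₀ _ (Real.log_pos hΛ).ne', Real.exp_log hC0]
  set β := Real.log C / Real.log Λ
  have hδβ : 0 < δ ^ β := Real.rpow_pos_of_pos hδ β
  have hc : 0 < φ (δ / Λ) / δ ^ β := div_pos (hpos _ (div_pos hδ hΛ0)) hδβ
  refine ⟨β, φ (δ / Λ) / δ ^ β, hβ, hc, ?_⟩
  set c := φ (δ / Λ) / δ ^ β with hcdef
  have key : ∀ n : ℕ, ∀ r, 0 < r → r ≤ δ → δ < Λ ^ (n + 1) * r → c * r ^ β ≤ φ r := by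
    have base : ∀ r, 0 < r → r ≤ δ → δ < Λ * r → c * r ^ β ≤ φ r := by
      intro r hr hrδ h
      calc c * r ^ β ≤ c * δ ^ β :=
            mul_le_mul_of_nonneg_left (Real.rpow_le_rpow hr.le hrδ hβ.le) hc.le
        _ = φ (δ / Λ) := by rw [hcdef]; field_simp
        _ ≤ φ r := hmono (by rw [div_le_iff₀ hΛ0]; linarith)
    intro n
    induction n with
    | zero => intro r hr hrδ h; exact base r hr hrδ (by simpa using h)
    | succ n ih =>
      intro r hr hrδ h
      rcases lt_or_ge δ (Λ * r) with h' | h'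
      · exact base r hr hrδ h'
      · have h1 := ih (Λ * r) (by positivity) h' (by rw [pow_succ] at h; linarith)
        rw [Real.mul_rpow hΛ0.le hr.le, hΛβ] at h1
        have h2 := h1.trans (hφ r hr hrδ)
        refine le_of_mul_le_mul_left ?_ hC0
        linarith
  intro r hr hrδ
  obtain ⟨n, -, hn⟩ := exists_nat_pow_near (x := δ / r) (by rwa [one_le_div hr]) hΛ
  exact key n r hr hrδ (by rwa [div_lt_iff₀ hr] at hn)

/-- The witness is the largest `i` with `r Λ ^ i ≤ δ`, the number of expansion steps before
macroscopic scale. It is of order `log (1 / r)`, so `κ ^ i` is bounded by a power of `r`. -/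
theorem exists_pow_le_rpow {Λ κ δ : ℝ} (hΛ : 1 < Λ) (hκ0 : 0 < κ) (hκ : κ < 1) (hδ : 0 < δ) :
    ∃ β C : ℝ, 0 < β ∧ 0 < C ∧ ∀ r, 0 < r → r ≤ δ →
      ∃ i : ℕ, r * Λ ^ i ≤ δ ∧ κ ^ i ≤ C * r ^ β := by
  have hΛ0 : 0 < Λ := by linarith
  have hβ : 0 < -Real.log κ / Real.log Λ :=
    div_pos (by linarith [Real.log_neg hκ0 hκ]) (Real.log_pos hΛ)
  have hΛβ : Λ ^ (-Real.log κ / Real.log Λ) = κ⁻¹ := by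
    rw [Real.rpow_def_of_pos hΛ0, mul_div_cancel₀ _ (Real.log_pos hΛ).ne', Real.exp_neg,
      Real.exp_log hκ0]
  set β := -Real.log κ / Real.log Λ
  have hδβ : 0 < δ ^ β := Real.rpow_pos_of_pos hδ β
  refine ⟨β, (κ * δ ^ β)⁻¹, hβ, by positivity, fun r hr hrδ => ?_⟩
  obtain ⟨n, hn1, hn2⟩ := exists_nat_pow_near (x := δ / r) (by rwa [one_le_div hr]) hΛ
  rw [le_div_iff₀ hr] at hn1
  rw [div_lt_iff₀ hr] at hn2
  refine ⟨n, by linarith, ?_⟩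
  have h1 := Real.rpow_le_rpow hδ.le hn2.le hβ.le
  rw [Real.mul_rpow (by positivity) hr.le, ← Real.rpow_natCast, ← Real.rpow_mul hΛ0.le,
    mul_comm _ β, Real.rpow_mul hΛ0.le, hΛβ, Real.rpow_natCast, inv_pow,
    ← div_eq_inv_mul, le_div_iff₀ (by positivity), pow_succ] at h1
  rw [← div_eq_inv_mul, le_div_iff₀ (by positivity)]
  linarith

end RealLemmas

/-! ### Local dynamics at the hyperbolic periodic point. -/

section Local

variable {I : Set ℝ} {f : I → I} {q : ℕ} {xt : I}

theorem ordConnected_ball (x : I) (r : ℝ) : (Metric.ball x r).OrdConnected := by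
  refine ⟨fun a ha b hb c hc => ?_⟩
  rw [Metric.mem_ball, Subtype.dist_eq, Real.dist_eq, abs_lt] at *
  have h1 : (a : ℝ) ≤ c := hc.1
  have h2 : (c : ℝ) ≤ b := hc.2
  constructor <;> linarith

theorem exists_forall_abs_sub_le_of_hasStrictDerivAt {F : ℝ → ℝ} {c x η : ℝ}
    (hF : HasStrictDerivAt F c x) (hη : 0 < η) :
    ∃ δ > 0, ∀ y z, |y - x| < δ → |z - x| < δ → |F y - F z - c * (y - z)| ≤ η * |y - z| := by
  have h1 := hF.hasStrictFDerivAt.isLittleO.def hη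
  obtain ⟨δ, hδ, h⟩ := Metric.eventually_nhds_iff.1 h1
  refine ⟨δ, hδ, fun y z hy hz => ?_⟩
  have := h (y := (y, z)) (by rw [Prod.dist_eq]; exact max_lt hy hz)
  simpa [mul_comm] using this

/-- Near its fixed point `G` expands by at least `(c + 1) / 2`, so the image of the contracted point
`w` lies beyond `z` and the intermediate value theorem applies. Finding `t` between `x` and `z`
ensures that the preimage stays inside the interval `I`. -/
theorem exists_mem_uIcc_eq_of_abs_sub_le {G : ℝ → ℝ} {c x δ r z : ℝ} (hG : G x = x) (hc : 1 < c)
    (hlin : ∀ y z, |y - x| < δ → |z - x| < δ → |G y - G z - c * (y - z)| ≤ (c - 1) / 2 * |y - z|)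
    (hr : r ≤ δ) (hz : |z - x| < (c + 1) / 2 * r) :
    ∃ t ∈ uIcc x z, |t - x| < r ∧ G t = z := by
  have hΛ : 1 < (c + 1) / 2 := by linarith
  set Λ := (c + 1) / 2 with hΛdef
  have hΛ0 : 0 < Λ := by linarith
  set w := x + (z - x) / Λ with hw
  have hwx : w - x = (z - x) / Λ := by rw [hw]; ring
  have hwr : |w - x| < r := by
    rw [hwx, abs_div, abs_of_pos hΛ0, div_lt_iff₀ hΛ0]
    linarith
  have hzw : z - x = Λ * (w - x) := by rw [hwx]; field_simp
  have hsub : ∀ t ∈ uIcc x w, |t - x| ≤ |w - x| := by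
    intro t ht
    exact abs_sub_left_of_mem_uIcc ht
  have hcont : ContinuousOn G (uIcc x w) := by
    have hL : LipschitzOnWith (Real.toNNReal (c + (c - 1) / 2)) G (uIcc x w) := by
      refine LipschitzOnWith.of_dist_le_mul fun y hy z hz => ?_
      rw [Real.coe_toNNReal _ (by linarith), Real.dist_eq, Real.dist_eq]
      have h1 := hlin y z (((hsub y hy).trans_lt hwr).trans_le hr)
        (((hsub z hz).trans_lt hwr).trans_le hr)
      have h2 := abs_sub_abs_le_abs_sub (G y - G z) (c * (y - z))
      rw [abs_mul, abs_of_pos (by linarith : 0 < c)] at h2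
      linarith
    exact hL.continuousOn
  have hx0 : |x - x| < δ := by
    rw [sub_self, abs_zero]
    exact ((abs_nonneg _).trans_lt hwr).trans_le hr
  have h1 := abs_le.1 (hlin w x (hwr.trans_le hr) hx0)
  rw [hG] at h1
  have hzw' := hzw
  rw [hΛdef] at hzw'
  have hmem : z ∈ uIcc (G x) (G w) := by
    rw [hG, mem_uIcc]
    rcases le_total 0 (w - x) with h | h
    · left
      rw [abs_of_nonneg h] at h1
      have := mul_nonneg hΛ0.le h
      constructor <;> linarith
    · right
      rw [abs_of_nonpos h] at h1
      have := mul_nonneg hΛ0.le (neg_nonneg.2 h)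
      constructor <;> linarith
  obtain ⟨t, ht, htz⟩ := intermediate_value_uIcc hcont hmem
  refine ⟨t, ?_, (hsub t ht).trans_lt hwr, htz⟩
  -- Since `Λ > 1`, the point `w` itself lies between `x` and `z`.
  refine uIcc_subset_uIcc left_mem_uIcc ?_ ht
  rw [mem_uIcc]
  rcases le_total 0 (w - x) with h | h
  · left
    have := mul_le_mul_of_nonneg_right hΛ.le h
    constructor <;> linarith
  · right
    have := mul_le_mul_of_nonneg_right hΛ.le (neg_nonneg.2 h)
    constructor <;> linarith

namespace IsHyperbolicPeriodicPt

theorem iterate_eq (hx : IsHyperbolicPeriodicPt f q xt) : f^[q] xt = xt := by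
  have := Function.iterate_minimalPeriod (f := f) (x := xt)
  rwa [hx.period] at this

theorem iterate_mod_eq (hx : IsHyperbolicPeriodicPt f q xt) (i : ℕ) :
    f^[i % q] xt = f^[i] xt := by
  have := Function.iterate_mod_minimalPeriod_eq (f := f) (x := xt) (n := i)
  rwa [hx.period] at this

theorem continuousAt_iterate (hx : IsHyperbolicPeriodicPt f q xt) (i : ℕ) :
    ContinuousAt f^[i] xt := by
  induction i with
  | zero => exact continuousAt_id
  | succ i ih =>
    rw [Function.iterate_succ']
    refine ContinuousAt.comp ?_ ih
    rw [← hx.iterate_mod_eq i]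
    exact hx.continuousAt _ (Nat.mod_lt _ hx.pos)

theorem iterate_ne (hx : IsHyperbolicPeriodicPt f q xt) {k : ℕ} (hk0 : 0 < k) (hk : k < q) :
    f^[k] xt ≠ xt := by
  intro h
  have := Function.IsPeriodicPt.minimalPeriod_le hk0 (f := f) (x := xt) h
  rw [hx.period] at this
  omega

/-- The intermediate points of the orbit differ from `xt`, and the iterates are continuous at `xt`;
the radius is shrunk once for each of the finitely many times. -/
theorem exists_no_early_return (hx : IsHyperbolicPeriodicPt f q xt) :
    ∃ δ > 0, ∀ k, 0 < k → k < q → ∀ y ∈ Metric.ball xt δ, f^[k] y ∉ Metric.ball xt δ := by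
  have h : ∀ n ≤ q, ∃ δ > 0, ∀ k, 0 < k → k < n →
      ∀ y ∈ Metric.ball xt δ, f^[k] y ∉ Metric.ball xt δ := by
    intro n
    induction n with
    | zero => exact fun _ => ⟨1, one_pos, fun k _ hk => absurd hk (by omega)⟩
    | succ n ih =>
      intro hn
      obtain ⟨δ, hδ, H⟩ := ih (by omega)
      rcases Nat.eq_zero_or_pos n with rfl | hn0
      · exact ⟨1, one_pos, fun k h0 hk => absurd hk (by omega)⟩
      · have hne := hx.iterate_ne hn0 (by omega : n < q)
        set d := dist (f^[n] xt) xt with hd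
        have hd0 : 0 < d := dist_pos.2 hne
        obtain ⟨δ', hδ', H'⟩ := Metric.continuousAt_iff.1 (hx.continuousAt_iterate n) (d / 2)
          (half_pos hd0)
        refine ⟨min δ (min δ' (d / 2)), by positivity, fun k hk0 hk y hy hfy => ?_⟩
        rw [Metric.mem_ball] at hy hfy
        rcases Nat.lt_succ_iff_lt_or_eq.1 hk with hk | rfl
        · exact H k hk0 hk y (Metric.mem_ball.2 (hy.trans_le (min_le_left _ _)))
            (Metric.mem_ball.2 (hfy.trans_le (min_le_left _ _)))
        · have h1 := H' (hy.trans_le ((min_le_right _ _).trans (min_le_left _ _)))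
          have h2 := hfy.trans_le ((min_le_right _ _).trans (min_le_right _ _))
          have h3 := dist_triangle_left (f^[k] xt) xt (f^[k] y)
          linarith
  exact h q le_rfl

theorem exists_hasStrictDerivAt (hx : IsHyperbolicPeriodicPt f q xt) :
    ∃ (F : ℝ → ℝ) (c : ℝ), HasStrictDerivAt F c xt ∧
      (∀ᶠ y : I in 𝓝 xt, ((f^[q] y : I) : ℝ) = F y) ∧ |c| ≠ 1 := by
  obtain ⟨F, hF, hFf, hne⟩ := hx.hyperbolic
  exact ⟨F, _, hF.hasStrictDerivAt (by simp), hFf, hne⟩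

/-- At an attracting periodic point all points of a small ball return after `q` steps. -/
theorem dichotomy (hx : IsHyperbolicPeriodicPt f q xt) :
    (∃ δ > 0, ∀ r ≤ δ, escapeSet f q (Metric.ball xt r) = ∅) ∨
    (∃ (F : ℝ → ℝ) (c Λ₁ Λ₂ δ : ℝ), HasStrictDerivAt F c xt ∧ 1 < |c| ∧
      1 < Λ₁ ∧ 1 < Λ₂ ∧ 0 < δ ∧ (∀ y ∈ Metric.ball xt δ, ((f^[q] y : I) : ℝ) = F y) ∧
      ∀ y ∈ Metric.ball xt δ, ∀ z ∈ Metric.ball xt δ,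
        Λ₁ * dist y z ≤ dist (f^[q] y) (f^[q] z) ∧ dist (f^[q] y) (f^[q] z) ≤ Λ₂ * dist y z ∧
        ∀ w ∈ Metric.ball xt δ, y ≤ w → w ≤ z → f^[q] w ∈ uIcc (f^[q] y) (f^[q] z)) := by
  obtain ⟨F, c, hF, hFf, hne⟩ := hx.exists_hasStrictDerivAt
  have H : ∀ η > 0, ∃ δ > 0, (∀ y ∈ Metric.ball xt δ, ((f^[q] y : I) : ℝ) = F y) ∧
      ∀ y ∈ Metric.ball xt δ, ∀ z ∈ Metric.ball xt δ,
      |((f^[q] y : I) : ℝ) - (f^[q] z : I) - c * ((y : ℝ) - z)| ≤ η * dist y z := by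
    intro η hη
    obtain ⟨δ, hδ, H⟩ := exists_forall_abs_sub_le_of_hasStrictDerivAt hF hη
    obtain ⟨δ', hδ', H'⟩ := Metric.eventually_nhds_iff.1 hFf
    refine ⟨min δ δ', by positivity,
      fun y hy => H' ((Metric.mem_ball.1 hy).trans_le (min_le_right _ _)), fun y hy z hz => ?_⟩
    rw [Metric.mem_ball] at hy hz
    rw [H' (hy.trans_le (min_le_right _ _)), H' (hz.trans_le (min_le_right _ _))]
    exact H y z (hy.trans_le (min_le_left _ _)) (hz.trans_le (min_le_left _ _))
  rcases lt_or_gt_of_ne hne with hc | hc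
  · left
    -- With tolerance `1 - |c|` the map `f^q` does not increase the distance to `xt`, so every point
    -- of a small ball is back in it at time `q`.
    obtain ⟨δ, hδ, -, H⟩ := H (1 - |c|) (by linarith)
    refine ⟨δ, hδ, fun r hr => ?_⟩
    rw [eq_empty_iff_forall_notMem]
    rintro y ⟨hy, hyq⟩
    refine (mem_iInter₂.1 hyq q ⟨hx.pos, le_rfl⟩) ?_
    have h1 := H y (Metric.ball_subset_ball hr hy) xt (Metric.mem_ball_self hδ)
    rw [mem_preimage, Metric.mem_ball]
    refine lt_of_le_of_lt ?_ (Metric.mem_ball.1 hy)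
    have h2 : dist (f^[q] y) xt = |((f^[q] y : I) : ℝ) - (f^[q] xt : I)| := by
      rw [hx.iterate_eq]; rfl
    have h3 : dist y xt = |(y : ℝ) - xt| := rfl
    rw [h2]
    calc |((f^[q] y : I) : ℝ) - (f^[q] xt : I)|
        = |(((f^[q] y : I) : ℝ) - (f^[q] xt : I) - c * ((y : ℝ) - xt)) + c * ((y : ℝ) - xt)| := by
          ring_nf
      _ ≤ (1 - |c|) * dist y xt + |c| * dist y xt := by
          refine (abs_add_le _ _).trans (add_le_add h1 ?_)
          rw [abs_mul, h3]
      _ = dist y xt := by ring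
  · right
    -- Half the excess of `|c|` over 1 gives the expansion bounds `(|c| + 1) / 2` and `(3|c| - 1) /
    -- 2`. It is also smaller than `|c|`, which makes `f^q` monotone near `xt`.
    obtain ⟨δ, hδ, HF, H⟩ := H ((|c| - 1) / 2) (by linarith)
    refine ⟨F, c, (|c| + 1) / 2, (3 * |c| - 1) / 2, δ, hF, hc, by linarith, by linarith, hδ, HF,
      fun y hy z hz => ?_⟩
    have h1 := H y hy z hz
    have h2 : dist (f^[q] y) (f^[q] z) = |((f^[q] y : I) : ℝ) - (f^[q] z : I)| := rfl
    have h3 : dist y z = |(y : ℝ) - z| := rfl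
    have h4 : |c * ((y : ℝ) - z)| = |c| * dist y z := by rw [abs_mul, h3]
    have h5 := abs_sub_abs_le_abs_sub (((f^[q] y : I) : ℝ) - (f^[q] z : I)) (c * ((y : ℝ) - z))
    have h6 := abs_sub_abs_le_abs_sub (c * ((y : ℝ) - z)) (((f^[q] y : I) : ℝ) - (f^[q] z : I))
    rw [abs_sub_comm (c * ((y : ℝ) - z))] at h6
    refine ⟨by rw [h2]; linarith, by rw [h2]; linarith, fun w hw hyw hwz => ?_⟩
    have hyw' : (y : ℝ) ≤ w := hyw
    have hwz' : (w : ℝ) ≤ z := hwz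
    have e1 := abs_le.1 (H y hy w hw)
    have e2 := abs_le.1 (H w hw z hz)
    have d1 : dist y w = w - y := by
      rw [Subtype.dist_eq, Real.dist_eq, abs_of_nonpos (by linarith)]; ring
    have d2 : dist w z = z - w := by
      rw [Subtype.dist_eq, Real.dist_eq, abs_of_nonpos (by linarith)]; ring
    rw [d1] at e1
    rw [d2] at e2
    rw [mem_uIcc]
    rcases lt_abs.1 hc with hc' | hc'
    · left
      rw [abs_of_pos (by linarith)] at e1 e2
      have p1 := mul_nonneg (by linarith : 0 ≤ c + 1) (sub_nonneg.2 hyw')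
      have p2 := mul_nonneg (by linarith : 0 ≤ c + 1) (sub_nonneg.2 hwz')
      exact ⟨show ((f^[q] y : I) : ℝ) ≤ (f^[q] w : I) by linarith,
        show ((f^[q] w : I) : ℝ) ≤ (f^[q] z : I) by linarith⟩
    · right
      rw [abs_of_neg (by linarith)] at e1 e2
      have p1 := mul_nonneg (by linarith : 0 ≤ -c + 1) (sub_nonneg.2 hyw')
      have p2 := mul_nonneg (by linarith : 0 ≤ -c + 1) (sub_nonneg.2 hwz')
      exact ⟨show ((f^[q] z : I) : ℝ) ≤ (f^[q] w : I) by linarith,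
        show ((f^[q] w : I) : ℝ) ≤ (f^[q] y : I) by linarith⟩

/-- At a repelling periodic point, `f^(2q)` maps small balls over larger concentric balls. -/
theorem exists_ball_subset_image (hx : IsHyperbolicPeriodicPt f q xt) (hI : I.OrdConnected)
    {F : ℝ → ℝ} {c Λ₁ Λ₂ δ : ℝ} (hF : HasStrictDerivAt F c xt) (hc : 1 < |c|)
    (hΛ₁ : 1 < Λ₁) (hΛ₂ : 1 < Λ₂) (hδ : 0 < δ)
    (hFf : ∀ y ∈ Metric.ball xt δ, ((f^[q] y : I) : ℝ) = F y)
    (hexp : ∀ y ∈ Metric.ball xt δ, ∀ z ∈ Metric.ball xt δ,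
      Λ₁ * dist y z ≤ dist (f^[q] y) (f^[q] z) ∧ dist (f^[q] y) (f^[q] z) ≤ Λ₂ * dist y z) :
    ∃ Λ δ' : ℝ, 1 < Λ ∧ 0 < δ' ∧ InjOn f^[2 * q] (Metric.ball xt δ') ∧
      ∀ r ≤ δ', Metric.ball xt (Λ * r) ⊆ f^[2 * q] '' Metric.ball xt r := by
  have hxt := Metric.mem_ball_self (x := xt) hδ
  have hFx : F xt = xt := by rw [← hFf xt hxt, hx.iterate_eq]
  -- The second iterate of `f^q` is used because its derivative is positive: preimages then stay on
  -- the same side of `xt`, which matters when `I` does not extend to both sides.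
  have hG : HasStrictDerivAt (F ∘ F) (c * c) xt := by
    refine HasStrictDerivAt.comp (xt : ℝ) ?_ hF
    rwa [hFx]
  have hcc : 1 < c * c := by
    rw [← abs_mul_abs_self]
    nlinarith
  obtain ⟨δ₁, hδ₁, H⟩ := exists_forall_abs_sub_le_of_hasStrictDerivAt hG
    (by linarith : 0 < (c * c - 1) / 2)
  have hδ₂ : 0 < δ / Λ₂ := by positivity
  have hδ₂' : δ / Λ₂ ≤ δ := div_le_self hδ.le hΛ₂.le
  have hq : ∀ y ∈ Metric.ball xt (δ / Λ₂), f^[q] y ∈ Metric.ball xt δ := by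
    intro y hy
    have h1 := (hexp y (Metric.ball_subset_ball hδ₂' hy) xt hxt).2
    rw [hx.iterate_eq] at h1
    rw [Metric.mem_ball, lt_div_iff₀ (by linarith)] at hy
    exact Metric.mem_ball.2 (by linarith)
  have hinj : InjOn f^[q] (Metric.ball xt δ) := by
    intro y hy z hz hyz
    have h1 := (hexp y hy z hz).1
    rw [hyz, dist_self] at h1
    refine dist_le_zero.1 (le_of_mul_le_mul_left ?_ (by linarith : 0 < Λ₁))
    linarith
  refine ⟨(c * c + 1) / 2, min δ₁ (δ / Λ₂), by linarith, by positivity, ?_, fun r hr z hz => ?_⟩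
  · rw [two_mul, Function.iterate_add]
    exact hinj.comp (hinj.mono (Metric.ball_subset_ball ((min_le_right _ _).trans hδ₂')))
      fun y hy => hq y (Metric.ball_subset_ball (min_le_right _ _) hy)
  · obtain ⟨t, ht, htr, htz⟩ := exists_mem_uIcc_eq_of_abs_sub_le (G := F ∘ F)
      (by simp [hFx]) hcc H (hr.trans (min_le_left _ _)) hz
    have htI : t ∈ I := hI.uIcc_subset xt.2 z.2 ht
    have hty : (⟨t, htI⟩ : I) ∈ Metric.ball xt r := htr
    refine ⟨⟨t, htI⟩, hty, Subtype.ext ?_⟩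
    have hty' := Metric.ball_subset_ball (hr.trans (min_le_right _ _)) hty
    rw [two_mul, Function.iterate_add_apply, hFf _ (hq _ hty'),
      hFf _ (Metric.ball_subset_ball hδ₂' hty')]
    exact htz

end IsHyperbolicPeriodicPt

end Local


/-! ### Size, regularity and short returns of the escape sets. -/

theorem measurableSet_escapeSet {I : Set ℝ} {f : I → I} (hf : Measurable f) (q : ℕ) {U : Set I}
    (hU : MeasurableSet U) : MeasurableSet (escapeSet f q U) :=
  hU.inter (MeasurableSet.iInter fun k => MeasurableSet.iInter fun _ => (hf.iterate k hU).compl)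

theorem escapeSet_subset {I : Set ℝ} (f : I → I) (q : ℕ) (U : Set I) : escapeSet f q U ⊆ U :=
  inter_subset_left

namespace IsGibbs

variable {I : Set ℝ} {f : I → I} {g h : I → ℝ} {lam : ℝ} {μ ν : Measure I} {q : ℕ} {xt : I}

/-- Each application of `f` multiplies `ν` by at most `lam / c` as long as `g ≥ c` along the orbit
segment and `f` is injective on the successive images. -/
theorem measure_iterate_image_le (G : IsGibbs f g h lam μ ν) {E : Set I} (hE : MeasurableSet E)
    {c : ℝ} {p : ℕ} (hinj : InjOn f^[p] E) (hc : ∀ i < p, ∀ y ∈ E, c ≤ g (f^[i] y)) :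
    ν (f^[p] '' E) ≤ (ENNReal.ofReal lam / ENNReal.ofReal c) ^ p * ν E := by
  have : StandardBorelSpace I := G.measurableSet.standardBorel
  induction p with
  | zero => simp
  | succ p ih =>
    rw [Function.iterate_succ'] at hinj
    have hinj' : InjOn f^[p] E := hinj.of_comp
    have hE' : MeasurableSet (f^[p] '' E) :=
      hE.image_of_measurable_injOn (G.measurable.iterate p) hinj'
    have h1 := G.conformal _ hE' hinj.image_of_comp
    rw [Function.iterate_succ', image_comp, h1]
    calc ∫⁻ x in f^[p] '' E, ENNReal.ofReal lam / ENNReal.ofReal (g x) ∂ν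
        ≤ ∫⁻ _ in f^[p] '' E, ENNReal.ofReal lam / ENNReal.ofReal c ∂ν := by
          refine setLIntegral_mono' hE' ?_
          rintro _ ⟨y, hy, rfl⟩
          exact ENNReal.div_le_div_left (ENNReal.ofReal_le_ofReal (hc p (by omega) y hy)) _
      _ ≤ ENNReal.ofReal lam / ENNReal.ofReal c *
            ((ENNReal.ofReal lam / ENNReal.ofReal c) ^ p * ν E) := by
          rw [setLIntegral_const]
          exact mul_le_mul' le_rfl (ih hinj' fun i hi => hc i (by omega))
      _ = _ := by rw [pow_succ]; ring

theorem exists_weight_lower_bound (hx : IsHyperbolicPeriodicPt f q xt)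
    (hg_low : ∀ i < q, ∃ c > 0, ∀ᶠ y in 𝓝 (f^[i] xt), c ≤ g y) (n : ℕ) :
    ∃ c > 0, ∃ δ > 0, ∀ i < n, ∀ y ∈ Metric.ball xt δ, c ≤ g (f^[i] y) := by
  induction n with
  | zero => exact ⟨1, one_pos, 1, one_pos, fun i hi => absurd hi (by omega)⟩
  | succ n ih =>
    obtain ⟨c, hc, δ, hδ, H⟩ := ih
    obtain ⟨c', hc', H'⟩ := hg_low (n % q) (Nat.mod_lt _ hx.pos)
    rw [hx.iterate_mod_eq] at H'
    obtain ⟨δ', hδ', H''⟩ :=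
      Metric.eventually_nhds_iff.1 ((hx.continuousAt_iterate n).eventually H')
    refine ⟨min c c', lt_min hc hc', min δ δ', lt_min hδ hδ', fun i hi y hy => ?_⟩
    rw [Metric.mem_ball] at hy
    rcases Nat.lt_succ_iff_lt_or_eq.1 hi with hi | rfl
    · exact (min_le_left _ _).trans (H i hi y (Metric.mem_ball.2 (hy.trans_le (min_le_left _ _))))
    · exact (min_le_right _ _).trans (H'' (hy.trans_le (min_le_right _ _)))

theorem absolutelyContinuous (G : IsGibbs f g h lam μ ν) : μ ≪ ν := by
  rw [G.density]
  exact withDensity_absolutelyContinuous _ _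

/-- Near `xt` the density `h` is bounded below, so the factor `ν(D)` in the mixing error can be
traded for `μ`. -/
theorem exists_measure_le_mul (G : IsGibbs f g h lam μ ν) [IsProbabilityMeasure μ]
    [IsProbabilityMeasure ν]
    (hh_low : ∃ c > 0, ∃ δ > 0, ∀ᵐ y ∂ν, dist y xt < δ → c ≤ h y) :
    ∃ C > 0, ∃ δ > 0, ∀ r ≤ δ, ν.real (Metric.ball xt r) ≤ C * μ.real (Metric.ball xt r) := by
  obtain ⟨c, hc, δ, hδ, H⟩ := hh_low
  refine ⟨c⁻¹, by positivity, δ, hδ, fun r hr => ?_⟩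
  rw [← div_eq_inv_mul, le_div_iff₀ hc, G.real_eq_setIntegral measurableSet_ball]
  calc ν.real (Metric.ball xt r) * c = ∫ _ in Metric.ball xt r, c ∂ν := by
        rw [setIntegral_const, smul_eq_mul]
    _ ≤ _ := by
        refine setIntegral_mono_ae_restrict (integrable_const c) (G.gap.1.integrable _) ?_
        refine (ae_restrict_iff' measurableSet_ball).2 ?_
        filter_upwards [H] with y hy hyr
        exact hy ((Metric.mem_ball.1 hyr).trans_le hr)

/-- Local expansion and conformality give doubling: the larger ball lies in `f^(2q)` of the smaller
one, whose `ν`-mass is at most a constant times that of the smaller ball. -/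
theorem exists_rpow_le_measure_ball (G : IsGibbs f g h lam μ ν) [IsProbabilityMeasure ν]
    (hx : IsHyperbolicPeriodicPt f q xt)
    (hg_low : ∀ i < q, ∃ c > 0, ∀ᶠ y in 𝓝 (f^[i] xt), c ≤ g y)
    (hpos : ∀ r, 0 < r → 0 < ν.real (Metric.ball xt r)) {Λ δ : ℝ} (hΛ : 1 < Λ) (hδ : 0 < δ)
    (hinj : InjOn f^[2 * q] (Metric.ball xt δ))
    (hcov : ∀ r ≤ δ, Metric.ball xt (Λ * r) ⊆ f^[2 * q] '' Metric.ball xt r) :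
    ∃ β c δ' : ℝ, 0 < β ∧ 0 < c ∧ 0 < δ' ∧
      ∀ r, 0 < r → r ≤ δ' → c * r ^ β ≤ ν.real (Metric.ball xt r) := by
  obtain ⟨c, hc, δ₁, hδ₁, Hc⟩ := exists_weight_lower_bound hx hg_low (2 * q)
  -- The maximum with 2 ensures `C > 1`, as the doubling lemma requires.
  set C := max 2 ((ENNReal.ofReal lam / ENNReal.ofReal c) ^ (2 * q)).toReal with hC
  have hδ' : 0 < min δ δ₁ := lt_min hδ hδ₁
  obtain ⟨β, c', hβ, hc', H⟩ := exists_rpow_le_of_doubling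
    (φ := fun r => ν.real (Metric.ball xt r)) (C := C)
    (fun a b hab => measureReal_mono (Metric.ball_subset_ball hab)) hpos hΛ
    (lt_of_lt_of_le one_lt_two (le_max_left _ _)) hδ' (fun r hr hrδ => by
      have h1 := G.measure_iterate_image_le (E := Metric.ball xt r) measurableSet_ball
        (hinj.mono (Metric.ball_subset_ball (hrδ.trans (min_le_left _ _))))
        (fun i hi y hy => Hc i hi y
          (Metric.ball_subset_ball (hrδ.trans (min_le_right _ _)) hy))
      have htop : (ENNReal.ofReal lam / ENNReal.ofReal c) ^ (2 * q) ≠ ⊤ :=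
        ENNReal.pow_ne_top (ENNReal.div_ne_top ENNReal.ofReal_ne_top (by simpa using hc))
      have h2 : ν.real (f^[2 * q] '' Metric.ball xt r) ≤ _ :=
        ENNReal.toReal_mono (ENNReal.mul_ne_top htop (measure_ne_top _ _)) h1
      rw [ENNReal.toReal_mul] at h2
      calc ν.real (Metric.ball xt (Λ * r)) ≤ ν.real (f^[2 * q] '' Metric.ball xt r) :=
            measureReal_mono (hcov r (hrδ.trans (min_le_left _ _)))
        _ ≤ _ := h2
        _ ≤ C * ν.real (Metric.ball xt r) :=
            mul_le_mul_of_nonneg_right (le_max_right _ _) measureReal_nonneg)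
  exact ⟨β, c', _, hβ, hc', hδ', H⟩

/-- Returns before time `q` do not occur, so the escape set is the ball minus `B ∩ f^(-q) B`, which
is order-connected by the local monotonicity of `f^q`. The bound is `4 · (1 + 4)`, independent of
the radius. -/
theorem eBVNorm_escapeSet_le {δ r : ℝ}
    (hret : ∀ k, 0 < k → k < q → ∀ y ∈ Metric.ball xt δ, f^[k] y ∉ Metric.ball xt δ)
    (hq : 0 < q) (hbetw : ∀ y ∈ Metric.ball xt δ, ∀ z ∈ Metric.ball xt δ,
      ∀ w ∈ Metric.ball xt δ, y ≤ w → w ≤ z → f^[q] w ∈ uIcc (f^[q] y) (f^[q] z))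
    (hr : r ≤ δ) :
    eBVNorm ((escapeSet f q (Metric.ball xt r)).indicator fun _ => (1 : ℝ)) ≤ 20 := by
  set B := Metric.ball xt r
  have hB : B ⊆ Metric.ball xt δ := Metric.ball_subset_ball hr
  have hA : escapeSet f q B = B ∩ (B ∩ f^[q] ⁻¹' B)ᶜ := by
    ext y
    simp only [escapeSet, mem_inter_iff, mem_iInter, mem_compl_iff, mem_preimage]
    constructor
    · rintro ⟨hy, H⟩
      exact ⟨hy, fun h' => H q ⟨hq, le_rfl⟩ h'.2⟩
    · rintro ⟨hy, H⟩
      refine ⟨hy, fun k hk hky => ?_⟩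
      rcases hk.2.lt_or_eq with hkq | rfl
      · exact hret k hk.1 hkq y (hB hy) (hB hky)
      · exact H ⟨hy, hky⟩
  have hoc : (B ∩ f^[q] ⁻¹' B).OrdConnected := by
    refine ⟨fun y hy z hz w hw => ?_⟩
    have hwB : w ∈ B := (ordConnected_ball xt r).out hy.1 hz.1 hw
    exact ⟨hwB, (ordConnected_ball xt r).uIcc_subset hy.2 hz.2
      (hbetw y (hB hy.1) z (hB hz.1) w (hB hwB) hw.1 hw.2)⟩
  rw [hA]
  refine (eBVNorm_indicator_inter_le _ _).trans ?_
  calc _ ≤ (4 : ℝ≥0∞) * (1 + 4) := mul_le_mul' (eBVNorm_indicator_le (ordConnected_ball xt r))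
        ((eBVNorm_indicator_compl_le _).trans (add_le_add le_rfl (eBVNorm_indicator_le hoc)))
    _ = 20 := by norm_num

/-- Points escaping from a small ball around a repelling periodic point do not come back before
the expansion has carried them to macroscopic distance. -/
theorem escapeSet_inter_preimage_eq_empty (hx : IsHyperbolicPeriodicPt f q xt) {Λ₁ Λ₂ δ r : ℝ}
    (hΛ₁ : 1 < Λ₁) (hΛ₂ : 1 < Λ₂)
    (hret : ∀ k, 0 < k → k < q → ∀ y ∈ Metric.ball xt δ, f^[k] y ∉ Metric.ball xt δ)
    (hexp : ∀ y ∈ Metric.ball xt δ,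
      Λ₁ * dist y xt ≤ dist (f^[q] y) xt ∧ dist (f^[q] y) xt ≤ Λ₂ * dist y xt)
    (hr : 0 < r) {i j : ℕ} (hi : r * Λ₂ ^ i ≤ δ) (hj0 : 0 < j) (hj : j < q * (i + 1)) :
    escapeSet f q (Metric.ball xt r) ∩ f^[j] ⁻¹' escapeSet f q (Metric.ball xt r) = ∅ := by
  have hrδ : r ≤ δ := le_trans (le_mul_of_one_le_right hr.le (one_le_pow₀ hΛ₂.le)) hi
  rw [eq_empty_iff_forall_notMem]
  rintro x ⟨⟨hxB, hxe⟩, hjx⟩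
  have hjB : f^[j] x ∈ Metric.ball xt r := escapeSet_subset f q _ hjx
  have hqx : r ≤ dist (f^[q] x) xt := by
    have := mem_iInter₂.1 hxe q ⟨hx.pos, le_rfl⟩
    simpa using this
  -- At multiples of `q` the distance to `xt` is at least `r` once the point has escaped, and it
  -- stays below `δ` up to time `q i`. Times that are not multiples of `q` are then excluded by the
  -- absence of early returns.
  have key : ∀ k ≤ i, dist (f^[q * k] x) xt < r * Λ₂ ^ k ∧
      (1 ≤ k → r ≤ dist (f^[q * k] x) xt) := by
    intro k
    induction k with
    | zero => exact fun _ => ⟨by simpa using hxB, fun h => absurd h (by omega)⟩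
    | succ k ih =>
      intro hk
      obtain ⟨h1, h2⟩ := ih (by omega)
      have hin : f^[q * k] x ∈ Metric.ball xt δ := by
        refine Metric.mem_ball.2 (h1.trans_le (le_trans ?_ hi))
        exact mul_le_mul_of_nonneg_left (pow_le_pow_right₀ hΛ₂.le (by omega)) hr.le
      have h3 := hexp _ hin
      have e : f^[q * (k + 1)] x = f^[q] (f^[q * k] x) := by
        rw [Nat.mul_succ, add_comm, Function.iterate_add_apply]
      rw [e]
      have hΛ₂0 : 0 < Λ₂ := by linarith
      refine ⟨?_, fun _ => ?_⟩
      · refine h3.2.trans_lt ?_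
        rw [pow_succ]
        linarith [mul_lt_mul_of_pos_left h1 hΛ₂0]
      · rcases Nat.eq_zero_or_pos k with rfl | hk0
        · simpa using hqx
        · have h4 := h2 hk0
          have h5 : 0 ≤ dist (f^[q * k] x) xt := dist_nonneg
          nlinarith [h3.1]
  have hk : j / q ≤ i := Nat.lt_succ_iff.1 (Nat.div_lt_of_lt_mul hj)
  have hsplit : f^[j] x = f^[j % q] (f^[q * (j / q)] x) := by
    rw [← Function.iterate_add_apply, Nat.mod_add_div]
  obtain ⟨h1, h2⟩ := key _ hk
  rw [hsplit] at hjB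
  rcases Nat.eq_zero_or_pos (j % q) with hl | hl
  · rw [hl] at hjB
    have hk1 : 1 ≤ j / q := by
      rcases Nat.eq_zero_or_pos (j / q) with h0 | h0
      · have := Nat.mod_add_div j q
        rw [hl, h0] at this
        omega
      · exact h0
    exact absurd (Metric.mem_ball.1 hjB) (not_lt.2 (h2 hk1))
  · refine hret _ hl (Nat.mod_lt _ hx.pos) (f^[q * (j / q)] x) ?_ (Metric.ball_subset_ball hrδ hjB)
    refine Metric.mem_ball.2 (h1.trans_le (le_trans ?_ hi))
    exact mul_le_mul_of_nonneg_left (pow_le_pow_right₀ hΛ₂.le hk) hr.le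

/-- Mixing and short-return estimates for the balls around a repelling periodic point. -/
theorem exists_ball_estimates (G : IsGibbs f g h lam μ ν) [IsProbabilityMeasure μ]
    [IsProbabilityMeasure ν] (hI : I.OrdConnected) (hx : IsHyperbolicPeriodicPt f q xt)
    (hh_low : ∃ c > 0, ∃ δ > 0, ∀ᵐ y ∂ν, dist y xt < δ → c ≤ h y)
    (hg_low : ∀ i < q, ∃ c > 0, ∀ᶠ y in 𝓝 (f^[i] xt), c ≤ g y)
    (hpos : ∀ r, 0 < r → 0 < μ (Metric.ball xt r))
    (hesc : ∀ δ > 0, ∃ r ≤ δ, (escapeSet f q (Metric.ball xt r)).Nonempty) :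
    ∃ δ K β κ : ℝ, 0 < δ ∧ 1 ≤ K ∧ 0 < β ∧ 0 < κ ∧ κ < 1 ∧ ∀ r, 0 < r → r ≤ δ →
      (∀ (j : ℕ) (D : Set I), MeasurableSet D →
        |μ.real (escapeSet f q (Metric.ball xt r) ∩ f^[j] ⁻¹' D) -
          μ.real (escapeSet f q (Metric.ball xt r)) * μ.real D| ≤ K * κ ^ j) ∧
      (∀ s : ℕ, ∑ j ∈ Finset.Icc 1 s, μ.real (escapeSet f q (Metric.ball xt r) ∩
          f^[j] ⁻¹' escapeSet f q (Metric.ball xt r)) ≤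
        K * μ.real (Metric.ball xt r) *
          (s * μ.real (Metric.ball xt r) + μ.real (Metric.ball xt r) ^ β)) ∧
      (∀ (m j : ℕ) (D : Set I), MeasurableSet D →
        |μ.real (avoid f (Metric.ball xt r) m ∩ f^[m + j] ⁻¹' D) -
          μ.real (avoid f (Metric.ball xt r) m) * μ.real D| ≤ K ^ (m + 1) * κ ^ j) := by
  rcases hx.dichotomy with ⟨δ, hδ, H⟩ | ⟨F, c, Λ₁, Λ₂, δ₁, hF, hc, hΛ₁, hΛ₂, hδ₁, hFf, hexp⟩
  -- The attracting case is impossible: small escape sets would be empty.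
  · obtain ⟨r, hr, y, hy⟩ := hesc δ hδ
    rw [H r hr] at hy
    exact absurd hy (notMem_empty y)
  obtain ⟨Λ, δ₂, hΛ, hδ₂, hinj, hcov⟩ := hx.exists_ball_subset_image hI hF hc hΛ₁ hΛ₂ hδ₁ hFf
    fun y hy z hz => ⟨(hexp y hy z hz).1, (hexp y hy z hz).2.1⟩
  obtain ⟨δ₃, hδ₃, hret⟩ := hx.exists_no_early_return
  have hνpos : ∀ r, 0 < r → 0 < ν.real (Metric.ball xt r) := fun r hr =>
    ENNReal.toReal_pos (fun h0 => (hpos r hr).ne' (G.absolutelyContinuous h0)) (measure_ne_top _ _)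
  obtain ⟨β₀, c₀, δ₄, hβ₀, hc₀, hδ₄, hlow⟩ :=
    G.exists_rpow_le_measure_ball hx hg_low hνpos hΛ hδ₂ hinj hcov
  obtain ⟨C₁, hC₁, δ₅, hδ₅, hνμ⟩ := G.exists_measure_le_mul hh_low
  obtain ⟨K₁, κ₁, hK₁, hκ₁0, hκ₁, hmix⟩ := G.exists_mixing_indicator
  obtain ⟨K₂, κ₂, hK₂, hκ₂0, hκ₂, hfar⟩ := G.exists_avoid_mixing (R := 1 + 4) (by norm_num)
  have hδ₆ : 0 < min δ₁ δ₃ := lt_min hδ₁ hδ₃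
  obtain ⟨β₁, C₂, hβ₁, hC₂, hreturn⟩ := exists_pow_le_rpow hΛ₂ hκ₁0 hκ₁ hδ₆
  have hret' : ∀ k, 0 < k → k < q → ∀ y ∈ Metric.ball xt (min δ₁ δ₃),
      f^[k] y ∉ Metric.ball xt (min δ₁ δ₃) := fun k h0 hk y hy hy' =>
    hret k h0 hk y (Metric.ball_subset_ball (min_le_right _ _) hy)
      (Metric.ball_subset_ball (min_le_right _ _) hy')
  have hsub := Metric.ball_subset_ball (x := xt) (min_le_left δ₁ δ₃)
  set κ := max κ₁ κ₂ with hκdef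
  set C₃ := 20 * K₁ * C₁ / (1 - κ₁) * (C₂ * (C₁ / c₀) ^ (β₁ / β₀)) with hC₃
  set K := max K₂ (max (20 * K₁) (max 1 C₃)) with hKdef
  have hK2 : K₂ ≤ K := le_max_left _ _
  have hK20 : 20 * K₁ ≤ K := (le_max_left _ _).trans (le_max_right _ _)
  have hK1 : 1 ≤ K := hK₂.trans hK2
  have hK3 : C₃ ≤ K := (le_max_right _ _).trans ((le_max_right _ _).trans (le_max_right _ _))
  refine ⟨min (min δ₁ δ₃) (min δ₄ δ₅), K, β₁ / β₀, κ, by positivity, hK1, by positivity,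
    lt_max_of_lt_left hκ₁0, max_lt hκ₁ hκ₂, fun r hr hrδ => ?_⟩
  have hrδ₆ : r ≤ min δ₁ δ₃ := hrδ.trans (min_le_left _ _)
  have hrδ₄ : r ≤ δ₄ := hrδ.trans ((min_le_right _ _).trans (min_le_left _ _))
  have hrδ₅ : r ≤ δ₅ := hrδ.trans ((min_le_right _ _).trans (min_le_right _ _))
  set B := Metric.ball xt r with hB
  set A := escapeSet f q B with hA
  have hBm : MeasurableSet B := measurableSet_ball
  have hAm : MeasurableSet A := measurableSet_escapeSet G.measurable q hBm
  have hA20 : eBVNorm (A.indicator fun _ => (1 : ℝ)) ≤ 20 :=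
    eBVNorm_escapeSet_le hret' hx.pos (fun y hy z hz w hw =>
      (hexp y (hsub hy) z (hsub hz)).2.2 w (hsub hw)) hrδ₆
  have hABV : IsBV (A.indicator fun _ => (1 : ℝ)) := ne_top_of_le_ne_top (by norm_num) hA20
  have hA20' : (eBVNorm (A.indicator fun _ => (1 : ℝ))).toReal ≤ 20 := by
    simpa using ENNReal.toReal_mono (by norm_num) hA20
  have hmixA : ∀ (j : ℕ) (D : Set I), MeasurableSet D →
      |μ.real (A ∩ f^[j] ⁻¹' D) - μ.real A * μ.real D| ≤ 20 * K₁ * κ₁ ^ j * ν.real D := by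
    intro j D hD
    refine (hmix A hAm hABV j D hD).trans ?_
    refine mul_le_mul_of_nonneg_right ?_ measureReal_nonneg
    calc _ ≤ K₁ * κ₁ ^ j * 20 := mul_le_mul_of_nonneg_left hA20' (by positivity)
      _ = _ := by ring
  refine ⟨fun j D hD => (hmixA j D hD).trans ?_, fun s => ?_, fun m j D hD => ?_⟩
  · calc 20 * K₁ * κ₁ ^ j * ν.real D ≤ 20 * K₁ * κ₁ ^ j * 1 :=
          mul_le_mul_of_nonneg_left measureReal_le_one (by positivity)
      _ ≤ K * κ ^ j := by
          rw [mul_one]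
          exact mul_le_mul hK20 (pow_le_pow_left₀ hκ₁0.le (le_max_left _ _) j) (by positivity)
            (by linarith)
  · set b := μ.real B with hb
    have hb0 : 0 < b := ENNReal.toReal_pos (hpos r hr).ne' (measure_ne_top _ _)
    have hAb : μ.real A ≤ b := measureReal_mono (escapeSet_subset f q B)
    obtain ⟨i, hi, hκi⟩ := hreturn r hr hrδ₆
    have hνA : ν.real A ≤ C₁ * b :=
      (measureReal_mono (escapeSet_subset f q B)).trans (hνμ r hrδ₅)
    -- Before time `i` there is no return at all; from time `i` on, mixing applies, with the factor
    -- `ν(A) ≤ C₁ b` retained.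
    have hterm : ∀ j ∈ Finset.Icc 1 s, μ.real (A ∩ f^[j] ⁻¹' A) ≤
        b * b + 20 * K₁ * (C₁ * b) * (if i ≤ j then κ₁ ^ j else 0) := by
      intro j hj
      split_ifs with hij
      · have h1 := (abs_le.1 (hmixA j A hAm)).2
        have h2 : μ.real A * μ.real A ≤ b * b :=
          mul_le_mul hAb hAb measureReal_nonneg hb0.le
        have h3 : 20 * K₁ * κ₁ ^ j * ν.real A ≤ 20 * K₁ * κ₁ ^ j * (C₁ * b) :=
          mul_le_mul_of_nonneg_left hνA (by positivity)
        linarith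
      · have hjq : j < q * (i + 1) := by
          have := Nat.le_mul_of_pos_left (i + 1) hx.pos
          omega
        rw [escapeSet_inter_preimage_eq_empty hx hΛ₁ hΛ₂ hret' (fun y hy => by
          have := hexp y (hsub hy) xt (Metric.mem_ball_self hδ₁)
          rw [hx.iterate_eq] at this
          exact ⟨this.1, this.2.1⟩) hr hi (Finset.mem_Icc.1 hj).1 hjq]
        rw [measureReal_empty]
        positivity
    have hgeo : ∑ j ∈ Finset.Icc 1 s, (if i ≤ j then κ₁ ^ j else 0) ≤ κ₁ ^ i / (1 - κ₁) := by
      rw [← Finset.sum_filter]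
      refine le_trans (Finset.sum_le_sum_of_subset_of_nonneg ?_ fun _ _ _ => by positivity)
        (geom_sum_Ico_le_of_lt_one (m := i) (n := s + 1) hκ₁0.le hκ₁)
      intro j hj
      rw [Finset.mem_filter, Finset.mem_Icc] at hj
      rw [Finset.mem_Ico]
      omega
    have h1κ : 0 < 1 - κ₁ := by linarith
    -- The polynomial lower bound on the mass of balls converts a power of the radius into a power
    -- of `μ(B)`.
    have hrb : r ^ β₁ ≤ (C₁ / c₀) ^ (β₁ / β₀) * b ^ (β₁ / β₀) := by
      have h1 : r ^ β₀ ≤ C₁ / c₀ * b := by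
        rw [div_mul_eq_mul_div, le_div_iff₀ hc₀]
        have := (hlow r hr hrδ₄).trans (hνμ r hrδ₅)
        linarith
      rw [← Real.mul_rpow (by positivity) hb0.le]
      calc r ^ β₁ = (r ^ β₀) ^ (β₁ / β₀) := by
            rw [← Real.rpow_mul hr.le, mul_div_cancel₀ _ hβ₀.ne']
        _ ≤ _ := Real.rpow_le_rpow (by positivity) h1 (by positivity)
    calc ∑ j ∈ Finset.Icc 1 s, μ.real (A ∩ f^[j] ⁻¹' A)
        ≤ ∑ j ∈ Finset.Icc 1 s, (b * b + 20 * K₁ * (C₁ * b) * (if i ≤ j then κ₁ ^ j else 0)) :=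
          Finset.sum_le_sum hterm
      _ = s * (b * b) + 20 * K₁ * (C₁ * b) *
            ∑ j ∈ Finset.Icc 1 s, (if i ≤ j then κ₁ ^ j else 0) := by
          rw [Finset.sum_add_distrib, Finset.sum_const, Nat.card_Icc, Nat.add_sub_cancel,
            nsmul_eq_mul, ← Finset.mul_sum]
      _ ≤ s * (b * b) + 20 * K₁ * (C₁ * b) *
            (C₂ * ((C₁ / c₀) ^ (β₁ / β₀) * b ^ (β₁ / β₀)) / (1 - κ₁)) := by
          gcongr
          refine hgeo.trans ?_
          gcongr
          exact hκi.trans (mul_le_mul_of_nonneg_left hrb hC₂.le)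
      _ = b * (s * b) + C₃ * (b * b ^ (β₁ / β₀)) := by rw [hC₃]; ring
      _ ≤ K * (b * (s * b)) + K * (b * b ^ (β₁ / β₀)) := by
          refine add_le_add ?_ (mul_le_mul_of_nonneg_right hK3 (by positivity))
          exact le_mul_of_one_le_left (by positivity) hK1
      _ = _ := by ring
  · have hBc : eBVNorm (Bᶜ.indicator fun _ => (1 : ℝ)) ≤ 1 + 4 :=
      (eBVNorm_indicator_compl_le _).trans
        (add_le_add le_rfl (eBVNorm_indicator_le (ordConnected_ball xt r)))
    refine (hfar B hBm hBc m j D hD).trans ?_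
    exact mul_le_mul (pow_le_pow_left₀ (by linarith) hK2 _)
      (pow_le_pow_left₀ hκ₂0.le (le_max_right _ _) j) (by positivity) (by positivity)

end IsGibbs


/-! ### The blocking argument. -/

theorem real_preimage_iterate {α : Type*} [MeasurableSpace α] {μ : Measure α} {f : α → α}
    (hf : MeasurePreserving f μ μ) {D : Set α} (hD : MeasurableSet D) (n : ℕ) :
    μ.real (f^[n] ⁻¹' D) = μ.real D :=
  congrArg ENNReal.toReal ((hf.iterate n).measure_preimage hD.nullMeasurableSet)

section Peeling

variable {α : Type*} [MeasurableSpace α] {μ : Measure α} [IsProbabilityMeasure μ] {f : α → α}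
  {A : Set α}

theorem real_compl_avoid_le (hf : MeasurePreserving f μ μ) (hA : MeasurableSet A) (l : ℕ) :
    μ.real (avoid f A l)ᶜ ≤ l * μ.real A := by
  have h : (avoid f A l)ᶜ ⊆ ⋃ i ∈ Finset.range l, f^[i] ⁻¹' A := by
    intro x hx
    simp only [avoid, mem_compl_iff, mem_ofPred_eq, not_forall, not_not] at hx
    obtain ⟨i, hi, hxi⟩ := hx
    exact mem_iUnion₂.2 ⟨i, Finset.mem_range.2 hi, hxi⟩
  refine (measureReal_mono h (measure_ne_top _ _)).trans
    ((measureReal_biUnion_finset_le _ _).trans ?_)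
  simp [real_preimage_iterate hf hA]

/-- Induction that prepends one step at a time. Excluding `A` at time 0 removes nearly `μ(A) μ(D)`:
the error is mixing across the gap `t`, plus the mass `R` of points of `A` that return to `A` within
`s` steps. -/
theorem abs_real_avoid_inter_sub_le (hf : MeasurePreserving f μ μ) (hA : MeasurableSet A)
    {K κ R : ℝ} (hK : 0 ≤ K) (hκ0 : 0 < κ) (hκ : κ < 1)
    (hmix : ∀ (j : ℕ) (D : Set α), MeasurableSet D →
      |μ.real (A ∩ f^[j] ⁻¹' D) - μ.real A * μ.real D| ≤ K * κ ^ j)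
    (t : ℕ) {D : Set α} (hD : MeasurableSet D) (s : ℕ)
    (hR : ∑ j ∈ Finset.Icc 1 s, μ.real (A ∩ f^[j] ⁻¹' A) ≤ R) :
    |μ.real (avoid f A s ∩ f^[s + t] ⁻¹' D) - (1 - s * μ.real A) * μ.real D| ≤
      s * (K * κ ^ t + R) := by
  have hfm := hf.measurable
  have hav := measurableSet_avoid hfm hA
  induction s with
  | zero => simp [avoid, real_preimage_iterate hf hD]
  | succ s ih =>
    have hR' : ∑ j ∈ Finset.Icc 1 s, μ.real (A ∩ f^[j] ⁻¹' A) ≤ R :=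
      (Finset.sum_le_sum_of_subset_of_nonneg
        (Finset.Icc_subset_Icc le_rfl (Nat.le_succ s)) fun _ _ _ => measureReal_nonneg).trans hR
    have ih := ih hR'
    set E := avoid f A s ∩ f^[s + t] ⁻¹' D with hE
    have hEm : MeasurableSet E := (hav s).inter (hfm.iterate _ hD)
    have hpre : f^[s + 1 + t] ⁻¹' D = f ⁻¹' (f^[s + t] ⁻¹' D) := by
      rw [← preimage_comp, ← Function.iterate_succ]
      congr 2; omega
    have hset : avoid f A (s + 1) ∩ f^[s + 1 + t] ⁻¹' D = f ⁻¹' E \ A := by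
      rw [hpre, add_comm s 1, avoid_add, avoid_one, hE, preimage_inter, Function.iterate_one,
        sdiff_eq, inter_assoc, inter_comm]
    have hfE : μ.real (f ⁻¹' E) = μ.real E := real_preimage_iterate hf hEm 1
    have h1 : μ.real (f ⁻¹' E \ A) = μ.real E - μ.real (A ∩ f ⁻¹' E) := by
      rw [← hfE, inter_comm]
      linarith [measureReal_sdiff_add_inter (μ := μ) (s := f ⁻¹' E) hA]
    have h2 : μ.real (A ∩ f ⁻¹' E) ≤ μ.real (A ∩ f^[s + 1 + t] ⁻¹' D) :=
      measureReal_mono (inter_subset_inter_right _ (by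
        rw [hpre]; exact preimage_mono inter_subset_right))
    have h3 : μ.real (A ∩ f^[s + 1 + t] ⁻¹' D) ≤ μ.real (A ∩ f ⁻¹' E) + R := by
      have hsub : A ∩ f^[s + 1 + t] ⁻¹' D ⊆
          (A ∩ f ⁻¹' E) ∪ ⋃ j ∈ Finset.Icc 1 s, A ∩ f^[j] ⁻¹' A := by
        rintro x ⟨hxA, hxD⟩
        by_cases hx : f x ∈ avoid f A s
        · left
          rw [hpre] at hxD
          exact ⟨hxA, hx, hxD⟩
        · right
          simp only [avoid, mem_ofPred_eq, not_forall, not_not] at hx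
          obtain ⟨i, hi, hxi⟩ := hx
          exact mem_iUnion₂.2 ⟨i + 1, Finset.mem_Icc.2 ⟨by omega, by omega⟩, hxA, hxi⟩
      refine (measureReal_mono hsub).trans ((measureReal_union_le _ _).trans ?_)
      gcongr
      exact (measureReal_biUnion_finset_le _ _).trans hR'
    have h4 := abs_le.1 (hmix (s + 1 + t) D hD)
    have h5 : K * κ ^ (s + 1 + t) ≤ K * κ ^ t :=
      mul_le_mul_of_nonneg_left (pow_le_pow_of_le_one hκ0.le hκ.le (by omega)) hK
    have ih := abs_le.1 ih
    have hR0 : 0 ≤ R := le_trans (Finset.sum_nonneg fun _ _ => measureReal_nonneg) hR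
    rw [hset, h1]
    push_cast
    rw [abs_le]
    constructor <;> linarith

/-- Each block of length `s` contributes a factor `1 - s μ(A)`. Also avoiding `A` during the
following gap costs at most `t μ(A)` per block. -/
theorem abs_real_avoid_blocks_sub_le (hf : MeasurePreserving f μ μ) (hA : MeasurableSet A)
    {K κ R : ℝ} (hK : 0 ≤ K) (hκ0 : 0 < κ) (hκ : κ < 1)
    (hmix : ∀ (j : ℕ) (D : Set α), MeasurableSet D →
      |μ.real (A ∩ f^[j] ⁻¹' D) - μ.real A * μ.real D| ≤ K * κ ^ j)
    (s t : ℕ) (hR : ∑ j ∈ Finset.Icc 1 s, μ.real (A ∩ f^[j] ⁻¹' A) ≤ R)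
    (hs : s * μ.real A ≤ 1) (k : ℕ) {D : Set α} (hD : MeasurableSet D) :
    |μ.real (avoid f A (k * (s + t)) ∩ f^[k * (s + t)] ⁻¹' D) -
      (1 - s * μ.real A) ^ k * μ.real D| ≤ k * (t * μ.real A + s * (K * κ ^ t + R)) := by
  have hfm := hf.measurable
  have hav := measurableSet_avoid hfm hA
  induction k with
  | zero => simp [avoid]
  | succ k ih =>
    set E := avoid f A (k * (s + t)) ∩ f^[k * (s + t)] ⁻¹' D with hE
    have hEm : MeasurableSet E := (hav _).inter (hfm.iterate _ hD)
    have hset : avoid f A ((k + 1) * (s + t)) ∩ f^[(k + 1) * (s + t)] ⁻¹' D =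
        avoid f A (s + t) ∩ f^[s + t] ⁻¹' E := by
      rw [show (k + 1) * (s + t) = (s + t) + k * (s + t) by ring, avoid_add, hE, preimage_inter,
        ← preimage_comp, ← Function.iterate_add, inter_assoc, add_comm (k * (s + t))]
    have h1 := abs_real_avoid_inter_sub_le hf hA hK hκ0 hκ hmix t hEm s hR
    have h2 : μ.real (avoid f A (s + t) ∩ f^[s + t] ⁻¹' E) ≤
        μ.real (avoid f A s ∩ f^[s + t] ⁻¹' E) :=
      measureReal_mono (inter_subset_inter_left _ (avoid_anti (Nat.le_add_right _ _)))
    have h3 : μ.real (avoid f A s ∩ f^[s + t] ⁻¹' E) ≤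
        μ.real (avoid f A (s + t) ∩ f^[s + t] ⁻¹' E) + t * μ.real A := by
      have hsub : avoid f A s ∩ f^[s + t] ⁻¹' E ⊆
          (avoid f A (s + t) ∩ f^[s + t] ⁻¹' E) ∪ f^[s] ⁻¹' (avoid f A t)ᶜ := by
        rintro x ⟨hx1, hx2⟩
        by_cases hx : f^[s] x ∈ avoid f A t
        · left
          rw [avoid_add]
          exact ⟨⟨hx1, hx⟩, hx2⟩
        · exact .inr hx
      refine (measureReal_mono hsub).trans ((measureReal_union_le _ _).trans ?_)
      rw [real_preimage_iterate hf (hav t).compl]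
      gcongr
      exact real_compl_avoid_le hf hA t
    have hp0 : 0 ≤ 1 - s * μ.real A := by linarith
    have hp1 : 1 - s * μ.real A ≤ 1 := by
      have : 0 ≤ s * μ.real A := by positivity
      linarith
    have h4 : |(1 - s * μ.real A) * (μ.real E - (1 - s * μ.real A) ^ k * μ.real D)| ≤
        k * (t * μ.real A + s * (K * κ ^ t + R)) := by
      rw [abs_mul, abs_of_nonneg hp0]
      exact (mul_le_of_le_one_left (abs_nonneg _) hp1).trans ih
    have h1 := abs_le.1 h1
    have h4 := abs_le.1 h4
    have e : (1 - s * μ.real A) * (μ.real E - (1 - s * μ.real A) ^ k * μ.real D) =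
        (1 - s * μ.real A) * μ.real E - (1 - s * μ.real A) ^ (k + 1) * μ.real D := by ring
    rw [e] at h4
    have ht0 : 0 ≤ t * μ.real A := by positivity
    rw [hset]
    push_cast
    rw [abs_le]
    constructor <;> linarith

theorem real_avoid_sub_le (hf : MeasurePreserving f μ μ) (hA : MeasurableSet A) {a b : ℕ}
    (hab : a ≤ b) : μ.real (avoid f A a) ≤ μ.real (avoid f A b) + (b - a : ℕ) * μ.real A := by
  have hav := measurableSet_avoid hf.measurable hA
  have hsub : avoid f A a ⊆ avoid f A b ∪ f^[a] ⁻¹' (avoid f A (b - a))ᶜ := by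
    intro x hx
    by_cases h : f^[a] x ∈ avoid f A (b - a)
    · left
      rw [← Nat.add_sub_cancel' hab, avoid_add]
      exact ⟨hx, h⟩
    · exact .inr h
  refine (measureReal_mono hsub).trans ((measureReal_union_le _ _).trans ?_)
  rw [real_preimage_iterate hf (hav _).compl]
  gcongr
  exact real_compl_avoid_le hf hA _

end Peeling

/-- The last visit to `B` before time `l` is a visit to the escape set, unless it falls in the final
`q` times. So passing from `B` to its escape set costs at most `q μ(B)`. -/
theorem real_avoid_escapeSet_le {I : Set ℝ} {f : I → I} {μ : Measure I} [IsProbabilityMeasure μ]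
    (hf : MeasurePreserving f μ μ) (q : ℕ) {B : Set I} (hB : MeasurableSet B) (l : ℕ) :
    μ.real (avoid f (escapeSet f q B) l) ≤ μ.real (avoid f B l) + q * μ.real B := by
  classical
  have hsub : avoid f (escapeSet f q B) l ⊆
      avoid f B l ∪ ⋃ j ∈ Finset.range q, f^[l - 1 - j] ⁻¹' B := by
    intro x hx
    by_cases h : x ∈ avoid f B l
    · exact .inl h
    · right
      simp only [avoid, mem_ofPred_eq, not_forall, not_not] at h
      obtain ⟨i₀, hi₀, hxi₀⟩ := h
      obtain ⟨i, hi, hmax⟩ := Finset.exists_max_image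
        ((Finset.range l).filter fun i => f^[i] x ∈ B) id
        ⟨i₀, Finset.mem_filter.2 ⟨Finset.mem_range.2 hi₀, hxi₀⟩⟩
      rw [Finset.mem_filter, Finset.mem_range] at hi
      have hne : f^[i] x ∉ escapeSet f q B := hx i hi.1
      have hk : ∃ k ∈ Icc 1 q, f^[k] (f^[i] x) ∈ B := by
        by_contra hcon
        push Not at hcon
        exact hne ⟨hi.2, mem_iInter₂.2 fun k hk => hcon k hk⟩
      obtain ⟨k, hk, hkB⟩ := hk
      rw [← Function.iterate_add_apply] at hkB
      have hlk : l ≤ k + i := by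
        by_contra hlt
        push Not at hlt
        have := hmax (k + i) (Finset.mem_filter.2 ⟨Finset.mem_range.2 hlt, hkB⟩)
        have h1 := hk.1
        simp only [id] at this
        omega
      have hkq := hk.2
      refine mem_iUnion₂.2 ⟨l - 1 - i, Finset.mem_range.2 (by omega), ?_⟩
      rw [show l - 1 - (l - 1 - i) = i by omega]
      exact hi.2
  refine (measureReal_mono hsub).trans ((measureReal_union_le _ _).trans ?_)
  gcongr
  refine (measureReal_biUnion_finset_le _ _).trans ?_
  simp [real_preimage_iterate hf hB]

/-! ### Choice of scales with `t ≈ n^(1/4)`. -/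

section Scales

theorem half_rpow_le_sqrt_sqrt {n : ℕ} (hn : 1 ≤ n) :
    (n : ℝ) ^ (1 / 4 : ℝ) / 2 ≤ (Nat.sqrt (Nat.sqrt n) : ℕ) ∧
      1 ≤ Nat.sqrt (Nat.sqrt n) ∧ Nat.sqrt (Nat.sqrt n) ^ 4 ≤ n := by
  set t := Nat.sqrt (Nat.sqrt n) with ht
  have h1 : 1 ≤ t := Nat.le_sqrt.2 (by simpa using Nat.le_sqrt.2 (by simpa using hn))
  have h2 : t ^ 4 ≤ n := by
    have a1 := Nat.sqrt_le (Nat.sqrt n)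
    have a2 := Nat.sqrt_le n
    calc t ^ 4 = (t * t) * (t * t) := by ring
      _ ≤ Nat.sqrt n * Nat.sqrt n := Nat.mul_le_mul a1 a1
      _ ≤ n := a2
  have h3 : n < (t + 1) ^ 4 := by
    have a2 : Nat.sqrt n + 1 ≤ (t + 1) * (t + 1) := Nat.lt_succ_sqrt (Nat.sqrt n)
    have a3 : n < (Nat.sqrt n + 1) * (Nat.sqrt n + 1) := Nat.lt_succ_sqrt n
    calc n < (Nat.sqrt n + 1) * (Nat.sqrt n + 1) := a3
      _ ≤ ((t + 1) * (t + 1)) * ((t + 1) * (t + 1)) := Nat.mul_le_mul a2 a2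
      _ = (t + 1) ^ 4 := by ring
  refine ⟨?_, h1, h2⟩
  have h4 : (n : ℝ) ≤ ((t : ℝ) + 1) ^ (4 : ℝ) := by
    have : (n : ℝ) ≤ ((t + 1) ^ 4 : ℕ) := by exact_mod_cast h3.le
    push_cast at this
    exact_mod_cast this
  have h5 : (n : ℝ) ^ (1 / 4 : ℝ) ≤ (t : ℝ) + 1 := by
    calc (n : ℝ) ^ (1 / 4 : ℝ) ≤ (((t : ℝ) + 1) ^ (4 : ℝ)) ^ (1 / 4 : ℝ) :=
          Real.rpow_le_rpow (by positivity) h4 (by norm_num)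
      _ = (t : ℝ) + 1 := by
          rw [← Real.rpow_mul (by positivity)]; norm_num
  have h6 : (1 : ℝ) ≤ t := by exact_mod_cast h1
  linarith

theorem eventually_log_rpow_le (M : ℝ) (r : ℝ) {ε : ℝ} (hε : 0 < ε) :
    ∀ᶠ n : ℕ in atTop, M * Real.log n ^ r ≤ (n : ℝ) ^ ε := by
  have h := (isLittleO_log_rpow_rpow_atTop r hε).def
    (show 0 < (|M| + 1)⁻¹ by positivity)
  filter_upwards [tendsto_natCast_atTop_atTop.eventually h] with n hn
  rw [Real.norm_of_nonneg (Real.rpow_nonneg (Nat.cast_nonneg n) ε), Real.norm_eq_abs,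
    ← div_eq_inv_mul, le_div_iff₀ (by positivity)] at hn
  calc M * Real.log n ^ r ≤ |M * Real.log n ^ r| := le_abs_self _
    _ = |Real.log n ^ r| * |M| := by rw [abs_mul, mul_comm]
    _ ≤ |Real.log n ^ r| * (|M| + 1) := by gcongr; linarith
    _ ≤ _ := hn

theorem eventually_log_le (M : ℝ) {ε : ℝ} (hε : 0 < ε) :
    ∀ᶠ n : ℕ in atTop, M * Real.log n ≤ (n : ℝ) ^ ε := by
  simpa using eventually_log_rpow_le M 1 hε

theorem eventually_pow_sqrt_sqrt_le (M : ℝ) {κ : ℝ} (hκ0 : 0 < κ) (hκ : κ < 1) :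
    ∀ᶠ n : ℕ in atTop, M * (n : ℝ) ^ (2 : ℝ) * κ ^ Nat.sqrt (Nat.sqrt n) ≤ 1 := by
  have hc : 0 < -Real.log κ / 2 := by linarith [Real.log_neg hκ0 hκ]
  -- Applied at `n^(1/4)`, the exponent `-8` yields the decay `n^(-2)` that is needed.
  have h := (isLittleO_exp_neg_mul_rpow_atTop hc (-8)).def
    (show 0 < (|M| + 1)⁻¹ by positivity)
  have ht : Tendsto (fun n : ℕ => (n : ℝ) ^ (1 / 4 : ℝ)) atTop atTop :=
    (tendsto_rpow_atTop (by norm_num)).comp tendsto_natCast_atTop_atTop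
  filter_upwards [ht.eventually h, eventually_ge_atTop 1] with n hn hn1
  have hn0 : (0 : ℝ) < n := by exact_mod_cast hn1
  obtain ⟨h1, -, -⟩ := half_rpow_le_sqrt_sqrt hn1
  rw [Real.norm_of_nonneg (Real.exp_pos _).le, Real.norm_of_nonneg (by positivity),
    ← Real.rpow_mul hn0.le] at hn
  have h2 : κ ^ Nat.sqrt (Nat.sqrt n) ≤
      Real.exp (-(-Real.log κ / 2) * (n : ℝ) ^ (1 / 4 : ℝ)) := by
    rw [← Real.rpow_natCast, Real.rpow_def_of_pos hκ0, Real.exp_le_exp]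
    nlinarith [Real.log_neg hκ0 hκ]
  have h3 : (n : ℝ) ^ (2 : ℝ) * (n : ℝ) ^ (1 / 4 * (-8) : ℝ) = 1 := by
    rw [← Real.rpow_add hn0]; norm_num
  calc M * (n : ℝ) ^ (2 : ℝ) * κ ^ Nat.sqrt (Nat.sqrt n)
      ≤ (|M| + 1) * (n : ℝ) ^ (2 : ℝ) * ((|M| + 1)⁻¹ * (n : ℝ) ^ (1 / 4 * (-8) : ℝ)) := by
        refine mul_le_mul ?_ (h2.trans hn) (by positivity) (by positivity)
        gcongr
        linarith [le_abs_self M]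
    _ = (n : ℝ) ^ (2 : ℝ) * (n : ℝ) ^ (1 / 4 * (-8) : ℝ) := by field_simp
    _ = 1 := h3

end Scales


/-- The four bounds control, in turn, the gaps between blocks, the mixing error summed over `n`
steps, the short returns, and the error made in the exponent by replacing `μ(A)` with `θ μ(B)`. -/
theorem exists_scale (M : ℝ) {κ β σ : ℝ} (hκ0 : 0 < κ) (hκ : κ < 1) (hβ : 0 < β) (hσ : 0 < σ) :
    ∃ γ : ℝ, 0 < γ ∧ ∀ᶠ n : ℕ in atTop,
      M * (Real.log n / Nat.sqrt (Nat.sqrt n)) ≤ (n : ℝ) ^ (-γ) ∧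
      M * (n * κ ^ Nat.sqrt (Nat.sqrt n)) ≤ (n : ℝ) ^ (-γ) ∧
      M * (Real.log n * (Real.log n / n) ^ β) ≤ (n : ℝ) ^ (-γ) ∧
      M * (Real.log n * (n : ℝ) ^ (-σ)) ≤ 1 := by
  set γ := min (1 / 8) (β / 2) with hγ
  have hγ0 : 0 < γ := lt_min (by norm_num) (by positivity)
  have hγ1 : γ ≤ 1 / 8 := min_le_left _ _
  have hγ2 : γ ≤ β / 2 := min_le_right _ _
  refine ⟨γ, hγ0, ?_⟩
  filter_upwards [eventually_log_le (2 * M) (by norm_num : (0 : ℝ) < 1 / 8),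
    eventually_pow_sqrt_sqrt_le M hκ0 hκ,
    eventually_log_rpow_le M (1 + β) (half_pos hβ), eventually_log_le M hσ,
    eventually_ge_atTop 2] with n h1 h2 h3 h4 hn
  have hn1 : (1 : ℝ) ≤ n := by exact_mod_cast (by omega : 1 ≤ n)
  have hn0 : (0 : ℝ) < n := by linarith
  have hL : 0 < Real.log n := Real.log_pos (by exact_mod_cast hn)
  obtain ⟨ht, ht1, -⟩ := half_rpow_le_sqrt_sqrt (by omega : 1 ≤ n)
  have ht0 : (0 : ℝ) < (Nat.sqrt (Nat.sqrt n) : ℕ) := by exact_mod_cast ht1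
  refine ⟨?_, ?_, ?_, ?_⟩
  · rw [← mul_div_assoc, div_le_iff₀ ht0]
    have e : (n : ℝ) ^ (1 / 8 : ℝ) = (n : ℝ) ^ (-(1 / 8) : ℝ) * (n : ℝ) ^ (1 / 4 : ℝ) := by
      rw [← Real.rpow_add hn0]; norm_num
    have e2 : (n : ℝ) ^ (-(1 / 8) : ℝ) ≤ (n : ℝ) ^ (-γ) :=
      Real.rpow_le_rpow_of_exponent_le hn1 (by linarith)
    calc M * Real.log n ≤ (n : ℝ) ^ (1 / 8 : ℝ) / 2 := by linarith
      _ = (n : ℝ) ^ (-(1 / 8) : ℝ) * ((n : ℝ) ^ (1 / 4 : ℝ) / 2) := by rw [e]; ring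
      _ ≤ _ := mul_le_mul e2 ht (by positivity) (by positivity)
  · have e : (n : ℝ) ^ (2 : ℝ) = n * n := by
      rw [show (2 : ℝ) = 1 + 1 by norm_num, Real.rpow_add hn0, Real.rpow_one]
    have e2 : (n : ℝ)⁻¹ ≤ (n : ℝ) ^ (-γ) := by
      rw [← Real.rpow_neg_one]
      exact Real.rpow_le_rpow_of_exponent_le hn1 (by linarith)
    refine le_trans ?_ e2
    rw [e] at h2
    rw [inv_eq_one_div, le_div_iff₀ hn0]
    linarith
  · have e : (n : ℝ) ^ (β / 2) = (n : ℝ) ^ (-(β / 2)) * (n : ℝ) ^ β := by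
      rw [← Real.rpow_add hn0]; ring_nf
    have e2 : (n : ℝ) ^ (-(β / 2)) ≤ (n : ℝ) ^ (-γ) :=
      Real.rpow_le_rpow_of_exponent_le hn1 (by linarith)
    refine le_trans ?_ e2
    rw [Real.rpow_add hL, Real.rpow_one, e] at h3
    rw [Real.div_rpow hL.le hn0.le, ← mul_div_assoc, ← mul_div_assoc,
      div_le_iff₀ (by positivity)]
    linarith
  · rw [Real.rpow_neg hn0.le, ← mul_assoc, ← div_eq_mul_inv, div_le_one (by positivity)]
    exact h4

/-! ### The approximate exponential law. -/

/-- Mixing, short-return and regularity estimates for a sequence of shrinking targets `B n`, with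
`A n` the part of `B n` that escapes from `B n`. -/
structure HittingEstimates {α : Type*} [MeasurableSpace α] (μ : Measure α) (f : α → α)
    (A B : ℕ → Set α) (θ σ K β κ : ℝ) (n₀ : ℕ) : Prop where
  preserving : MeasurePreserving f μ μ
  measurableSet_A : ∀ n, MeasurableSet (A n)
  measurableSet_B : ∀ n, MeasurableSet (B n)
  subset : ∀ n, A n ⊆ B n
  θ_pos : 0 < θ
  σ_pos : 0 < σ
  one_le_K : 1 ≤ K
  β_pos : 0 < β
  κ_pos : 0 < κ
  κ_lt : κ < 1
  ratio : ∀ n ≥ n₀, |μ.real (A n) - θ * μ.real (B n)| ≤ K * (n : ℝ) ^ (-σ) * μ.real (B n)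
  mixing : ∀ n ≥ n₀, ∀ (j : ℕ) (D : Set α), MeasurableSet D →
    |μ.real (A n ∩ f^[j] ⁻¹' D) - μ.real (A n) * μ.real D| ≤ K * κ ^ j
  returns : ∀ n ≥ n₀, ∀ s : ℕ, ∑ j ∈ Finset.Icc 1 s, μ.real (A n ∩ f^[j] ⁻¹' A n) ≤
    K * μ.real (B n) * (s * μ.real (B n) + μ.real (B n) ^ β)
  far : ∀ n ≥ n₀, ∀ (m j : ℕ) (D : Set α), MeasurableSet D →
    |μ.real (avoid f (B n) m ∩ f^[m + j] ⁻¹' D) - μ.real (avoid f (B n) m) * μ.real D| ≤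
      K ^ (m + 1) * κ ^ j
  tail : ∀ n l, μ.real (avoid f (A n) l) ≤ μ.real (avoid f (B n) l) + K * μ.real (B n)
  pos : ∀ n ≥ n₀, 0 < μ.real (B n)
  mono : Monotone fun n : ℕ => n * μ.real (B n)
  tendsto : Tendsto (fun n => μ.real (B n)) atTop (𝓝 0)
  nested : ∀ m n, μ.real (B m) < μ.real (B n) → B m ⊆ B n

namespace HittingEstimates

variable {α : Type*} [MeasurableSpace α] {μ : Measure α} [IsProbabilityMeasure μ] {f : α → α}
  {A B : ℕ → Set α} {θ σ K β κ : ℝ} {n₀ : ℕ}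

set_option maxHeartbeats 1000000 in
-- Block decomposition at scale `t ≈ n^(1/4)`. The upper bound is joint with an arbitrary later
-- event `D`, so that it also yields correlations; for this the time is rounded down to a whole
-- number `l'` of blocks. Allowing `m ≥ n` lets one event serve a whole range of targets.
theorem exists_poisson (H : HittingEstimates μ f A B θ σ K β κ n₀) :
    ∃ γ : ℝ, 0 < γ ∧ ∀ᶠ n : ℕ in atTop, ∀ m ≥ n, n * μ.real (B m) ≤ Real.log n →
      (∀ l ≤ n, ∃ l' ≤ l, ∀ D, MeasurableSet D →
        μ.real (avoid f (A m) l' ∩ f^[l'] ⁻¹' D) ≤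
          Real.exp (2 - θ * μ.real (B m) * l) * μ.real D + (n : ℝ) ^ (-γ)) ∧
      Real.exp (-(θ * μ.real (B m) * n) - 2) - (n : ℝ) ^ (-γ) ≤ μ.real (avoid f (B m) n) := by
  -- The factor 8 makes each elementary error at most `P / 8`. Four of them give the block error `P
  -- / 2`; the incomplete last block and the passage from `A` to `B` fit in the rest.
  obtain ⟨γ, hγ, hev⟩ := exists_scale (8 * K) H.κ_pos H.κ_lt H.β_pos H.σ_pos
  refine ⟨γ, hγ, ?_⟩
  filter_upwards [hev, eventually_ge_atTop 2, eventually_ge_atTop n₀]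
    with n ⟨hT1, hT2, hT3, hT4⟩ hn2 hnn₀ m hm hb
  obtain ⟨-, ht1, ht4⟩ := half_rpow_le_sqrt_sqrt (by omega : 1 ≤ n)
  set t := Nat.sqrt (Nat.sqrt n) with ht
  have hK := H.one_le_K
  have hn1 : (1 : ℝ) ≤ n := by exact_mod_cast (by omega : 1 ≤ n)
  have hn0 : (0 : ℝ) < n := by linarith
  have htr : (1 : ℝ) ≤ t := by exact_mod_cast ht1
  have ht4r : (t : ℝ) ^ 4 ≤ n := by exact_mod_cast ht4
  set L := Real.log n with hL
  have hL0 : 0 < L := Real.log_pos (by exact_mod_cast hn2)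
  set b := μ.real (B m) with hbdef
  set p := μ.real (A m) with hpdef
  have hmn₀ : m ≥ n₀ := hnn₀.trans hm
  have hb0 : 0 < b := H.pos m hmn₀
  have hp0 : 0 ≤ p := measureReal_nonneg
  have hpb : p ≤ b := measureReal_mono (H.subset m)
  have hθ := H.θ_pos
  set P := (n : ℝ) ^ (-γ) with hP
  have hP0 : 0 < P := Real.rpow_pos_of_pos hn0 _
  have hP1 : P ≤ 1 := Real.rpow_le_one_of_one_le_of_nonpos hn1 (by linarith)
  set w := L / t with hw
  have hw0 : 0 < w := by positivity
  have hKw : w ≤ K * w := le_mul_of_one_le_left hw0.le hK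
  have hw8 : w ≤ 1 / 8 := by linarith
  have hbn : b ≤ L / n := by rw [le_div_iff₀ hn0]; linarith
  have hsb' : (t : ℝ) ^ 2 * b ≤ L / t ^ 2 := by
    rw [le_div_iff₀ (by positivity)]
    calc (t : ℝ) ^ 2 * b * t ^ 2 = t ^ 4 * b := by ring
      _ ≤ n * b := by gcongr
      _ ≤ L := hb
  have hsb : (t : ℝ) ^ 2 * b ≤ w := by
    refine hsb'.trans ?_
    rw [hw]
    gcongr
    nlinarith
  have hLsb : L * ((t : ℝ) ^ 2 * b) ≤ w * w := by
    calc L * ((t : ℝ) ^ 2 * b) ≤ L * (L / t ^ 2) := by gcongr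
      _ = w * w := by rw [hw]; field_simp
  have hww : w * w ≤ w := by nlinarith
  set R := K * b * (((t ^ 2 : ℕ) : ℝ) * b + b ^ β) with hR
  have hsp : ((t ^ 2 : ℕ) : ℝ) * p ≤ w := by
    push_cast
    exact (mul_le_mul_of_nonneg_left hpb (by positivity)).trans hsb
  have hratio := abs_le.1 (H.ratio m hmn₀)
  have hσ : K * (m : ℝ) ^ (-σ) * b * n ≤ 1 := by
    have h1 : (m : ℝ) ^ (-σ) ≤ (n : ℝ) ^ (-σ) :=
      Real.rpow_le_rpow_of_nonpos hn0 (by exact_mod_cast hm) (by linarith [H.σ_pos])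
    have h2 : (0 : ℝ) ≤ (n : ℝ) ^ (-σ) := by positivity
    calc K * (m : ℝ) ^ (-σ) * b * n = K * (m : ℝ) ^ (-σ) * (n * b) := by ring
      _ ≤ K * (n : ℝ) ^ (-σ) * L := by gcongr
      _ ≤ 1 := by nlinarith [mul_nonneg (mul_nonneg (by linarith : 0 ≤ K) hL0.le) h2]
  have hblocks : ∀ k : ℕ, k * (t ^ 2 + t) ≤ n → (k : ℝ) * t ^ 2 ≤ n ∧ (k : ℝ) * t * b ≤ w ∧
      ∀ D, MeasurableSet D → |μ.real (avoid f (A m) (k * (t ^ 2 + t)) ∩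
        f^[k * (t ^ 2 + t)] ⁻¹' D) - (1 - ((t ^ 2 : ℕ) : ℝ) * p) ^ k * μ.real D| ≤ P / 2 := by
    intro k hk
    have hks : (k : ℝ) * t ^ 2 ≤ n := by
      have : k * t ^ 2 ≤ n := le_trans (Nat.mul_le_mul_left _ (Nat.le_add_right _ _)) hk
      exact_mod_cast this
    have hkt : (k : ℝ) * t * b ≤ w := by
      rw [hw, le_div_iff₀ (by linarith)]
      calc (k : ℝ) * t * b * t = k * t ^ 2 * b := by ring
        _ ≤ n * b := by gcongr
        _ ≤ L := hb
    refine ⟨hks, hkt, fun D hD => ?_⟩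
    refine (abs_real_avoid_blocks_sub_le H.preserving (H.measurableSet_A m) (by linarith)
      H.κ_pos H.κ_lt (H.mixing m hmn₀) (t ^ 2) t (H.returns m hmn₀ _) (hsp.trans (by linarith))
      k hD).trans ?_
    have hκt : 0 ≤ κ ^ t := pow_nonneg H.κ_pos.le t
    have hbβ : b ^ β ≤ (L / n) ^ β := Real.rpow_le_rpow hb0.le hbn H.β_pos.le
    have e1 : (k : ℝ) * (t * p) ≤ w := by
      calc (k : ℝ) * (t * p) = k * t * p := by ring
        _ ≤ k * t * b := by gcongr
        _ ≤ w := hkt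
    have e2 : (k : ℝ) * (((t ^ 2 : ℕ) : ℝ) * (K * κ ^ t)) ≤ K * (n * κ ^ t) := by
      push_cast
      calc (k : ℝ) * ((t : ℝ) ^ 2 * (K * κ ^ t)) = k * t ^ 2 * (K * κ ^ t) := by ring
        _ ≤ n * (K * κ ^ t) := by gcongr
        _ = _ := by ring
    have e3 : (k : ℝ) * (((t ^ 2 : ℕ) : ℝ) * R) ≤ K * (w + L * (L / n) ^ β) := by
      rw [hR]
      push_cast
      calc (k : ℝ) * ((t : ℝ) ^ 2 * (K * b * ((t : ℝ) ^ 2 * b + b ^ β)))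
          = k * t ^ 2 * (K * b * ((t : ℝ) ^ 2 * b + b ^ β)) := by ring
        _ ≤ n * (K * b * ((t : ℝ) ^ 2 * b + b ^ β)) := by gcongr
        _ = K * ((n * b) * ((t : ℝ) ^ 2 * b + b ^ β)) := by ring
        _ ≤ K * (L * ((t : ℝ) ^ 2 * b + (L / n) ^ β)) := by gcongr
        _ ≤ K * (w + L * (L / n) ^ β) := by
            rw [mul_add L]
            gcongr
            linarith
    have e4 : (k : ℝ) * (t * p + ((t ^ 2 : ℕ) : ℝ) * (K * κ ^ t + R)) =
        k * (t * p) + k * (((t ^ 2 : ℕ) : ℝ) * (K * κ ^ t)) + k * (((t ^ 2 : ℕ) : ℝ) * R) := by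
      ring
    rw [e4]
    linarith
  have hx0 : 0 ≤ ((t ^ 2 : ℕ) : ℝ) * p := by positivity
  have hN0 : 0 < t ^ 2 + t := by positivity
  have hNb : ((t ^ 2 + t : ℕ) : ℝ) * b ≤ 2 * w := by
    push_cast
    have : (t : ℝ) * b ≤ t ^ 2 * b := by gcongr; nlinarith
    linarith
  refine ⟨fun l hl => ⟨l / (t ^ 2 + t) * (t ^ 2 + t), Nat.div_mul_le_self _ _, fun D hD => ?_⟩, ?_⟩
  · set k := l / (t ^ 2 + t) with hk
    obtain ⟨-, hkt, hX⟩ := hblocks k ((Nat.div_mul_le_self _ _).trans hl)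
    have hX := (abs_le.1 (hX D hD)).2
    have hlk : (l : ℝ) ≤ k * t ^ 2 + k * t + ((t ^ 2 + t : ℕ) : ℝ) := by
      have h1 : l < (k + 1) * (t ^ 2 + t) := by
        rw [mul_comm]
        exact Nat.lt_mul_div_succ l hN0
      have h2 : (l : ℝ) < ((k + 1) * (t ^ 2 + t) : ℕ) := by exact_mod_cast h1
      push_cast at h2 ⊢
      linarith
    have h1 : (1 - ((t ^ 2 : ℕ) : ℝ) * p) ^ k ≤ Real.exp (2 - θ * b * l) := by
      calc (1 - ((t ^ 2 : ℕ) : ℝ) * p) ^ k ≤ Real.exp (-(((t ^ 2 : ℕ) : ℝ) * p)) ^ k :=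
            pow_le_pow_left₀ (by linarith) (Real.one_sub_le_exp_neg _) k
        _ = Real.exp (-(k * t ^ 2 * p)) := by
            rw [← Real.exp_nat_mul]; push_cast; ring_nf
        _ ≤ Real.exp (2 - θ * b * l) := by
            apply Real.exp_le_exp.2
            -- The gaps and the incomplete block contribute at most `3 w ≤ 3 / 8` to the exponent
            -- and the ratio error at most 1, whence the constant 2.
            have h2 : p * l ≤ k * t ^ 2 * p + 3 * w := by
              calc p * l ≤ p * (k * t ^ 2 + k * t + ((t ^ 2 + t : ℕ) : ℝ)) := by gcongr
                _ = k * t ^ 2 * p + k * t * p + ((t ^ 2 + t : ℕ) : ℝ) * p := by ring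
                _ ≤ k * t ^ 2 * p + k * t * b + ((t ^ 2 + t : ℕ) : ℝ) * b := by gcongr
                _ ≤ _ := by linarith
            have h3 : (θ * b - K * (m : ℝ) ^ (-σ) * b) * l ≤ p * l := by
              gcongr
              linarith
            have h4 : K * (m : ℝ) ^ (-σ) * b * l ≤ 1 := by
              refine le_trans ?_ hσ
              gcongr
            linarith
    have h5 := mul_le_mul_of_nonneg_right h1 (measureReal_nonneg (μ := μ) (s := D))
    linarith
  · set k := n / (t ^ 2 + t) with hk
    obtain ⟨hks, hkt, hX⟩ := hblocks k (Nat.div_mul_le_self _ _)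
    have hX := (abs_le.1 (hX univ MeasurableSet.univ)).1
    rw [preimage_univ, inter_univ, probReal_univ, mul_one] at hX
    set x := ((t ^ 2 : ℕ) : ℝ) * p with hx
    have hxw : x ≤ 1 / 2 := by linarith
    have h1 : Real.exp (-(θ * b * n) - 2) ≤ (1 - x) ^ k := by
      -- Valid for `0 ≤ x ≤ 1 / 2`. The quadratic terms add up to at most `2 w²` over all blocks, so
      -- they cost only a bounded factor.
      have h2 : Real.exp (-(x + 2 * x * x)) ≤ 1 - x := by
        have h3 := Real.add_one_le_exp (x + 2 * x * x)
        rw [Real.exp_neg, inv_eq_one_div, div_le_iff₀ (Real.exp_pos _)]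
        have h4 : 0 ≤ 1 - x := by linarith
        refine le_trans ?_ (mul_le_mul_of_nonneg_left h3 h4)
        nlinarith [mul_nonneg hx0 hx0]
      calc Real.exp (-(θ * b * n) - 2) ≤ Real.exp (-(x + 2 * x * x)) ^ k := by
            rw [← Real.exp_nat_mul]
            apply Real.exp_le_exp.2
            have h5 : (k : ℝ) * x ≤ n * p := by
              rw [hx]; push_cast
              calc (k : ℝ) * ((t : ℝ) ^ 2 * p) = k * t ^ 2 * p := by ring
                _ ≤ n * p := by gcongr
            have h6 : x ≤ (t : ℝ) ^ 2 * b := by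
              rw [hx]; push_cast; gcongr
            have h7 : (k : ℝ) * x * x ≤ w * w := by
              calc (k : ℝ) * x * x ≤ (n * p) * x := by gcongr
                _ ≤ L * ((t : ℝ) ^ 2 * b) := by
                    refine mul_le_mul ?_ h6 hx0 hL0.le
                    exact le_trans (by gcongr) hb
                _ ≤ _ := hLsb
            have h8 : n * p ≤ n * (θ * b + K * (m : ℝ) ^ (-σ) * b) := by
              gcongr
              linarith
            nlinarith
        _ ≤ (1 - x) ^ k := pow_le_pow_left₀ (Real.exp_pos _).le h2 k
    have h2 := real_avoid_sub_le H.preserving (H.measurableSet_A m)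
      (Nat.div_mul_le_self n (t ^ 2 + t))
    rw [← hk] at h2
    have h3 : ((n - k * (t ^ 2 + t) : ℕ) : ℝ) * p ≤ ((t ^ 2 + t : ℕ) : ℝ) * b := by
      have : n - k * (t ^ 2 + t) ≤ t ^ 2 + t := by
        have h := Nat.mod_add_div n (t ^ 2 + t)
        have h' := (Nat.mod_lt n hN0).le
        rw [mul_comm, ← hk] at h
        omega
      gcongr
    have h4 := H.tail m n
    have h5 : K * b ≤ K * w := by
      gcongr
      refine le_trans (le_mul_of_one_le_left hb0.le ?_) hsb
      nlinarith
    linarith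

end HittingEstimates


/-! ### The convergent case. -/

theorem summable_log_rpow {η : ℝ} (hη : 0 < η) (c : ℝ) :
    Summable fun n : ℕ => c * Real.log n / n * (n : ℝ) ^ (-η) := by
  have h : Summable fun n : ℕ => (n : ℝ) ^ (-1 - η / 2) :=
    Real.summable_nat_rpow.2 (by linarith)
  refine summable_of_isBigO_nat h (Asymptotics.IsBigO.of_bound 1 ?_)
  filter_upwards [eventually_log_le |c| (half_pos hη), eventually_ge_atTop 1] with n hn hn1
  have hn0 : (0 : ℝ) < n := by exact_mod_cast hn1
  have hL : 0 ≤ Real.log n := Real.log_nonneg (by exact_mod_cast hn1)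
  rw [one_mul, Real.norm_of_nonneg (by positivity : 0 ≤ (n : ℝ) ^ (-1 - η / 2)), norm_mul,
    norm_div, norm_mul, Real.norm_of_nonneg hL, Real.norm_of_nonneg hn0.le,
    Real.norm_of_nonneg (by positivity : 0 ≤ (n : ℝ) ^ (-η)), Real.norm_eq_abs]
  calc |c| * Real.log n / n * (n : ℝ) ^ (-η) ≤ (n : ℝ) ^ (η / 2) / n * (n : ℝ) ^ (-η) := by gcongr
    _ = (n : ℝ) ^ (-1 - η / 2) := by
        rw [div_eq_mul_inv, ← Real.rpow_neg_one, ← Real.rpow_add hn0, ← Real.rpow_add hn0]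
        ring_nf

theorem antitone_mul_exp_neg {θ x y : ℝ} (hθ : 0 < θ) (hy : 1 ≤ θ * y) (hyx : y ≤ x) :
    x * Real.exp (-(θ * x)) ≤ y * Real.exp (-(θ * y)) := by
  have hy0 : 0 < y := by
    by_contra h
    push Not at h
    nlinarith
  have h1 : Real.exp (-(θ * y)) = Real.exp (-(θ * x)) * Real.exp (θ * (x - y)) := by
    rw [← Real.exp_add]; ring_nf
  have h2 := Real.add_one_le_exp (θ * (x - y))
  rw [h1, mul_comm x, mul_left_comm]
  refine mul_le_mul_of_nonneg_left ?_ (Real.exp_pos _).le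
  have h3 : y * (θ * (x - y) + 1) ≤ y * Real.exp (θ * (x - y)) := by gcongr
  nlinarith [mul_le_mul_of_nonneg_right hy (sub_nonneg.2 hyx)]

theorem exists_block_of_strictMono {N : ℕ → ℕ} (hN : StrictMono N) {K m : ℕ} (hm : N K ≤ m) :
    ∃ k ≥ K, N k ≤ m ∧ m < N (k + 1) := by
  have hex : ∃ k, m < N (k + 1) := ⟨m, hN.id_le (m + 1)⟩
  have hKk : K ≤ Nat.find hex := by
    by_contra h
    push Not at h
    have h1 := Nat.find_spec hex
    have h2 := hN.monotone (show Nat.find hex + 1 ≤ K from h)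
    omega
  refine ⟨Nat.find hex, hKk, ?_, Nat.find_spec hex⟩
  rcases hKk.eq_or_lt with h | h
  · rwa [← h]
  · have h1 := Nat.find_min hex (show Nat.find hex - 1 < Nat.find hex by omega)
    rw [show Nat.find hex - 1 + 1 = Nat.find hex by omega] at h1
    omega

/-- Along the blocks `N (k + 1) = N k + ⌈N k / a (N k)⌉`, the series `∑ exp (-θ a (N k))` is
controlled by `∑ a n / n * exp (-θ a n)`. -/
theorem summable_exp_neg_blocks {a : ℕ → ℝ} (ha : Monotone a) {θ : ℝ} (hθ : 0 < θ)
    (hsum : Summable fun n : ℕ => a n / n * Real.exp (-(θ * a n))) {N : ℕ → ℕ} (ha0 : ∀ n, 0 ≤ a n)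
    (hN : StrictMono N) (ha1 : 1 ≤ a (N 0)) (hθa : 1 ≤ θ * a (N 0))
    (hlow : ∀ k, (N k : ℝ) / a (N k) ≤ N (k + 1) - N k)
    (hupp : ∀ k, (N (k + 1) : ℝ) ≤ 3 * N k) :
    Summable fun k => Real.exp (-(θ * a (N k))) := by
  rw [← summable_nat_add_iff 1]
  set u : ℕ → ℝ := fun n => a n / n * Real.exp (-(θ * a n)) with hu
  have hu0 : ∀ n, 0 ≤ u n := fun n =>
    mul_nonneg (div_nonneg (ha0 n) (Nat.cast_nonneg n)) (Real.exp_pos _).le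
  -- The block has at least `N k / a (N k)` terms, each at least `a (N (k + 1)) W / N (k + 1)`
  -- because `x exp (-θ x)` decreases beyond `1 / θ`. Charging the right endpoint of the block is
  -- why the sum is shifted by one.
  have hblock : ∀ k, Real.exp (-(θ * a (N (k + 1)))) ≤
      3 * ∑ i ∈ Finset.Ioc (N k) (N (k + 1)), u i := by
    intro k
    have hk1 : N k < N (k + 1) := hN k.lt_succ_self
    have haN : 1 ≤ a (N k) := ha1.trans (ha (hN.monotone (Nat.zero_le k)))
    have haN' : a (N k) ≤ a (N (k + 1)) := ha hk1.le
    have hN1 : (0 : ℝ) < N (k + 1) := by exact_mod_cast (by omega : 0 < N (k + 1))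
    set W := Real.exp (-(θ * a (N (k + 1)))) with hW
    have hterm : ∀ i ∈ Finset.Ioc (N k) (N (k + 1)), a (N (k + 1)) * W / N (k + 1) ≤ u i := by
      intro i hi
      rw [Finset.mem_Ioc] at hi
      have hi0 : (0 : ℝ) < i := by exact_mod_cast (by omega : 0 < i)
      have h0 : N 0 ≤ i := (hN.monotone (Nat.zero_le k)).trans hi.1.le
      rw [hu]
      simp only
      rw [div_mul_eq_mul_div]
      refine div_le_div₀ (mul_nonneg (ha0 i) (Real.exp_pos _).le)
        (antitone_mul_exp_neg hθ ?_ (ha hi.2)) hi0 (by exact_mod_cast hi.2)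
      exact hθa.trans (mul_le_mul_of_nonneg_left (ha h0) hθ.le)
    have hsum' := Finset.card_nsmul_le_sum _ _ _ hterm
    rw [Nat.card_Ioc, nsmul_eq_mul, Nat.cast_sub hk1.le] at hsum'
    have hW0 : 0 < W := Real.exp_pos _
    have h1 : W / 3 ≤ (N (k + 1) - N k : ℝ) * (a (N (k + 1)) * W / N (k + 1)) := by
      calc W / 3 ≤ ((N k : ℝ) / N (k + 1)) * W := by
            rw [div_mul_eq_mul_div, div_le_div_iff₀ three_pos hN1]
            nlinarith [hupp k]
        _ = (N k : ℝ) / a (N k) * (a (N k) * W / N (k + 1)) := by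
            field_simp
        _ ≤ (N (k + 1) - N k : ℝ) * (a (N (k + 1)) * W / N (k + 1)) := by
            have h2 : (0 : ℝ) ≤ N (k + 1) - N k := by
              have : (N k : ℝ) ≤ N (k + 1) := by exact_mod_cast hk1.le
              linarith
            have := hlow k
            have := ha0 (N k)
            gcongr
    linarith
  refine summable_of_sum_range_le (c := 3 * ∑' i, u i) (fun k => (Real.exp_pos _).le) fun K => ?_
  have hpart : ∀ K, ∑ k ∈ Finset.range K, Real.exp (-(θ * a (N (k + 1)))) ≤
      3 * ∑ i ∈ Finset.Ioc (N 0) (N K), u i := by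
    intro K
    induction K with
    | zero => simp
    | succ K ih =>
      rw [Finset.sum_range_succ, ← Finset.sum_Ioc_consecutive _
        (hN.monotone (Nat.zero_le K)) (hN.monotone K.le_succ), mul_add]
      exact add_le_add ih (hblock K)
  refine (hpart K).trans ?_
  gcongr
  exact hsum.sum_le_tsum _ fun i _ => hu0 i

namespace HittingEstimates

variable {α : Type*} [MeasurableSpace α] {μ : Measure α} {f : α → α} {A B : ℕ → Set α}
  {θ σ K β κ : ℝ} {n₀ : ℕ}

/-- If the nondecreasing sequence `n μ(B n)` stayed bounded, the terms would dominate a positive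
multiple of `1 / n`. -/
theorem tendsto_atTop_of_summable (H : HittingEstimates μ f A B θ σ K β κ n₀)
    (hsum : Summable fun n : ℕ => μ.real (B n) * Real.exp (-(n * θ * μ.real (B n)))) :
    Tendsto (fun n : ℕ => n * μ.real (B n)) atTop atTop := by
  rcases tendsto_atTop_of_monotone H.mono with h | ⟨l, hl⟩
  · exact h
  exfalso
  set N := max n₀ 1 with hN
  set c := (N : ℝ) * μ.real (B N) * Real.exp (-(θ * l)) with hc
  have hN1 : (0 : ℝ) < N := by exact_mod_cast (lt_of_lt_of_le one_pos (le_max_right n₀ 1))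
  have hc0 : 0 < c := mul_pos (mul_pos hN1 (H.pos N (le_max_left _ _))) (Real.exp_pos _)
  have h1 : Summable fun n : ℕ => c * (1 / (n : ℝ)) := by
    refine Summable.of_norm_bounded_eventually_nat hsum ?_
    filter_upwards [eventually_ge_atTop N] with n hn
    have hn0 : (0 : ℝ) < n := hN1.trans_le (by exact_mod_cast hn)
    rw [Real.norm_of_nonneg (by positivity)]
    have e1 : (N : ℝ) * μ.real (B N) ≤ n * μ.real (B n) := H.mono hn
    have e2 : (n : ℝ) * μ.real (B n) ≤ l := H.mono.ge_of_tendsto hl n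
    have e3 : Real.exp (-(θ * l)) ≤ Real.exp (-(n * θ * μ.real (B n))) := by
      apply Real.exp_le_exp.2
      have := mul_le_mul_of_nonneg_left e2 H.θ_pos.le
      linarith
    calc c * (1 / n) ≤ n * μ.real (B n) * Real.exp (-(n * θ * μ.real (B n))) * (1 / n) := by
          rw [hc]; gcongr
      _ = _ := by field_simp
  rw [summable_mul_left_iff hc0.ne'] at h1
  exact Real.not_summable_one_div_natCast h1

/-- The summable case: almost every orbit hits `B n` within the first `n` steps, for all large
`n`. -/
theorem ae_eventually_notMem_avoid [IsProbabilityMeasure μ]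
    (H : HittingEstimates μ f A B θ σ K β κ n₀)
    (hsum : Summable fun n : ℕ => μ.real (B n) * Real.exp (-(n * θ * μ.real (B n)))) :
    ∀ᵐ x ∂μ, ∀ᶠ n in atTop, x ∉ avoid f (B n) n := by
  obtain ⟨γ, hγ, hpois⟩ := H.exists_poisson
  have hθ := H.θ_pos
  -- Capping at `c₀ log n` keeps the exponential law applicable, as `c₀ ≤ 1`, and makes the error
  -- `n^(-γ)` at most `exp (-θ a n)`, as `θ c₀ ≤ γ`. The cap adds only a convergent series.
  set c₀ := min 1 (γ / θ) with hc₀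
  have hc₀0 : 0 < c₀ := lt_min one_pos (div_pos hγ hθ)
  have hc₀1 : c₀ ≤ 1 := min_le_left _ _
  have hc₀γ : θ * c₀ ≤ γ := by
    calc θ * c₀ ≤ θ * (γ / θ) := mul_le_mul_of_nonneg_left (min_le_right _ _) hθ.le
      _ = γ := by field_simp
  set a : ℕ → ℝ := fun n => min (n * μ.real (B n)) (c₀ * Real.log n) with ha
  have hlogmono : Monotone fun n : ℕ => Real.log n := by
    intro m n hmn
    rcases Nat.eq_zero_or_pos m with rfl | hm
    · simpa using Real.log_natCast_nonneg n
    · exact Real.log_le_log (by exact_mod_cast hm) (by exact_mod_cast hmn)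
  have hamono : Monotone a := fun m n hmn => min_le_min (H.mono hmn)
    (mul_le_mul_of_nonneg_left (hlogmono hmn) hc₀0.le)
  have ha0 : ∀ n, 0 ≤ a n := fun n => le_min (by positivity)
    (mul_nonneg hc₀0.le (Real.log_natCast_nonneg n))
  have hatop : Tendsto a atTop atTop := by
    have h1 := H.tendsto_atTop_of_summable hsum
    have h2 : Tendsto (fun n : ℕ => c₀ * Real.log n) atTop atTop :=
      (Real.tendsto_log_atTop.comp tendsto_natCast_atTop_atTop).const_mul_atTop hc₀0
    refine tendsto_atTop.2 fun y => ?_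
    filter_upwards [h1.eventually_ge_atTop y, h2.eventually_ge_atTop y] with n ha hb
      using le_min ha hb
  have hasum : Summable fun n : ℕ => a n / n * Real.exp (-(θ * a n)) := by
    refine Summable.of_nonneg_of_le (fun n => mul_nonneg (div_nonneg (ha0 n) (Nat.cast_nonneg n))
      (Real.exp_pos _).le) (fun n => ?_)
      (hsum.add (summable_log_rpow (mul_pos hθ hc₀0) c₀))
    rcases Nat.eq_zero_or_pos n with rfl | hn
    · simp
    have hn0 : (0 : ℝ) < n := by exact_mod_cast hn
    have hL := Real.log_natCast_nonneg n
    have e1 : 0 ≤ μ.real (B n) * Real.exp (-(n * θ * μ.real (B n))) := by positivity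
    have e2 : 0 ≤ c₀ * Real.log n / n * (n : ℝ) ^ (-(θ * c₀)) := by positivity
    rcases min_choice (n * μ.real (B n)) (c₀ * Real.log n) with h | h
    · refine le_trans (le_of_eq ?_) (le_add_of_nonneg_right e2)
      simp only [ha, h]
      rw [mul_div_cancel_left₀ _ hn0.ne']
      ring_nf
    · refine le_trans (le_of_eq ?_) (le_add_of_nonneg_left e1)
      simp only [ha, h]
      rw [Real.rpow_def_of_pos hn0]
      ring_nf
  obtain ⟨n₁, hn₁⟩ := eventually_atTop.1 (hpois.and ((hatop.eventually_ge_atTop (max 1 (1 / θ))).and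
    (eventually_ge_atTop (max 1 n₀))))
  set N : ℕ → ℕ := fun k => Nat.rec n₁ (fun _ m => m + ⌈(m : ℝ) / a m⌉₊) k with hN
  have hNsucc : ∀ k, N (k + 1) = N k + ⌈(N k : ℝ) / a (N k)⌉₊ := fun k => rfl
  have hNge : ∀ k, n₁ ≤ N k := by
    intro k
    induction k with
    | zero => exact le_rfl
    | succ k ih => rw [hNsucc]; omega
  have haN1 : ∀ k, 1 ≤ a (N k) := fun k => (le_max_left _ _).trans (hn₁ _ (hNge k)).2.1
  have hNpos : ∀ k, 1 ≤ N k := fun k => (le_max_left _ _).trans (hn₁ _ (hNge k)).2.2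
  have hNposr : ∀ k, (1 : ℝ) ≤ N k := fun k => by exact_mod_cast hNpos k
  have hNmono : StrictMono N := by
    refine strictMono_nat_of_lt_succ fun k => ?_
    rw [hNsucc]
    have : 0 < ⌈(N k : ℝ) / a (N k)⌉₊ := Nat.ceil_pos.2
      (div_pos (by linarith [hNposr k]) (by linarith [haN1 k]))
    omega
  have hNr : ∀ k, (N (k + 1) : ℝ) = N k + (⌈(N k : ℝ) / a (N k)⌉₊ : ℕ) := fun k => by
    rw [hNsucc]; push_cast; rfl
  have haN : ∀ k, a (N k) ≤ N k := fun k => by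
    refine (min_le_left _ _).trans (mul_le_of_le_one_right (Nat.cast_nonneg _) measureReal_le_one)
  have hupp : ∀ k, (N (k + 1) : ℝ) ≤ N k * (1 + 2 / a (N k)) := by
    intro k
    have h1 := haN1 k
    have h2 : 1 ≤ (N k : ℝ) / a (N k) := (one_le_div (by linarith)).2 (haN k)
    have h3 := Nat.ceil_lt_add_one (show 0 ≤ (N k : ℝ) / a (N k) by positivity)
    rw [hNr]
    have e : (N k : ℝ) * (1 + 2 / a (N k)) = N k + 2 * (N k / a (N k)) := by ring
    rw [e]
    linarith
  have hws : Summable fun k => Real.exp (-(θ * a (N k))) := by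
    refine summable_exp_neg_blocks hamono hθ hasum ha0 hNmono (haN1 0) ?_ (fun k => ?_) fun k => ?_
    · have := (le_max_right _ _).trans (hn₁ _ (hNge 0)).2.1
      rwa [div_le_iff₀' hθ] at this
    · rw [hNr]
      linarith [Nat.le_ceil ((N k : ℝ) / a (N k))]
    · refine (hupp k).trans ?_
      have h1 : 2 / a (N k) ≤ 2 := div_le_self two_pos.le (haN1 k)
      have := hNposr k
      nlinarith
  have hmiss : ∀ k, μ.real (⋃ m ∈ Finset.Ico (N k) (N (k + 1)), avoid f (B m) m) ≤
      (Real.exp (2 + 3 * θ) + 1) * Real.exp (-(θ * a (N k))) := by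
    intro k
    set n := N k with hn
    have hn1 : (1 : ℝ) ≤ n := hNposr k
    have hN' : (0 : ℝ) < N (k + 1) := by linarith [hNposr (k + 1)]
    have ha1 : 1 ≤ a n := haN1 k
    -- Every ball in the block has measure at least `v`. The first later index `m'` whose ball has
    -- measure below `v` therefore gives a ball inside all of them, so one avoidance event covers
    -- all failures in the block.
    set v := a n / N (k + 1) with hv
    have hv0 : 0 < v := by positivity
    have hbv : ∀ m, n ≤ m → m < N (k + 1) → v ≤ μ.real (B m) := by
      intro m hnm hm
      have hm0 : (0 : ℝ) < m := by exact_mod_cast (lt_of_lt_of_le (hNpos k) hnm)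
      rw [hv, div_le_iff₀ hN']
      calc a n ≤ n * μ.real (B n) := min_le_left _ _
        _ ≤ m * μ.real (B m) := H.mono hnm
        _ ≤ N (k + 1) * μ.real (B m) := by gcongr
        _ = _ := mul_comm _ _
    have hex : ∃ m, n ≤ m ∧ μ.real (B m) < v :=
      ((eventually_ge_atTop n).and (H.tendsto.eventually_lt_const hv0)).exists
    classical
    set m' := Nat.find hex with hm'
    obtain ⟨hnm', hbm'⟩ := Nat.find_spec hex
    have hlt : n < m' := by
      rcases hnm'.eq_or_lt with h | h
      · have h1 := hbv n le_rfl (hNmono k.lt_succ_self)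
        rw [← h] at hbm'
        exact absurd hbm' (not_lt.2 h1)
      · exact h
    have hprev : v ≤ μ.real (B (m' - 1)) := by
      have h1 := Nat.find_min hex (show m' - 1 < m' by omega)
      by_contra hcon
      exact h1 ⟨by omega, not_le.1 hcon⟩
    -- By minimality of `m'` and monotonicity of `m μ(B m)`, the ball `B m'` is not much smaller
    -- than `v`. Of the loss 3, rounding the block length accounts for 2 and the step from `m' - 1`
    -- to `m'` for 1.
    have hlow' : a n - 3 ≤ n * μ.real (B m') := by
      have h1 : ((m' - 1 : ℕ) : ℝ) * μ.real (B (m' - 1)) ≤ m' * μ.real (B m') :=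
        H.mono (Nat.sub_le _ _)
      rw [Nat.cast_sub (by omega), Nat.cast_one] at h1
      have hnm : (n : ℝ) + 1 ≤ m' := by exact_mod_cast hlt
      have hm0 : (0 : ℝ) < m' := by linarith
      have h2 : (1 - 1 / (n : ℝ)) * v ≤ μ.real (B m') := by
        have h3 : ((m' : ℝ) - 1) * v ≤ m' * μ.real (B m') :=
          le_trans (mul_le_mul_of_nonneg_left hprev (by linarith)) h1
        have h4 : (1 - 1 / (m' : ℝ)) * v ≤ μ.real (B m') := by
          refine le_of_mul_le_mul_left ?_ hm0
          calc (m' : ℝ) * ((1 - 1 / (m' : ℝ)) * v) = (m' - 1) * v := by field_simp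
            _ ≤ _ := h3
        refine le_trans ?_ h4
        have h5 : 1 / (m' : ℝ) ≤ 1 / n := one_div_le_one_div_of_le (by linarith) (by linarith)
        gcongr
      have h6 : a n - 2 ≤ n * v := by
        rw [hv, ← mul_div_assoc, le_div_iff₀ hN']
        rcases le_total (a n) 2 with h | h
        · have : 0 ≤ (n : ℝ) * a n := by positivity
          nlinarith
        · calc (a n - 2) * N (k + 1) ≤ (a n - 2) * (n * (1 + 2 / a n)) :=
                mul_le_mul_of_nonneg_left (hupp k) (by linarith)
            _ = n * (a n - 4 / a n) := by field_simp; ring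
            _ ≤ n * a n := by
                have : 0 < 4 / a n := by positivity
                gcongr
                linarith
      have h7 : v ≤ 1 := hprev.trans measureReal_le_one
      calc a n - 3 ≤ n * v - v := by linarith
        _ = n * ((1 - 1 / (n : ℝ)) * v) := by field_simp
        _ ≤ n * μ.real (B m') := by gcongr
    have hupp' : n * μ.real (B m') ≤ Real.log n := by
      have h1 : n * μ.real (B m') ≤ a n := by
        calc n * μ.real (B m') ≤ n * v := by gcongr
          _ = a n * (n / N (k + 1)) := by rw [hv]; ring
          _ ≤ a n * 1 := by
              gcongr
              rw [div_le_one hN']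
              exact_mod_cast (hNmono k.lt_succ_self).le
          _ = a n := mul_one _
      refine h1.trans ((min_le_right _ _).trans ?_)
      exact mul_le_of_le_one_left (Real.log_natCast_nonneg n) hc₀1
    obtain ⟨l', hl', hX⟩ := ((hn₁ n (hNge k)).1 m' hnm' hupp').1 n le_rfl
    have hX := hX univ MeasurableSet.univ
    rw [preimage_univ, inter_univ, probReal_univ, mul_one] at hX
    have hsub : (⋃ m ∈ Finset.Ico n (N (k + 1)), avoid f (B m) m) ⊆ avoid f (A m') l' := by
      refine iUnion₂_subset fun m hm => ?_
      rw [Finset.mem_Ico] at hm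
      have h1 : B m' ⊆ B m := H.nested _ _ (hbm'.trans_le (hbv m hm.1 hm.2))
      exact (avoid_subset_avoid ((H.subset m').trans h1) m).trans (avoid_anti (hl'.trans hm.1))
    have hP : (n : ℝ) ^ (-γ) ≤ Real.exp (-(θ * a n)) := by
      rw [Real.rpow_def_of_pos (by linarith)]
      apply Real.exp_le_exp.2
      have h1 : a n ≤ c₀ * Real.log n := min_le_right _ _
      have h2 : θ * a n ≤ θ * (c₀ * Real.log n) := by gcongr
      have h3 : θ * c₀ * Real.log n ≤ γ * Real.log n :=
        mul_le_mul_of_nonneg_right hc₀γ (Real.log_natCast_nonneg n)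
      linarith
    refine (measureReal_mono hsub).trans (hX.trans ?_)
    have h1 : Real.exp (2 - θ * μ.real (B m') * n) ≤
        Real.exp (2 + 3 * θ) * Real.exp (-(θ * a n)) := by
      rw [← Real.exp_add]
      apply Real.exp_le_exp.2
      have := mul_le_mul_of_nonneg_left hlow' hθ.le
      linarith
    linarith
  have hBC : ∀ᵐ x ∂μ, ∀ᶠ k in atTop,
      x ∉ ⋃ m ∈ Finset.Ico (N k) (N (k + 1)), avoid f (B m) m := by
    refine ae_eventually_notMem (ne_top_of_le_ne_top (hws.mul_left
      (Real.exp (2 + 3 * θ) + 1)).tsum_ofReal_ne_top (ENNReal.tsum_le_tsum fun k => ?_))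
    rw [← ofReal_measureReal (measure_ne_top _ _)]
    exact ENNReal.ofReal_le_ofReal (hmiss k)
  filter_upwards [hBC] with x hx
  obtain ⟨k₀, hk₀⟩ := eventually_atTop.1 hx
  filter_upwards [eventually_ge_atTop (N k₀)] with m hm hxm
  obtain ⟨k, hk, h1, h2⟩ := exists_block_of_strictMono hNmono hm
  exact hk₀ k hk (mem_iUnion₂.2 ⟨m, Finset.mem_Ico.2 ⟨h1, h2⟩, hxm⟩)

end HittingEstimates


/-! ### Second-moment form of the divergence Borel–Cantelli lemma. -/

section SecondMoment

variable {α : Type*} [MeasurableSpace α] {μ : Measure α} [IsProbabilityMeasure μ]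

/-- Integrates the pointwise inequality `2cX - c²X² ≤ 1` on the union, where `X` counts the events
that occur; off the union `X = 0`. Optimising over `c` would give the Chung–Erdős bound. -/
theorem two_mul_sum_sub_le_real_biUnion {ι : Type*} (F : Finset ι) {E : ι → Set α}
    (hE : ∀ i, MeasurableSet (E i)) (c : ℝ) :
    2 * c * ∑ i ∈ F, μ.real (E i) - c ^ 2 * ∑ i ∈ F, ∑ j ∈ F, μ.real (E i ∩ E j) ≤
      μ.real (⋃ i ∈ F, E i) := by
  have hU : MeasurableSet (⋃ i ∈ F, E i) := F.measurableSet_biUnion fun i _ => hE i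
  have hint : ∀ S : Set α, MeasurableSet S → Integrable (S.indicator fun _ => (1 : ℝ)) μ :=
    fun S hS => (integrable_const 1).indicator hS
  have hval : ∀ S : Set α, MeasurableSet S → ∫ x, S.indicator (fun _ => (1 : ℝ)) x ∂μ = μ.real S :=
    fun S hS => by rw [integral_indicator hS, setIntegral_const, smul_eq_mul, mul_one]
  have h1 : ∫ x, (2 * c * ∑ i ∈ F, (E i).indicator (fun _ => (1 : ℝ)) x -
      c ^ 2 * ∑ i ∈ F, ∑ j ∈ F, (E i ∩ E j).indicator (fun _ => (1 : ℝ)) x) ∂μ =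
      2 * c * ∑ i ∈ F, μ.real (E i) - c ^ 2 * ∑ i ∈ F, ∑ j ∈ F, μ.real (E i ∩ E j) := by
    rw [integral_sub, integral_const_mul, integral_const_mul, integral_finsetSum,
      integral_finsetSum]
    · congr 2
      · exact Finset.sum_congr rfl fun i _ => hval _ (hE i)
      · refine Finset.sum_congr rfl fun i _ => ?_
        rw [integral_finsetSum _ fun j _ => hint _ ((hE i).inter (hE j))]
        exact Finset.sum_congr rfl fun j _ => hval _ ((hE i).inter (hE j))
    · exact fun i _ => integrable_finsetSum _ fun j _ => hint _ ((hE i).inter (hE j))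
    · exact fun i _ => hint _ (hE i)
    · exact (integrable_finsetSum _ fun i _ => hint _ (hE i)).const_mul _
    · exact (integrable_finsetSum _ fun i _ => integrable_finsetSum _ fun j _ =>
        hint _ ((hE i).inter (hE j))).const_mul _
  rw [← h1, ← hval _ hU]
  refine integral_mono ?_ (hint _ hU) fun x => ?_
  · exact ((integrable_finsetSum _ fun i _ => hint _ (hE i)).const_mul _).sub
      ((integrable_finsetSum _ fun i _ => integrable_finsetSum _ fun j _ =>
        hint _ ((hE i).inter (hE j))).const_mul _)
  · have hsq : ∑ i ∈ F, ∑ j ∈ F, (E i ∩ E j).indicator (fun _ => (1 : ℝ)) x =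
        (∑ i ∈ F, (E i).indicator (fun _ => (1 : ℝ)) x) ^ 2 := by
      rw [sq, Finset.sum_mul_sum]
      refine Finset.sum_congr rfl fun i _ => Finset.sum_congr rfl fun j _ => ?_
      rw [← inter_indicator_mul]
      simp
    simp only [hsq]
    by_cases hx : x ∈ ⋃ i ∈ F, E i
    · rw [indicator_of_mem hx]
      nlinarith [sq_nonneg (1 - c * ∑ i ∈ F, (E i).indicator (fun _ => (1 : ℝ)) x)]
    · rw [indicator_of_notMem hx]
      have : ∀ i ∈ F, (E i).indicator (fun _ => (1 : ℝ)) x = 0 := fun i hi =>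
        indicator_of_notMem (fun h => hx (mem_iUnion₂.2 ⟨i, hi, h⟩)) _
      rw [Finset.sum_eq_zero this]
      simp

/-- Pair correlations exceed the product bound only by a summable function of the index difference,
so the second moment is at most a constant times the square of the sum of the weights. Every tail
union then has measure at least `c² / C'`, and this passes to the limsup. -/
theorem pos_measure_frequently {E : ℕ → Set α} (hE : ∀ i, MeasurableSet (E i)) {w ε : ℕ → ℝ}
    {c C : ℝ} (hw : ∀ k, 0 ≤ w k) (hns : ¬ Summable w) (hε0 : ∀ k, 0 ≤ ε k) (hε : Summable ε)
    (hc : 0 < c) (hC : 0 < C) (hlow : ∀ k, c * w k ≤ μ.real (E k))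
    (hpair : ∀ j k, j ≤ k → μ.real (E j ∩ E k) ≤ C * w j * (w k + ε (k - j))) :
    0 < μ {x | ∃ᶠ k in atTop, x ∈ E k} := by
  set S₀ := ∑' k, ε k with hS₀
  have hS₀0 : 0 ≤ S₀ := tsum_nonneg hε0
  set C' := 2 * C * (1 + S₀) with hC'
  have hC'0 : 0 < C' := by positivity
  have htail : ∀ K : ℕ, c ^ 2 / C' ≤ μ.real (⋃ k ≥ K, E k) := by
    intro K
    have htend : Tendsto (fun N => ∑ k ∈ Finset.range N, w k) atTop atTop :=
      not_summable_iff_tendsto_nat_atTop_of_nonneg hw |>.1 hns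
    obtain ⟨N, hN1, hN⟩ := ((htend.eventually_ge_atTop (∑ k ∈ Finset.range K, w k + 1)).and
      (eventually_ge_atTop K)).exists
    set F := Finset.Ico K N with hF
    set S := ∑ k ∈ F, w k with hS
    have hS1 : 1 ≤ S := by
      rw [hS, hF, Finset.sum_Ico_eq_sub _ hN]
      linarith
    have hsumε : ∀ j, ∑ k ∈ F.filter (j ≤ ·), ε (k - j) ≤ S₀ := by
      intro j
      have hinj : InjOn (fun k => k - j) (F.filter (j ≤ ·) : Finset ℕ) := by
        intro a ha b hb hab
        have h1 := (Finset.mem_filter.1 (Finset.mem_coe.1 ha)).2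
        have h2 := (Finset.mem_filter.1 (Finset.mem_coe.1 hb)).2
        simp only at hab
        omega
      rw [← Finset.sum_image (f := ε) hinj]
      exact hε.sum_le_tsum _ fun i _ => hε0 i
    have hhalf : ∀ j ∈ F, ∑ k ∈ F.filter (j ≤ ·), μ.real (E j ∩ E k) ≤
        C * w j * (S + S₀) := by
      intro j _
      calc ∑ k ∈ F.filter (j ≤ ·), μ.real (E j ∩ E k)
          ≤ ∑ k ∈ F.filter (j ≤ ·), C * w j * (w k + ε (k - j)) :=
            Finset.sum_le_sum fun k hk => hpair j k (Finset.mem_filter.1 hk).2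
        _ = C * w j * (∑ k ∈ F.filter (j ≤ ·), w k + ∑ k ∈ F.filter (j ≤ ·), ε (k - j)) := by
            rw [← Finset.mul_sum, Finset.sum_add_distrib]
        _ ≤ C * w j * (S + S₀) := by
            have := hw j
            gcongr
            · exact Finset.sum_le_sum_of_subset_of_nonneg (Finset.filter_subset _ _)
                fun k _ _ => hw k
            · exact hsumε j
    have hdouble : ∑ j ∈ F, ∑ k ∈ F, μ.real (E j ∩ E k) ≤ C' * S ^ 2 := by
      have h1 : ∑ j ∈ F, ∑ k ∈ F.filter (j ≤ ·), μ.real (E j ∩ E k) ≤ C * S * (S + S₀) := by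
        calc _ ≤ ∑ j ∈ F, C * w j * (S + S₀) := Finset.sum_le_sum hhalf
          _ = _ := by rw [← Finset.sum_mul, ← Finset.mul_sum]
      have h2 : ∑ j ∈ F, ∑ k ∈ F, μ.real (E j ∩ E k) ≤
          ∑ j ∈ F, ∑ k ∈ F.filter (j ≤ ·), μ.real (E j ∩ E k) +
          ∑ j ∈ F, ∑ k ∈ F.filter (j ≤ ·), μ.real (E j ∩ E k) := by
        have h3 : ∑ j ∈ F, ∑ k ∈ F.filter (j ≤ ·), μ.real (E j ∩ E k) =
            ∑ j ∈ F, ∑ k ∈ F.filter (· ≤ j), μ.real (E j ∩ E k) := by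
          simp only [Finset.sum_filter]
          rw [Finset.sum_comm]
          refine Finset.sum_congr rfl fun j _ => Finset.sum_congr rfl fun k _ => ?_
          rw [inter_comm]
        conv_rhs => rw [add_comm]; enter [1]; rw [h3]
        rw [← Finset.sum_add_distrib]
        refine Finset.sum_le_sum fun j _ => ?_
        simp only [Finset.sum_filter]
        rw [← Finset.sum_add_distrib]
        refine Finset.sum_le_sum fun k _ => ?_
        have := measureReal_nonneg (μ := μ) (s := E j ∩ E k)
        rcases le_total j k with h | h
        · rw [if_pos h]
          split_ifs <;> linarith
        · rw [if_pos h]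
          split_ifs <;> linarith
      have h4 : S * S₀ ≤ S ^ 2 * S₀ := by
        rw [sq, mul_assoc]
        exact le_mul_of_one_le_left (by positivity) hS1
      rw [hC']
      nlinarith
    have h2 := two_mul_sum_sub_le_real_biUnion (μ := μ) F hE (c / (C' * S))
    have h3 : c * S ≤ ∑ i ∈ F, μ.real (E i) := by
      rw [hS, Finset.mul_sum]
      exact Finset.sum_le_sum fun k _ => hlow k
    have hS0 : 0 < S := by linarith
    calc c ^ 2 / C' = 2 * (c / (C' * S)) * (c * S) - (c / (C' * S)) ^ 2 * (C' * S ^ 2) := by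
          field_simp; ring
      _ ≤ 2 * (c / (C' * S)) * ∑ i ∈ F, μ.real (E i) -
          (c / (C' * S)) ^ 2 * ∑ j ∈ F, ∑ k ∈ F, μ.real (E j ∩ E k) := by gcongr
      _ ≤ μ.real (⋃ i ∈ F, E i) := h2
      _ ≤ μ.real (⋃ k ≥ K, E k) := by
          refine measureReal_mono (iUnion₂_subset fun i hi => ?_) (measure_ne_top _ _)
          exact subset_iUnion₂_of_subset i (Finset.mem_Ico.1 hi).1 le_rfl
  have hset : {x | ∃ᶠ k in atTop, x ∈ E k} = ⋂ K : ℕ, ⋃ k ≥ K, E k := by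
    ext x
    simp [frequently_atTop]
  have hanti : Antitone fun K : ℕ => ⋃ k ≥ K, E k := fun a b hab =>
    iUnion₂_subset fun k hk => subset_iUnion₂_of_subset k (le_trans hab hk) le_rfl
  have hmeas : ∀ K : ℕ, NullMeasurableSet (⋃ k ≥ K, E k) μ := fun K =>
    (MeasurableSet.iUnion fun k => MeasurableSet.iUnion fun _ => hE k).nullMeasurableSet
  have hlim := tendsto_measure_iInter_atTop hmeas hanti ⟨0, measure_ne_top μ _⟩
  rw [hset]
  have h0 : ENNReal.ofReal (c ^ 2 / C') ≤ μ (⋂ K : ℕ, ⋃ k ≥ K, E k) := by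
    refine ge_of_tendsto' hlim fun K => ?_
    refine (ENNReal.ofReal_le_ofReal (htail K)).trans ?_
    rw [ofReal_measureReal (measure_ne_top _ _)]
    exact le_rfl
  exact lt_of_lt_of_le (ENNReal.ofReal_pos.2 (by positivity)) h0

end SecondMoment

/-! ### Greedy thinning of the indices. -/

section Greedy

theorem summable_exp_neg_mul_sqrt {c : ℝ} (hc : 0 < c) :
    Summable fun d : ℕ => Real.exp (-(c * √d)) := by
  have h := isLittleO_exp_neg_mul_rpow_atTop hc (-4)
  have ht : Tendsto (fun n : ℕ => √(n : ℝ)) atTop atTop :=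
    Real.tendsto_sqrt_atTop.comp tendsto_natCast_atTop_atTop
  have h2 := (h.comp_tendsto ht).isBigO
  refine summable_of_isBigO_nat (Real.summable_nat_rpow.2 (by norm_num : (-2 : ℝ) < -1)) ?_
  refine h2.congr' ?_ ?_
  · exact Eventually.of_forall fun n => by simp
  · filter_upwards with n
    simp only [Function.comp]
    rw [Real.sqrt_eq_rpow, ← Real.rpow_mul (Nat.cast_nonneg n)]
    norm_num

theorem mul_exp_neg_le {θ x y : ℝ} (hθ : 0 < θ) (hy : 0 ≤ y) (hyx : y ≤ x) :
    x * Real.exp (-(θ * x)) ≤ (1 + 1 / θ) * max y 1 * Real.exp (-(θ * y)) := by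
  have h1 : Real.exp (-(θ * x)) = Real.exp (-(θ * (x - y))) * Real.exp (-(θ * y)) := by
    rw [← Real.exp_add]; ring_nf
  rw [h1, ← mul_assoc]
  refine mul_le_mul_of_nonneg_right ?_ (Real.exp_pos _).le
  have h2 : (x - y) * Real.exp (-(θ * (x - y))) ≤ 1 / θ := by
    rw [Real.exp_neg, ← div_eq_mul_inv, div_le_div_iff₀ (Real.exp_pos _) hθ]
    have := Real.add_one_le_exp (θ * (x - y))
    linarith
  have h3 : y * Real.exp (-(θ * (x - y))) ≤ y * 1 := by
    gcongr
    rw [Real.exp_le_one_iff]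
    have := mul_nonneg hθ.le (sub_nonneg.2 hyx)
    linarith
  have h4 : y ≤ max y 1 := le_max_left _ _
  have h5 : 1 ≤ max y 1 := le_max_right _ _
  have h6 : 1 / θ ≤ 1 / θ * max y 1 := le_mul_of_one_le_right (by positivity) h5
  linarith

/-- Growth gives `1 - m / n ≥ d / (a + d)`, while `n < m a` forces `d ≤ a²`. Since `√d ≤ a`, the
product `a d / (a + d)` is at least `√d / 2`. -/
theorem sqrt_le_mul_one_sub {a m n : ℝ} {d : ℕ} (hm : 0 < m) (hn : n < m * a)
    (ha : 1 ≤ a) (hgrow : m * (1 + d / a) ≤ n) : √d / 2 ≤ a * (1 - m / n) := by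
  have ha0 : 0 < a := by linarith
  have hd0 : (0 : ℝ) ≤ d := Nat.cast_nonneg d
  have hn0 : 0 < n := lt_of_lt_of_le (by positivity) hgrow
  have hda : (d : ℝ) ≤ a ^ 2 := by
    have h1 : 1 + d / a < a := lt_of_mul_lt_mul_left (hgrow.trans_lt hn) hm.le
    have h2 : d / a < a := by linarith
    rw [div_lt_iff₀ ha0] at h2
    nlinarith
  have hsq : √(d : ℝ) ≤ a := Real.sqrt_le_iff.2 ⟨ha0.le, hda⟩
  have h3 : d / (a + d) ≤ 1 - m / n := by
    have h4 : m / n ≤ a / (a + d) := by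
      rw [div_le_div_iff₀ hn0 (by positivity)]
      have : m * (1 + d / a) * a ≤ n * a := by gcongr
      calc m * (a + d) = m * (1 + d / a) * a := by field_simp
        _ ≤ n * a := this
        _ = a * n := by ring
    have h5 : d / (a + d) = 1 - a / (a + d) := by field_simp; ring
    rw [h5]
    linarith
  have h6 : √(d : ℝ) / 2 ≤ a * (d / (a + d)) := by
    rw [← mul_div_assoc, div_le_div_iff₀ two_pos (by positivity)]
    have e : (d : ℝ) = √d * √d := (Real.mul_self_sqrt hd0).symm
    have hs0 : 0 ≤ √(d : ℝ) := Real.sqrt_nonneg _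
    rcases Nat.eq_zero_or_pos d with rfl | hd
    · simp
    · have hs1 : 1 ≤ √(d : ℝ) := Real.one_le_sqrt.2 (by exact_mod_cast hd)
      have h7 : √(d : ℝ) * d ≤ a * d := by gcongr
      have h8 : √(d : ℝ) * a ≤ d * a := by
        gcongr
        nlinarith
      linarith
  exact h6.trans (by gcongr)

/-- The indices of `G`, thinned out so that consecutive ones have ratio at least `1 + 1 / max a 1`,
carry the divergence of a series and decorrelate the events `E`. -/
theorem pos_measure_frequently_of_not_summable {α : Type*} [MeasurableSpace α] {μ : Measure α}
    [IsProbabilityMeasure μ] {E : ℕ → Set α} (hE : ∀ i, MeasurableSet (E i)) {a : ℕ → ℝ}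
    (ha : Monotone a) (ha0 : ∀ n, 0 ≤ a n) (han : ∀ n, a n ≤ n) {θ c C : ℝ} (hθ : 0 < θ)
    (hc : 0 < c) (hC : 0 < C) {G : Set ℕ} (hG : ∀ n ∈ G, 1 ≤ n)
    (hns : ¬ Summable (G.indicator fun n : ℕ => a n / n * Real.exp (-(θ * a n))))
    (hlow : ∀ n ∈ G, c * Real.exp (-(θ * a n)) ≤ μ.real (E n))
    (hpair : ∀ m ∈ G, ∀ n ∈ G, m ≤ n → μ.real (E m ∩ E n) ≤
      C * Real.exp (-(θ * a m)) * Real.exp (-(θ * (a n * (1 - m / n))))) :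
    0 < μ {x | ∃ᶠ n in atTop, x ∈ E n} := by
  classical
  have hinf : G.Infinite := by
    intro hfin
    exact hns (summable_of_hasFiniteSupport (hfin.subset support_indicator_subset))
  have hex : ∀ x : ℝ, ∃ n ∈ G, x ≤ n := by
    intro x
    obtain ⟨n, hn, hxn⟩ := hinf.exists_gt ⌈x⌉₊
    exact ⟨n, hn, (Nat.le_ceil x).trans (by exact_mod_cast hxn.le)⟩
  choose! nxt hnxtG hnxt hnxtmin using fun x : ℝ =>
    (show ∃ n, n ∈ G ∧ x ≤ n ∧ ∀ i ∈ G, x ≤ i → n ≤ i from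
      ⟨Nat.find (hex x), (Nat.find_spec (hex x)).1, (Nat.find_spec (hex x)).2,
        fun i hi hxi => Nat.find_min' (hex x) ⟨hi, hxi⟩⟩)
  -- The next index is the smallest element of `G` beyond a factor `1 + 1 / max a 1`; the truncation
  -- at 1 keeps this ratio at most 2.
  set N : ℕ → ℕ := fun k => Nat.rec (nxt 0)
    (fun _ m => nxt ((m : ℝ) * (1 + 1 / max (a m) 1))) k with hN
  have hNsucc : ∀ k, N (k + 1) = nxt ((N k : ℝ) * (1 + 1 / max (a (N k)) 1)) := fun k => rfl
  have hNG : ∀ k, N k ∈ G := by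
    intro k
    cases k with
    | zero => exact hnxtG _
    | succ k => exact hnxtG _
  have hmax : ∀ n, (0 : ℝ) < max (a n) 1 := fun n => lt_max_of_lt_right one_pos
  have hN1 : ∀ k, (1 : ℝ) ≤ N k := fun k => by exact_mod_cast hG _ (hNG k)
  have hgrow : ∀ k, (N k : ℝ) * (1 + 1 / max (a (N k)) 1) ≤ N (k + 1) := fun k => hnxt _
  have hmono : StrictMono N := by
    refine strictMono_nat_of_lt_succ fun k => ?_
    have h1 : (N k : ℝ) < N (k + 1) := by
      refine lt_of_lt_of_le ?_ (hgrow k)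
      have h2 := hmax (N k)
      have h3 := hN1 k
      have : 0 < (N k : ℝ) * (1 / max (a (N k)) 1) := by positivity
      linarith
    exact_mod_cast h1
  set u : ℕ → ℝ := G.indicator fun n : ℕ => a n / n * Real.exp (-(θ * a n)) with hu
  have hu0 : ∀ n, 0 ≤ u n := fun n => indicator_nonneg
    (fun n _ => mul_nonneg (div_nonneg (ha0 n) (Nat.cast_nonneg n)) (Real.exp_pos _).le) n
  set w : ℕ → ℝ := fun k => Real.exp (-(θ * a (N k))) with hw
  -- The greedy choice leaves at most `n / y + 1` elements of `G` in the block, each contributing at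
  -- most a constant times `y w k / n`. The thinned series therefore still diverges.
  have hblock : ∀ k, ∑ i ∈ Finset.Ico (N k) (N (k + 1)), u i ≤ 2 * (1 + 1 / θ) * w k := by
    intro k
    set n := N k with hn
    have hn1 : (1 : ℝ) ≤ n := hN1 k
    set y := max (a n) 1 with hy
    have hy0 : 0 < y := hmax n
    have hyn : y ≤ n := max_le (han n) hn1
    set F := (Finset.Ico n (N (k + 1))).filter (· ∈ G) with hF
    have hFsub : F ⊆ Finset.Ico n (n + (⌊(n : ℝ) / y⌋₊ + 1)) := by
      intro i hi
      rw [hF, Finset.mem_filter, Finset.mem_Ico] at hi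
      rw [Finset.mem_Ico]
      refine ⟨hi.1.1, ?_⟩
      by_contra hcon
      push Not at hcon
      have h1 : (n : ℝ) * (1 + 1 / y) ≤ i := by
        have h2 : ((n + (⌊(n : ℝ) / y⌋₊ + 1) : ℕ) : ℝ) ≤ i := by exact_mod_cast hcon
        push_cast at h2
        have h3 := Nat.lt_floor_add_one ((n : ℝ) / y)
        rw [mul_add, mul_one, mul_one_div]
        linarith
      have h4 := hnxtmin _ i hi.2 h1
      rw [← hNsucc k] at h4
      omega
    have hcard : (F.card : ℝ) ≤ n / y + 1 := by
      have h1 := Finset.card_le_card hFsub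
      rw [Nat.card_Ico, Nat.add_sub_cancel_left] at h1
      have h2 : (F.card : ℝ) ≤ (⌊(n : ℝ) / y⌋₊ + 1 : ℕ) := by exact_mod_cast h1
      push_cast at h2
      have := Nat.floor_le (show 0 ≤ (n : ℝ) / y by positivity)
      linarith
    have hterm : ∀ i ∈ F, u i ≤ (1 + 1 / θ) * y * w k / n := by
      intro i hi
      rw [hF, Finset.mem_filter, Finset.mem_Ico] at hi
      have hni : (n : ℝ) ≤ i := by exact_mod_cast hi.1.1
      rw [hu, indicator_of_mem hi.2, div_mul_eq_mul_div]
      refine div_le_div₀ (by positivity) (mul_exp_neg_le hθ (ha0 n) (ha hi.1.1)) (by linarith) hni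
    calc ∑ i ∈ Finset.Ico n (N (k + 1)), u i = ∑ i ∈ F, u i := by
          rw [hF, Finset.sum_filter]
          refine Finset.sum_congr rfl fun i _ => ?_
          split_ifs with h
          · rfl
          · exact indicator_of_notMem h _
      _ ≤ F.card • ((1 + 1 / θ) * y * w k / n) := Finset.sum_le_card_nsmul _ _ _ hterm
      _ ≤ (n / y + 1) * ((1 + 1 / θ) * y * w k / n) := by
          rw [nsmul_eq_mul]
          have : 0 ≤ w k := (Real.exp_pos _).le
          gcongr
      _ = (1 + 1 / θ) * w k * (1 + y / n) := by field_simp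
      _ ≤ (1 + 1 / θ) * w k * 2 := by
          have : 0 ≤ w k := (Real.exp_pos _).le
          have h2 : y / n ≤ 1 := (div_le_one (by linarith)).2 hyn
          gcongr
          linarith
      _ = _ := by ring
  have hw0 : ∀ k, 0 ≤ w k := fun k => (Real.exp_pos _).le
  have hwns : ¬ Summable w := by
    intro hws
    apply hns
    have hpart : ∀ k, ∑ i ∈ Finset.range (N k), u i ≤
        ∑ i ∈ Finset.range k, 2 * (1 + 1 / θ) * w i := by
      intro k
      induction k with
      | zero =>
        rw [Finset.sum_range_zero]
        refine Finset.sum_nonpos fun i hi => le_of_eq (indicator_of_notMem (fun hiG => ?_) _)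
        have := hnxtmin 0 i hiG (Nat.cast_nonneg i)
        have h2 := Finset.mem_range.1 hi
        have h3 : N 0 = nxt 0 := rfl
        omega
      | succ k ih =>
        rw [Finset.sum_range_succ, ← Finset.sum_range_add_sum_Ico _ (hmono.monotone k.le_succ)]
        exact add_le_add ih (hblock k)
    refine summable_of_sum_range_le (c := ∑' i, 2 * (1 + 1 / θ) * w i) hu0 fun n => ?_
    have hws' : Summable fun i => 2 * (1 + 1 / θ) * w i := hws.mul_left _
    calc ∑ i ∈ Finset.range n, u i ≤ ∑ i ∈ Finset.range (N n), u i :=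
          Finset.sum_le_sum_of_subset_of_nonneg
            (Finset.range_subset_range.2 (hmono.id_le n)) fun i _ _ => hu0 i
      _ ≤ _ := hpart n
      _ ≤ _ := hws'.sum_le_tsum _ fun i _ => mul_nonneg (by positivity) (hw0 i)
  have hgrow' : ∀ j d, (N j : ℝ) * (1 + d / max (a (N (j + d))) 1) ≤ N (j + d) := by
    intro j d
    set y := max (a (N (j + d))) 1 with hy
    have hy0 : 0 < y := hmax _
    have h1 : ∀ e ≤ d, (N j : ℝ) * (1 + 1 / y) ^ e ≤ N (j + e) := by
      intro e
      induction e with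
      | zero => simp
      | succ e ih =>
        intro he
        have h2 : 1 / y ≤ 1 / max (a (N (j + e))) 1 := by
          apply one_div_le_one_div_of_le (hmax _)
          exact max_le_max (ha (hmono.monotone (by omega))) le_rfl
        calc (N j : ℝ) * (1 + 1 / y) ^ (e + 1) = (N j : ℝ) * (1 + 1 / y) ^ e * (1 + 1 / y) := by
              rw [pow_succ]; ring
          _ ≤ N (j + e) * (1 + 1 / max (a (N (j + e))) 1) := by
              have := hmax (N (j + e))
              refine mul_le_mul (ih (by omega)) (by linarith) (by positivity) (by positivity)
          _ ≤ N (j + e + 1) := hgrow _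
    refine le_trans ?_ (h1 d le_rfl)
    have h3 := one_add_mul_le_pow (show (-2 : ℝ) ≤ 1 / y by
      have : 0 < 1 / y := by positivity
      linarith) d
    have h4 := hN1 j
    gcongr
    calc 1 + (d : ℝ) / y = 1 + d * (1 / y) := by ring
      _ ≤ _ := h3
  have hfreq : 0 < μ {x | ∃ᶠ k in atTop, x ∈ E (N k)} := by
    refine pos_measure_frequently (μ := μ) (E := fun k => E (N k)) (fun k => hE _) hw0 hwns
      (ε := fun d : ℕ => Real.exp (-(θ / 2 * √d))) (fun k => (Real.exp_pos _).le)
      (summable_exp_neg_mul_sqrt (half_pos hθ)) hc (C := C * Real.exp θ)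
      (by positivity) (fun k => hlow _ (hNG k)) fun j k hjk => ?_
    obtain ⟨d, rfl⟩ := Nat.exists_eq_add_of_le hjk
    rw [Nat.add_sub_cancel_left]
    refine (hpair _ (hNG j) _ (hNG (j + d)) (hmono.monotone hjk)).trans ?_
    have hm1 := hN1 j
    have hn1 := hN1 (j + d)
    set m : ℝ := (N j : ℝ)
    set n : ℝ := (N (j + d) : ℝ) with hndef
    set x := a (N (j + d)) with hx
    have hexp1 : 1 ≤ Real.exp θ := Real.one_le_exp hθ.le
    -- If `m x ≤ n`, replacing `1 - m / n` by 1 costs at most `exp θ`, which gives the independent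
    -- term. Otherwise the growth of the thinned sequence gives decay in `√d`, which is summable.
    have hkey : Real.exp (-(θ * (x * (1 - m / n)))) ≤
        Real.exp θ * (w (j + d) + Real.exp (-(θ / 2 * √d))) := by
      have hwk := hw0 (j + d)
      have he := (Real.exp_pos (-(θ / 2 * √(d : ℝ)))).le
      rcases le_or_gt (m * x) n with h | h
      · have h1 : x * (m / n) ≤ 1 := by
          rw [← mul_div_assoc, div_le_one (by linarith)]
          linarith
        calc Real.exp (-(θ * (x * (1 - m / n)))) ≤ Real.exp (θ + -(θ * x)) := by
              apply Real.exp_le_exp.2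
              have := mul_le_mul_of_nonneg_left h1 hθ.le
              linarith
          _ = Real.exp θ * w (j + d) := Real.exp_add _ _
          _ ≤ _ := by gcongr; linarith
      · have hmn : m ≤ n := by
          exact Nat.cast_le.2 (hmono.monotone hjk)
        have hx1 : 1 ≤ x := by
          by_contra hcon
          push Not at hcon
          nlinarith
        have hg := hgrow' j d
        rw [max_eq_left hx1] at hg
        have h1 := sqrt_le_mul_one_sub (by linarith) h hx1 hg
        calc Real.exp (-(θ * (x * (1 - m / n)))) ≤ Real.exp (-(θ / 2 * √d)) := by
              apply Real.exp_le_exp.2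
              have := mul_le_mul_of_nonneg_left h1 hθ.le
              linarith
          _ ≤ Real.exp θ * Real.exp (-(θ / 2 * √d)) := le_mul_of_one_le_left he hexp1
          _ ≤ _ := by gcongr; linarith
    calc C * Real.exp (-(θ * a (N j))) * Real.exp (-(θ * (x * (1 - m / n))))
        ≤ C * w j * (Real.exp θ * (w (j + d) + Real.exp (-(θ / 2 * √d)))) := by
          have := hw0 j
          gcongr
      _ = _ := by ring
  refine hfreq.trans_le (measure_mono fun x hx => ?_)
  exact hmono.tendsto_atTop.frequently hx

end Greedy


/-! ### The divergent case. -/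

theorem avoid_subset_preimage {α : Type*} (f : α → α) (S : Set α) {k l n : ℕ} (h : k + l ≤ n) :
    avoid f S n ⊆ f^[k] ⁻¹' avoid f S l := by
  refine (avoid_anti h).trans ?_
  rw [avoid_add]
  exact inter_subset_right

namespace HittingEstimates

variable {α : Type*} [MeasurableSpace α] {μ : Measure α} [IsProbabilityMeasure μ] {f : α → α}
  {A B : ℕ → Set α} {θ σ K β κ : ℝ} {n₀ : ℕ}

/-- The avoidance events decorrelate across a long gap. -/
theorem real_avoid_inter_avoid_le_of_far (H : HittingEstimates μ f A B θ σ K β κ n₀) {Q : ℕ}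
    (hQ : K ^ 2 * κ ^ (Q - 1) ≤ 1) {m n t : ℕ} (hm : n₀ ≤ m) (hm1 : 1 ≤ m) (hQt : Q * m ≤ t)
    (hQ1 : 1 ≤ Q) (htn : 2 * t ≤ n) :
    μ.real (avoid f (B m) m ∩ avoid f (B n) n) ≤
      μ.real (avoid f (B m) m) * μ.real (avoid f (B n) (n - 2 * t)) + κ ^ t := by
  have hD := measurableSet_avoid H.preserving.measurable (H.measurableSet_B n) (n - 2 * t)
  have hmt : m ≤ t := le_trans (Nat.le_mul_of_pos_left m hQ1) hQt
  have h1 := (abs_le.1 (H.far m hm m (2 * t - m) _ hD)).2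
  rw [show m + (2 * t - m) = 2 * t by omega] at h1
  have h2 : μ.real (avoid f (B m) m ∩ avoid f (B n) n) ≤
      μ.real (avoid f (B m) m ∩ f^[2 * t] ⁻¹' avoid f (B n) (n - 2 * t)) :=
    measureReal_mono (inter_subset_inter_right _ (avoid_subset_preimage f _ (by omega)))
  have hK := H.one_le_K
  have hκ := H.κ_pos
  -- The geometric loss over `m` steps is absorbed by the factor `κ ^ ((Q - 1) m)` available because
  -- `t ≥ Q m`, by the choice of `Q`.
  have h3 : K ^ (m + 1) * κ ^ (2 * t - m) ≤ κ ^ t := by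
    obtain ⟨Q, rfl⟩ : ∃ Q', Q = Q' + 1 := ⟨Q - 1, by omega⟩
    have e : (Q + 1) * m = Q * m + m := by ring
    calc K ^ (m + 1) * κ ^ (2 * t - m) ≤ K ^ (2 * m) * κ ^ (Q * m + t) :=
          mul_le_mul (pow_le_pow_right₀ hK (by omega))
            (pow_le_pow_of_le_one hκ.le H.κ_lt.le (by omega)) (by positivity) (by positivity)
      _ = (K ^ 2 * κ ^ Q) ^ m * κ ^ t := by rw [mul_pow, pow_add, pow_mul, pow_mul]; ring
      _ ≤ 1 * κ ^ t := by
          gcongr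
          exact pow_le_one₀ (by positivity) hQ
      _ = κ ^ t := one_mul _
  linarith

/-- The divergent case: with positive probability, infinitely often an orbit fails to hit `B n`
within the first `n` steps. -/
theorem pos_measure_frequently_avoid (H : HittingEstimates μ f A B θ σ K β κ n₀)
    (hns : ¬ Summable fun n : ℕ => μ.real (B n) * Real.exp (-(n * θ * μ.real (B n)))) :
    0 < μ {x | ∃ᶠ n in atTop, x ∈ avoid f (B n) n} := by
  obtain ⟨γ, hγ, hpois⟩ := H.exists_poisson
  have hθ := H.θ_pos
  have hK := H.one_le_K
  -- The factor 6 is `1 + 5`: for comparable indices `log n ≤ 5 log m`, and `m^(-γ)` must be below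
  -- `exp (-θ a m) exp (-θ a n)`.
  set c₀ := min 1 (min 1 (γ / 6) / θ) with hc₀
  have hc₀0 : 0 < c₀ := lt_min one_pos (div_pos (lt_min one_pos (by linarith)) hθ)
  have hc₀1 : c₀ ≤ 1 := min_le_left _ _
  have hc₀m : θ * c₀ ≤ min 1 (γ / 6) := by
    calc θ * c₀ ≤ θ * (min 1 (γ / 6) / θ) := mul_le_mul_of_nonneg_left (min_le_right _ _) hθ.le
      _ = min 1 (γ / 6) := by field_simp
  have hθc1 : θ * c₀ ≤ 1 := hc₀m.trans (min_le_left _ _)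
  have hθcγ : 6 * (θ * c₀) ≤ γ := by linarith [hc₀m.trans (min_le_right _ _)]
  obtain ⟨Q, hQ1, hQ⟩ : ∃ Q : ℕ, 1 ≤ Q ∧ K ^ 2 * κ ^ (Q - 1) ≤ 1 := by
    obtain ⟨Q, hQ⟩ := exists_pow_lt_of_lt_one (show 0 < (K ^ 2)⁻¹ by positivity) H.κ_lt
    refine ⟨Q + 1, by omega, ?_⟩
    rw [Nat.add_sub_cancel]
    calc K ^ 2 * κ ^ Q ≤ K ^ 2 * (K ^ 2)⁻¹ := by gcongr
      _ = 1 := mul_inv_cancel₀ (by positivity)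
  set a : ℕ → ℝ := fun n => n * μ.real (B n) with ha
  have ha0 : ∀ n, 0 ≤ a n := fun n => by positivity
  have hlogtop : Tendsto (fun n : ℕ => θ * c₀ * Real.log n) atTop atTop :=
    (Real.tendsto_log_atTop.comp tendsto_natCast_atTop_atTop).const_mul_atTop (mul_pos hθ hc₀0)
  have hsmall : Tendsto (fun n : ℕ => (n : ℝ) ^ (-(γ / 2))) atTop (𝓝 0) :=
    (tendsto_rpow_neg_atTop (half_pos hγ)).comp tendsto_natCast_atTop_atTop
  obtain ⟨n₁, hn₁⟩ := eventually_atTop.1 (hpois.and ((eventually_ge_atTop (max (Q ^ 4) n₀)).and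
    ((hlogtop.eventually_ge_atTop 1).and ((hsmall.eventually_le_const
      (show 0 < Real.exp (-2) / 2 by positivity)).and
      ((eventually_pow_sqrt_sqrt_le 1 H.κ_pos H.κ_lt).and
        (eventually_log_le 2 (one_half_pos (α := ℝ))))))))
  -- Only indices with `a n ≤ c₀ log n` are kept, where the exponential law applies; the others
  -- contribute a convergent series.
  set G : Set ℕ := {n | n₁ ≤ n ∧ a n ≤ c₀ * Real.log n} with hG
  have hQ4 : ∀ n ≥ n₁, Q ^ 4 ≤ n := fun n hn => (le_max_left _ _).trans (hn₁ n hn).2.1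
  have hpos : ∀ n ≥ n₁, 1 ≤ n := fun n hn => (Nat.one_le_pow _ _ hQ1).trans (hQ4 n hn)
  have hn₀ : ∀ n ≥ n₁, n₀ ≤ n := fun n hn => (le_max_right _ _).trans (hn₁ n hn).2.1
  have hG1 : ∀ n ∈ G, 1 ≤ n := fun n hn => hpos n hn.1
  have haG : ∀ n ∈ G, θ * a n ≤ θ * c₀ * Real.log n := fun n hn => by
    rw [mul_assoc]; exact mul_le_mul_of_nonneg_left hn.2 hθ.le
  have hlogG : ∀ n ∈ G, n * μ.real (B n) ≤ Real.log n := fun n hn =>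
    hn.2.trans (mul_le_of_le_one_left (Real.log_natCast_nonneg n) hc₀1)
  have hexpG : ∀ n ∈ G, ∀ y, (n : ℝ) ^ y = Real.exp (Real.log n * y) := fun n hn y =>
    Real.rpow_def_of_pos (by exact_mod_cast hG1 n hn) y
  have hX : ∀ n ∈ G, ∀ l ≤ n, ∃ l' ≤ l, ∀ D, MeasurableSet D →
      μ.real (avoid f (A n) l' ∩ f^[l'] ⁻¹' D) ≤
        Real.exp (2 - θ * μ.real (B n) * l) * μ.real D + (n : ℝ) ^ (-γ) := fun n hn =>
    ((hn₁ n hn.1).1 n le_rfl (hlogG n hn)).1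
  have hXA : ∀ n ∈ G, ∀ l ≤ n, ∃ l' ≤ l, μ.real (avoid f (A n) l') ≤
      Real.exp (2 - θ * μ.real (B n) * l) + (n : ℝ) ^ (-γ) := by
    intro n hn l hl
    obtain ⟨l', hl', h⟩ := hX n hn l hl
    have h := h univ MeasurableSet.univ
    rw [preimage_univ, inter_univ, probReal_univ, mul_one] at h
    exact ⟨l', hl', h⟩
  have hXB : ∀ n ∈ G, ∀ l ≤ n, μ.real (avoid f (B n) l) ≤
      Real.exp (2 - θ * μ.real (B n) * l) + (n : ℝ) ^ (-γ) := by
    intro n hn l hl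
    obtain ⟨l', hl', h⟩ := hXA n hn l hl
    exact (measureReal_mono ((avoid_anti hl').trans (avoid_subset_avoid (H.subset n) l'))).trans h
  have herr : ∀ n ∈ G, (n : ℝ) ^ (-γ) ≤ Real.exp (-(θ * a n)) := by
    intro n hn
    rw [hexpG n hn]
    apply Real.exp_le_exp.2
    have h1 := haG n hn
    have h2 := Real.log_natCast_nonneg n
    nlinarith
  refine pos_measure_frequently_of_not_summable
    (fun n => measurableSet_avoid H.preserving.measurable (H.measurableSet_B n) n)
    H.mono ha0 (fun n => mul_le_of_le_one_right (Nat.cast_nonneg _) measureReal_le_one) hθ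
    (c := Real.exp (-2) / 2) (C := (Real.exp 2 + 1) * (Real.exp 3 + 1) + 1) (by positivity)
    (by positivity) hG1 (fun hsum => hns ?_) (fun n hn => ?_) (fun m hm n hn hmn => ?_)
  · refine Summable.of_norm_bounded_eventually_nat
      (hsum.add (summable_log_rpow (mul_pos hθ hc₀0) c₀)) ?_
    filter_upwards [eventually_ge_atTop n₁] with n hn
    have hn0 : (0 : ℝ) < n := by exact_mod_cast hpos n hn
    have hL := Real.log_natCast_nonneg n
    have e2 : 0 ≤ c₀ * Real.log n / n * (n : ℝ) ^ (-(θ * c₀)) := by positivity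
    have e3 : μ.real (B n) * Real.exp (-(n * θ * μ.real (B n))) =
        a n / n * Real.exp (-(θ * a n)) := by
      simp only [ha]
      rw [mul_div_cancel_left₀ _ hn0.ne']
      ring_nf
    rw [Real.norm_of_nonneg (by positivity), e3]
    by_cases hnG : n ∈ G
    · rw [indicator_of_mem hnG]
      exact le_add_of_nonneg_right e2
    · rw [indicator_of_notMem hnG, zero_add]
      have h1 : c₀ * Real.log n ≤ a n := by
        by_contra h
        exact hnG ⟨hn, (not_le.1 h).le⟩
      have h2 := antitone_mul_exp_neg hθ (by rw [← mul_assoc]; exact (hn₁ n hn).2.2.1) h1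
      rw [Real.rpow_def_of_pos hn0, div_mul_eq_mul_div, div_mul_eq_mul_div]
      refine div_le_div_of_nonneg_right (h2.trans (le_of_eq ?_)) hn0.le
      ring_nf
  · have h1 := ((hn₁ n hn.1).1 n le_rfl (hlogG n hn)).2
    have h2 : (n : ℝ) ^ (-γ) ≤ Real.exp (-2) / 2 * Real.exp (-(θ * a n)) := by
      have e : (n : ℝ) ^ (-γ) = (n : ℝ) ^ (-(γ / 2)) * (n : ℝ) ^ (-(γ / 2)) := by
        rw [← Real.rpow_add (by exact_mod_cast hG1 n hn)]; ring_nf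
      rw [e]
      refine mul_le_mul (hn₁ n hn.1).2.2.2.1 ?_ (by positivity) (by positivity)
      rw [hexpG n hn]
      apply Real.exp_le_exp.2
      have h1 := haG n hn
      have h2 := Real.log_natCast_nonneg n
      nlinarith
    have h3 : Real.exp (-(θ * μ.real (B n) * n) - 2) = Real.exp (-2) * Real.exp (-(θ * a n)) := by
      rw [← Real.exp_add]; simp only [ha]; ring_nf
    rw [h3] at h1
    linarith
  have hm1 : (1 : ℝ) ≤ m := by exact_mod_cast hG1 m hm
  have hmn' : (m : ℝ) ≤ n := by exact_mod_cast hmn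
  have hn1 : (1 : ℝ) ≤ n := hm1.trans hmn'
  have hlm := Real.log_natCast_nonneg m
  have hln := Real.log_natCast_nonneg n
  have hlmn : Real.log m ≤ Real.log n := Real.log_le_log (by linarith) hmn'
  have ham := haG m hm
  have han := haG n hn
  have hθa : ∀ n, 0 ≤ θ * a n := fun n => mul_nonneg hθ.le (ha0 n)
  have hfrac0 : 0 ≤ 1 - (m : ℝ) / n := sub_nonneg.2 ((div_le_one (by linarith)).2 hmn')
  have hfrac1 : 1 - (m : ℝ) / n ≤ 1 := sub_le_self _ (by positivity)
  have hWn : Real.exp (-(θ * a n)) ≤ Real.exp (-(θ * (a n * (1 - m / n)))) := by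
    apply Real.exp_le_exp.2
    have := mul_le_of_le_one_right (hθa n) hfrac1
    linarith
  set W := Real.exp (-(θ * (a n * (1 - m / n)))) with hW
  have hW0 : 0 < W := Real.exp_pos _
  set V := Real.exp (-(θ * a m)) with hV
  have hV0 : 0 < V := Real.exp_pos _
  have hEm : Real.exp (2 - θ * μ.real (B m) * m) = Real.exp 2 * V := by
    rw [hV, ← Real.exp_add]; simp only [ha]; ring_nf
  have hherr := herr m hm
  obtain ⟨-, ht1, ht4⟩ := half_rpow_le_sqrt_sqrt (hG1 n hn)
  set t := Nat.sqrt (Nat.sqrt n) with ht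
  -- For `m` small against `n^(1/4)` the crude mixing of avoidance events suffices. Otherwise `n ≤ m
  -- ^ 5`, and the joint form of the exponential law at index `m` applies with the avoidance of `A
  -- n` as the later event.
  rcases le_or_gt (Q * m) t with hfar | hnear
  · have ht2 : (t : ℝ) ≤ √n := by
      apply Real.le_sqrt_of_sq_le
      refine le_trans ?_ (by exact_mod_cast ht4 : (t : ℝ) ^ 4 ≤ n)
      exact pow_le_pow_right₀ (by exact_mod_cast ht1) (by norm_num)
    have hlogn : 2 * Real.log n ≤ √n := by
      rw [Real.sqrt_eq_rpow]; exact (hn₁ n hn.1).2.2.2.2.2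
    -- Discarding the first `2t` times of the second event changes its exponent by at most 1, which
    -- is why `exp 3` replaces `exp 2`.
    have h1 : θ * μ.real (B n) * (2 * t) ≤ 1 := by
      refine le_of_mul_le_mul_right (a := (n : ℝ)) ?_ (by linarith)
      calc θ * μ.real (B n) * (2 * t) * n = θ * a n * (2 * t) := by simp only [ha]; ring
        _ ≤ 1 * Real.log n * (2 * t) := by
            refine mul_le_mul_of_nonneg_right (han.trans ?_) (by positivity)
            exact mul_le_mul_of_nonneg_right hθc1 hln
        _ = 2 * Real.log n * t := by ring
        _ ≤ √n * √n := by gcongr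
        _ = 1 * n := by rw [Real.mul_self_sqrt (by linarith), one_mul]
    have hlog1 : 1 ≤ Real.log n := by
      have := (hn₁ n hn.1).2.2.1
      nlinarith
    have h2t : 2 * t ≤ n := by
      have : (2 * t : ℝ) ≤ n := by
        calc (2 * t : ℝ) ≤ 2 * Real.log n * t := by nlinarith [(Nat.cast_nonneg t : (0 : ℝ) ≤ t)]
          _ ≤ √n * √n := by gcongr
          _ = n := Real.mul_self_sqrt (by linarith)
      exact_mod_cast this
    have h2 := H.real_avoid_inter_avoid_le_of_far hQ (hn₀ m hm.1) (hG1 m hm) hfar hQ1 h2t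
    have h3 : μ.real (avoid f (B m) m) ≤ (Real.exp 2 + 1) * V := by
      have := hXB m hm m le_rfl
      rw [hEm] at this
      linarith
    have h4 : μ.real (avoid f (B n) (n - 2 * t)) ≤ (Real.exp 3 + 1) * W := by
      refine (hXB n hn (n - 2 * t) (Nat.sub_le _ _)).trans ?_
      have e1 : Real.exp (2 - θ * μ.real (B n) * (n - 2 * t : ℕ)) ≤ Real.exp 3 * W := by
        refine le_trans ?_ (mul_le_mul_of_nonneg_left hWn (Real.exp_pos _).le)
        rw [← Real.exp_add]
        apply Real.exp_le_exp.2
        rw [Nat.cast_sub h2t]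
        push_cast
        have e : θ * μ.real (B n) * (n - 2 * t) = θ * a n - θ * μ.real (B n) * (2 * t) := by
          simp only [ha]; ring
        linarith
      linarith [herr n hn]
    have h5 : κ ^ t ≤ V * W := by
      have e1 : (n : ℝ) ^ (2 : ℝ) * κ ^ t ≤ 1 := by simpa using (hn₁ n hn.1).2.2.2.2.1
      have e2 : V * Real.exp (-(θ * a n)) * (n : ℝ) ^ (2 : ℝ) ≥ 1 := by
        rw [hexpG n hn, hV, ← Real.exp_add, ← Real.exp_add]
        apply Real.one_le_exp
        have q1 : θ * c₀ * Real.log m ≤ θ * c₀ * Real.log n := by gcongr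
        nlinarith
      have e3 : κ ^ t ≤ V * Real.exp (-(θ * a n)) := by
        refine le_of_mul_le_mul_left (e1.trans (e2.trans_eq (mul_comm _ _))) (by positivity)
      exact e3.trans (mul_le_mul_of_nonneg_left hWn hV0.le)
    calc _ ≤ _ := h2
      _ ≤ (Real.exp 2 + 1) * V * ((Real.exp 3 + 1) * W) + V * W := by gcongr
      _ = _ := by ring
  · have hnm5 : n ≤ m ^ 5 := by
      have q1 : n < (t + 1) ^ 4 := by
        have e1 : n < (Nat.sqrt n + 1) ^ 2 := by rw [sq]; exact Nat.lt_succ_sqrt n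
        have e2 : Nat.sqrt n + 1 ≤ (t + 1) ^ 2 := by
          rw [sq]; exact Nat.lt_succ_sqrt (Nat.sqrt n)
        calc n < (Nat.sqrt n + 1) ^ 2 := e1
          _ ≤ ((t + 1) ^ 2) ^ 2 := Nat.pow_le_pow_left e2 2
          _ = (t + 1) ^ 4 := by ring
      calc n ≤ (t + 1) ^ 4 := q1.le
        _ ≤ (Q * m) ^ 4 := Nat.pow_le_pow_left hnear 4
        _ = Q ^ 4 * m ^ 4 := mul_pow _ _ _
        _ ≤ m * m ^ 4 := Nat.mul_le_mul_right _ (hQ4 m hm.1)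
        _ = m ^ 5 := by ring
    have hln5 : Real.log n ≤ 5 * Real.log m := by
      have := Real.log_le_log (by linarith) (by exact_mod_cast hnm5 : (n : ℝ) ≤ (m : ℝ) ^ 5)
      rwa [Real.log_pow] at this
    obtain ⟨m', hm', hXm⟩ := hX m hm m le_rfl
    obtain ⟨l', hl', hXn⟩ := hXA n hn (n - m) (Nat.sub_le _ _)
    have hD := measurableSet_avoid H.preserving.measurable (H.measurableSet_A n) l'
    have h1 := hXm _ hD
    have hsub : avoid f (B m) m ∩ avoid f (B n) n ⊆
        avoid f (A m) m' ∩ f^[m'] ⁻¹' avoid f (A n) l' :=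
      inter_subset_inter ((avoid_anti hm').trans (avoid_subset_avoid (H.subset m) m'))
        ((avoid_subset_avoid (H.subset n) n).trans (avoid_subset_preimage f _ (by omega)))
    have hEn : Real.exp (2 - θ * μ.real (B n) * (n - m : ℕ)) = Real.exp 2 * W := by
      rw [hW, ← Real.exp_add, Nat.cast_sub hmn]
      have : (n : ℝ) ≠ 0 := by linarith
      congr 1
      simp only [ha]
      field_simp
      ring
    have h2 : μ.real (avoid f (A n) l') ≤ (Real.exp 2 + 1) * W := by
      rw [hEn] at hXn
      linarith [herr n hn]
    have h3 : (m : ℝ) ^ (-γ) ≤ V * W := by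
      refine le_trans ?_ (mul_le_mul_of_nonneg_left hWn hV0.le)
      rw [hV, ← Real.exp_add, hexpG m hm]
      apply Real.exp_le_exp.2
      have q1 : θ * c₀ * Real.log n ≤ θ * c₀ * (5 * Real.log m) := by gcongr
      have q2 : 6 * (θ * c₀) * Real.log m ≤ γ * Real.log m := by gcongr
      linarith
    rw [hEm] at h1
    have hVW : 0 < V * W := by positivity
    have h23 : Real.exp 2 ≤ Real.exp 3 := Real.exp_le_exp.2 (by norm_num)
    calc _ ≤ _ := measureReal_mono hsub
      _ ≤ _ := h1
      _ ≤ Real.exp 2 * V * ((Real.exp 2 + 1) * W) + V * W := by gcongr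
      _ = (Real.exp 2 * (Real.exp 2 + 1) + 1) * (V * W) := by ring
      _ ≤ ((Real.exp 2 + 1) * (Real.exp 3 + 1) + 1) * (V * W) := by
          gcongr
          linarith
      _ = _ := by ring

end HittingEstimates


/-! ### Atoms, the zero-one law and the maximum process. -/

section Atoms

variable {α : Type*} [MeasurableSpace α] {μ : Measure α} [IsProbabilityMeasure μ] {f : α → α}

/-- An ergodic probability measure with an atom is carried by a finite set. -/
theorem exists_finite_of_measure_singleton_pos [MeasurableSingletonClass α]
    (hf : Ergodic f μ) {p : α} (hp : 0 < μ {p}) :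
    ∃ S : Set α, S.Finite ∧ μ Sᶜ = 0 := by
  set S : Set α := range fun n => f^[n] p with hS
  have hSc : S.Countable := countable_range _
  have hsub : S ⊆ f ⁻¹' S := by
    rintro _ ⟨n, rfl⟩
    exact ⟨n + 1, Function.iterate_succ_apply' f n p⟩
  have hfull : S =ᵐ[μ] univ := by
    refine (hf.ae_empty_or_univ_of_ae_le_preimage hSc.measurableSet.nullMeasurableSet
      hsub.eventuallyLE).resolve_left fun h => ?_
    have h0 : μ S = 0 := by rw [measure_congr h, measure_empty]
    have hpS : p ∈ S := ⟨0, rfl⟩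
    exact hp.ne' (measure_mono_null (singleton_subset_iff.2 hpS) h0)
  have hae : μ Sᶜ = 0 := eventuallyEq_univ.1 hfull
  -- By invariance the image of the full-measure orbit also has full measure, so it contains the
  -- atom `p`. Hence `p` is periodic and its orbit is finite.
  have himage : μ (f '' S)ᶜ = 0 := by
    have h1 : MeasurableSet (f '' S) := (hSc.image f).measurableSet
    have h2 := hf.toMeasurePreserving.measure_preimage h1.compl.nullMeasurableSet
    rw [← h2]
    exact measure_mono_null (fun x hx hxS => hx (mem_image_of_mem f hxS)) hae
  obtain ⟨_, ⟨n, rfl⟩, hn⟩ : p ∈ f '' S := by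
    by_contra h
    exact hp.ne' (measure_mono_null (singleton_subset_iff.2 h) himage)
  have hper : Function.IsPeriodicPt f (n + 1) p := by
    rw [Function.IsPeriodicPt, Function.IsFixedPt, Function.iterate_succ_apply']
    exact hn
  refine ⟨S, ((finite_Iio (n + 1)).image fun k => f^[k] p).subset ?_, hae⟩
  rintro _ ⟨k, rfl⟩
  exact ⟨k % (n + 1), Nat.mod_lt _ n.succ_pos, hper.iterate_mod_apply k⟩

end Atoms

theorem tendsto_real_ball {X : Type*} [MetricSpace X] [MeasurableSpace X] [BorelSpace X]
    {μ : Measure X} [IsFiniteMeasure μ] {x : X} (hx : μ {x} = 0) {r : ℕ → ℝ}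
    (hr : Tendsto r atTop (𝓝 0)) : Tendsto (fun n => μ.real (Metric.ball x (r n))) atTop (𝓝 0) := by
  have h := (tendsto_measure_cthickening_of_isClosed (μ := μ) ⟨1, one_pos, measure_ne_top _ _⟩
    (isClosed_singleton (x := x))).comp hr
  rw [hx] at h
  have h2 := (ENNReal.tendsto_toReal ENNReal.zero_ne_top).comp h
  refine squeeze_zero (fun n => measureReal_nonneg) (fun n => ?_) h2
  refine measureReal_mono (fun y hy => ?_)
  have hr0 : 0 ≤ r n := dist_nonneg.trans (Metric.mem_ball.1 hy).le
  rw [Metric.cthickening_singleton x hr0]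
  exact Metric.ball_subset_closedBall hy

/-- Zero-one law for the event that all but finitely many shrinking targets are hit. -/
theorem eventually_notMem_avoid_ae_empty_or_univ {X : Type*} [MetricSpace X] [MeasurableSpace X]
    [BorelSpace X] {μ : Measure X} [IsProbabilityMeasure μ] {f : X → X} (hf : Ergodic f μ) {x : X}
    (hx : μ {x} = 0) {r : ℕ → ℝ} (hr : Tendsto r atTop (𝓝 0)) :
    ({y | ∀ᶠ n in atTop, y ∉ avoid f (Metric.ball x (r n)) n} : Set X) =ᵐ[μ] (∅ : Set X) ∨
    ({y | ∀ᶠ n in atTop, y ∉ avoid f (Metric.ball x (r n)) n} : Set X) =ᵐ[μ] univ := by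
  have hmeas : MeasurableSet {y | ∀ᶠ n in atTop, y ∉ avoid f (Metric.ball x (r n)) n} := by
    simp only [eventually_atTop, ofPred_exists, ofPred_forall]
    exact .iUnion fun n => .iInter fun m => .iInter fun _ =>
      (measurableSet_avoid hf.measurable measurableSet_ball m).compl
  refine hf.ae_empty_or_univ_of_ae_le_preimage hmeas.nullMeasurableSet ?_
  have hne : ∀ᵐ y ∂μ, y ≠ x := measure_eq_zero_iff_ae_notMem.1 hx
  filter_upwards [hne] with y hy hyH
  change ∀ᶠ n in atTop, f y ∉ avoid f (Metric.ball x (r n)) n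
  -- If `y` hits the target at a positive time, `f y` hits it one step earlier. A hit at time 0 is
  -- excluded for large `n` because `y ≠ x` and the radii tend to 0.
  filter_upwards [hyH, hr.eventually_lt_const (dist_pos.2 hy)] with n hn hrn hfy
  refine hn fun i hi => ?_
  rcases i with - | i
  · simpa using hrn.le
  · exact hfy i (by omega)

theorem eventuallyAlwaysHitting_eq {I : Set ℝ} (f : I → I) (B : ℕ → Set I) :
    eventuallyAlwaysHitting f B = {x | ∀ᶠ n in atTop, x ∉ avoid f (B n) n} := by
  ext x
  simp only [eventuallyAlwaysHitting, avoid, mem_iUnion, mem_iInter, mem_preimage, mem_ofPred_eq,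
    not_forall, not_not, exists_prop]
  constructor
  · rintro ⟨n, -, h⟩
    exact eventually_atTop.2 ⟨n, h⟩
  · intro h
    obtain ⟨n, hn⟩ := eventually_atTop.1 h
    exact ⟨max n 1, le_max_right _ _, fun m hm => hn m ((le_max_left _ _).trans hm)⟩

theorem le_maxProcess_iff {I : Set ℝ} (f : I → I) {ψ : ℝ → EReal} (hψ : StrictAntiOn ψ (Ici 0))
    (x y : I) {r : ℝ} (hr : 0 < r) (n : ℕ) :
    ψ r ≤ maxProcess f (fun y => ψ (dist y x)) n y ↔ ∃ k < n, dist (f^[k] y) x ≤ r := by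
  have hbot : ⊥ < ψ r := bot_le.trans_lt
    (hψ (mem_Ici.2 hr.le) (mem_Ici.2 (by linarith : 0 ≤ r + 1)) (lt_add_one r))
  rw [maxProcess, Finset.le_sup_iff hbot]
  simp only [Finset.mem_range, hψ.le_iff_ge (mem_Ici.2 hr.le) (mem_Ici.2 dist_nonneg)]

/-- Spheres in the line have at most two points. This removes the difference between hitting the
open ball and hitting the closed ball, which is what the non-strict inequality for the maximum
detects. -/
theorem ae_dist_iterate_ne {I : Set ℝ} {f : I → I} {μ : Measure I} (hf : MeasurePreserving f μ μ)
    (hμ : ∀ x, μ {x} = 0) (x : I) (r : ℕ → ℝ) : ∀ᵐ y ∂μ, ∀ n k, dist (f^[k] y) x ≠ r n := by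
  refine ae_all_iff.2 fun n => ae_all_iff.2 fun k => ?_
  have hfin : {y : I | dist y x = r n}.Finite := by
    refine Finite.of_finite_image (f := Subtype.val)
      ((finite_singleton ((x : ℝ) + r n)).insert ((x : ℝ) - r n) |>.subset ?_)
      Subtype.val_injective.injOn
    rintro _ ⟨y, hy, rfl⟩
    rw [mem_ofPred_eq, Subtype.dist_eq, Real.dist_eq] at hy
    rcases abs_choice ((y : ℝ) - x) with h | h <;> rw [h] at hy
    · exact .inr (mem_singleton_iff.2 (by linarith))
    · exact .inl (by linarith)
  have h0 : μ {y : I | dist y x = r n} = 0 := by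
    rw [← biUnion_of_singleton {y : I | dist y x = r n}]
    exact (measure_biUnion_null_iff hfin.countable).2 fun y _ => hμ y
  have h1 := (hf.iterate k).quasiMeasurePreserving.preimage_null h0
  filter_upwards [measure_eq_zero_iff_ae_notMem.1 h1] with y hy using hy

theorem IsHyperbolicPeriodicPt.notMem_escapeSet {I : Set ℝ} {f : I → I} {q : ℕ} {xt : I}
    (hx : IsHyperbolicPeriodicPt f q xt) {U : Set I} (hU : xt ∈ U) : xt ∉ escapeSet f q U := by
  intro h
  refine mem_iInter₂.1 h.2 q ⟨hx.pos, le_rfl⟩ ?_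
  rwa [mem_preimage, hx.iterate_eq]

/-- A nonzero extremal index rules out atoms. -/
theorem measure_singleton_eq_zero_of_escapeRatio {I : Set ℝ} {f : I → I} {μ : Measure I}
    [IsProbabilityMeasure μ] (hf : Ergodic f μ) {q : ℕ} {xt : I}
    (hx : IsHyperbolicPeriodicPt f q xt) {r : ℕ → ℝ} (hr0 : ∀ n, 1 ≤ n → 0 < r n)
    (hr : Tendsto r atTop (𝓝 0))
    (hesc : ∀ᶠ n in atTop, escapeRatio f μ q (Metric.ball xt (r n)) ≠ 0) (p : I) : μ {p} = 0 := by
  by_contra hp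
  obtain ⟨S, hfin, hS⟩ := exists_finite_of_measure_singleton_pos hf (pos_iff_ne_zero.2 hp)
  -- An atom would make the support finite, so small balls would carry no mass away from `xt`. As
  -- `xt` itself never escapes, the escape ratios would vanish.
  have hclosed : IsClosed (S \ {xt}) := (hfin.subset sdiff_subset).isClosed
  have hnhds : (S \ {xt})ᶜ ∈ 𝓝 xt := hclosed.isOpen_compl.mem_nhds fun h => h.2 rfl
  obtain ⟨ε, hε, hball⟩ := Metric.mem_nhds_iff.1 hnhds
  obtain ⟨n, hn, hrn, hn1⟩ :=
    (hesc.and ((hr.eventually_lt_const hε).and (eventually_ge_atTop 1))).exists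
  refine hn ?_
  have h0 : μ (escapeSet f q (Metric.ball xt (r n))) = 0 := by
    refine measure_mono_null (t := Sᶜ) (fun y hy hyS => ?_) hS
    refine hball (Metric.ball_subset_ball hrn.le (escapeSet_subset f q _ hy)) ⟨hyS, fun h => ?_⟩
    rw [mem_singleton_iff] at h
    exact hx.notMem_escapeSet (Metric.mem_ball_self (hr0 n hn1)) (h ▸ hy)
  rw [escapeRatio, measureReal_def, h0]
  simp

theorem setOf_lt_dist_eq_ball {I : Set ℝ} {ψ : ℝ → EReal} (hψ : StrictAntiOn ψ (Ici 0)) (x : I)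
    {r : ℝ} (hr : 0 < r) : {y : I | ψ r < ψ (dist y x)} = Metric.ball x r := by
  ext y
  exact hψ.lt_iff_gt (mem_Ici.2 hr.le) (mem_Ici.2 dist_nonneg)

/-- Specialises the estimates for balls to the radii `r n`. A nonzero escape ratio forces positive
mass, hence every ball around `xt` has positive mass, and it rules out the attracting case. The
constant is enlarged to at least `q` for the passage from the escape set to the ball. -/
theorem IsGibbs.exists_hittingEstimates {I : Set ℝ} {f : I → I} {g h : I → ℝ} {lam : ℝ}
    {μ ν : Measure I} {xt : I} {q : ℕ} [IsProbabilityMeasure μ] [IsProbabilityMeasure ν]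
    (G : IsGibbs f g h lam μ ν) (hI : I.OrdConnected) (hf : Ergodic f μ)
    (hx : IsHyperbolicPeriodicPt f q xt)
    (hh_low : ∃ c > 0, ∃ δ > 0, ∀ᵐ y ∂ν, dist y xt < δ → c ≤ h y)
    (hg_low : ∀ i < q, ∃ c > 0, ∀ᶠ y in 𝓝 (f^[i] xt), c ≤ g y)
    {r : ℕ → ℝ} (hr0 : ∀ n, 1 ≤ n → 0 < r n) (hr : Tendsto r atTop (𝓝 0))
    (hmono : Monotone fun n : ℕ => (n : ℝ) * μ.real (Metric.ball xt (r n)))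
    (hatom : μ {xt} = 0) {θ σ : ℝ} (hθ : 0 < θ) (hσ : 0 < σ)
    (hratio : (fun n : ℕ => escapeRatio f μ q (Metric.ball xt (r n)) - θ)
      =O[atTop] fun n : ℕ => (n : ℝ) ^ (-σ))
    (hesc : ∀ᶠ n in atTop, escapeRatio f μ q (Metric.ball xt (r n)) ≠ 0) :
    ∃ (K β κ : ℝ) (n₀ : ℕ), HittingEstimates μ f
      (fun n => escapeSet f q (Metric.ball xt (r n))) (fun n => Metric.ball xt (r n)) θ σ K β κ
      n₀ := by
  have hBpos : ∀ᶠ n in atTop, 0 < μ.real (Metric.ball xt (r n)) := by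
    filter_upwards [hesc] with n hn
    refine measureReal_nonneg.lt_of_ne fun h => hn ?_
    rw [escapeRatio, ← h, div_zero]
  have hpos : ∀ s, 0 < s → 0 < μ (Metric.ball xt s) := by
    intro s hs
    obtain ⟨n, hn, hrn⟩ := (hBpos.and (hr.eventually_lt_const hs)).exists
    exact (ENNReal.toReal_pos_iff.1 hn).1.trans_le
      (measure_mono (Metric.ball_subset_ball hrn.le))
  have hne : ∀ δ > 0, ∃ s ≤ δ, (escapeSet f q (Metric.ball xt s)).Nonempty := by
    intro δ hδ
    obtain ⟨n, hn, hrn⟩ := (hesc.and (hr.eventually_lt_const hδ)).exists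
    refine ⟨r n, hrn.le, nonempty_iff_ne_empty.2 fun h => hn ?_⟩
    rw [escapeRatio, h, measureReal_empty, zero_div]
  obtain ⟨δ, K, β, κ, hδ, hK, hβ, hκ0, hκ, hest⟩ :=
    G.exists_ball_estimates hI hx hh_low hg_low hpos hne
  obtain ⟨C, hC⟩ := hratio.bound
  obtain ⟨n₀, hn₀⟩ := eventually_atTop.1 (hC.and (hBpos.and ((hr.eventually_le_const hδ).and
    (eventually_ge_atTop 1))))
  have hest' : ∀ n ≥ n₀, _ := fun n hn => hest (r n) (hr0 n (hn₀ n hn).2.2.2) (hn₀ n hn).2.2.1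
  refine ⟨max (max K C) q, β, κ, n₀, ?_⟩
  have hKL : K ≤ max (max K C) q := (le_max_left _ _).trans (le_max_left _ _)
  have hCL : C ≤ max (max K C) q := (le_max_right _ _).trans (le_max_left _ _)
  have hqL : (q : ℝ) ≤ max (max K C) q := le_max_right _ _
  set L := max (max K C) (q : ℝ) with hL
  exact
    { preserving := hf.toMeasurePreserving
      measurableSet_A := fun n => measurableSet_escapeSet hf.measurable q measurableSet_ball
      measurableSet_B := fun n => measurableSet_ball
      subset := fun n => escapeSet_subset f q _
      θ_pos := hθ
      σ_pos := hσ
      one_le_K := hK.trans hKL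
      β_pos := hβ
      κ_pos := hκ0
      κ_lt := hκ
      ratio := fun n hn => by
        obtain ⟨h1, h2, -⟩ := hn₀ n hn
        rw [Real.norm_eq_abs, Real.norm_of_nonneg (by positivity), escapeRatio] at h1
        have e : μ.real (escapeSet f q (Metric.ball xt (r n))) - θ * μ.real (Metric.ball xt (r n)) =
            (μ.real (escapeSet f q (Metric.ball xt (r n))) / μ.real (Metric.ball xt (r n)) - θ) *
              μ.real (Metric.ball xt (r n)) := by
          rw [sub_mul, div_mul_cancel₀ _ h2.ne']
        rw [e, abs_mul, abs_of_pos h2]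
        gcongr
        exact h1.trans (mul_le_mul_of_nonneg_right hCL (by positivity))
      mixing := fun n hn j D hD => ((hest' n hn).1 j D hD).trans (by gcongr)
      returns := fun n hn s => ((hest' n hn).2.1 s).trans (by gcongr)
      far := fun n hn m j D hD => ((hest' n hn).2.2 m j D hD).trans (by gcongr)
      tail := fun n l => (real_avoid_escapeSet_le hf.toMeasurePreserving q measurableSet_ball
        l).trans (by gcongr)
      pos := fun n hn => (hn₀ n hn).2.1
      mono := hmono
      tendsto := tendsto_real_ball hatom hr
      nested := fun m n hmn => by
        rcases le_total (r m) (r n) with h | h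
        · exact Metric.ball_subset_ball h
        · exact absurd (measureReal_mono (Metric.ball_subset_ball h)) (not_le.2 hmn) }

end EAH

/-! ### The main theorem. -/

theorem theorem4p1
    -- an interval map with countably many branches and an ergodic invariant probability
    (I : Set ℝ) (hI : I.OrdConnected) (f : I → I) (hbr : EAH.HasCountablyManyBranches f)
    (μ : Measure I) [IsProbabilityMeasure μ] (hμ : Ergodic f μ)
    (hdecay : EAH.ExpDecayOfCorrelations f μ)
    -- the potential `log g`, its conformal measure `ν`, and the density `h` of `μ`
    (g h : I → ℝ) (lam : ℝ) (hlam : 0 < lam) (hg : EAH.IsWeight f g)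
    (ν : Measure I) [IsProbabilityMeasure ν]
    (hν : EAH.IsConformal f (fun x => ENNReal.ofReal lam / ENNReal.ofReal (g x)) ν)
    (hh : ∀ x, 0 ≤ h x) (hdens : μ = ν.withDensity fun x => ENNReal.ofReal (h x))
    (hgap : EAH.HasSpectralGap f g lam h)
    -- the hyperbolic periodic point, with `h` and `g` nondegenerate there
    (xt : I) (q : ℕ) (hxt : EAH.IsHyperbolicPeriodicPt f q xt)
    (hh_low : ∃ c > 0, ∃ δ > 0, ∀ᵐ y ∂ν, dist y xt < δ → c ≤ h y)
    (hg_low : ∀ i < q, ∃ c > 0, ∀ᶠ y in 𝓝 (f^[i] xt), c ≤ g y)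
    -- the observable `x ↦ ψ (dist x xt)`
    (ψ : ℝ → EReal) (hψ_anti : StrictAntiOn ψ (Ici 0)) (hψ_cont : ContinuousOn ψ (Ici 0))
    (hψ_lim : Tendsto ψ (𝓝[>] 0) (𝓝 ⊤))
    -- the radii
    (r : ℕ → ℝ) (hr_pos : ∀ n, 1 ≤ n → 0 < r n) (hr_lim : Tendsto r atTop (𝓝 0))
    (hr_mono : Monotone fun n : ℕ => (n : ℝ) * μ.real (Metric.ball xt (r n)))
    -- the extremal index, with a rate
    (θ : ℝ) (hθ : θ ≠ 0)
    (hθ_rate : ∃ σ : ℝ, 0 < σ ∧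
      (fun n : ℕ => EAH.escapeRatio f μ q {x | ψ (r n) < ψ (dist x xt)} - θ)
        =O[atTop] fun n : ℕ => (n : ℝ) ^ (-σ)) :
    (Summable (fun n : ℕ => μ.real (Metric.ball xt (r n)) *
          Real.exp (-((n : ℝ) * θ * μ.real (Metric.ball xt (r n))))) →
        μ (EAH.eventuallyAlwaysHitting f fun n => Metric.ball xt (r n)) = 1 ∧
        μ {x | ∀ᶠ n in atTop, ψ (r n) ≤ EAH.maxProcess f (fun y => ψ (dist y xt)) n x} = 1) ∧
    (¬ Summable (fun n : ℕ => μ.real (Metric.ball xt (r n)) *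
          Real.exp (-((n : ℝ) * θ * μ.real (Metric.ball xt (r n))))) →
        μ (EAH.eventuallyAlwaysHitting f fun n => Metric.ball xt (r n)) = 0 ∧
        μ {x | ∀ᶠ n in atTop, ψ (r n) ≤ EAH.maxProcess f (fun y => ψ (dist y xt)) n x} = 0) := by
  obtain ⟨σ, hσ, hrate⟩ := hθ_rate
  have G : EAH.IsGibbs f g h lam μ ν :=
    ⟨hI.measurableSet, hμ.measurable, hbr, hlam, hg, hν, hh, hdens, hgap⟩
  have hrate' : (fun n : ℕ => EAH.escapeRatio f μ q (Metric.ball xt (r n)) - θ)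
      =O[atTop] fun n : ℕ => (n : ℝ) ^ (-σ) := by
    refine hrate.congr' ?_ EventuallyEq.rfl
    filter_upwards [eventually_ge_atTop 1] with n hn
    rw [EAH.setOf_lt_dist_eq_ball hψ_anti xt (hr_pos n hn)]
  have hlim : Tendsto (fun n : ℕ => EAH.escapeRatio f μ q (Metric.ball xt (r n))) atTop (𝓝 θ) :=
    tendsto_sub_nhds_zero_iff.1 (hrate'.trans_tendsto
      ((tendsto_rpow_neg_atTop hσ).comp tendsto_natCast_atTop_atTop))
  have hesc := hlim.eventually_ne hθ
  -- As a limit of ratios of measures `θ` is nonnegative, and it is nonzero by assumption.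
  have hθ0 : 0 < θ := lt_of_le_of_ne (ge_of_tendsto' hlim fun n =>
    div_nonneg measureReal_nonneg measureReal_nonneg) hθ.symm
  have hatom := EAH.measure_singleton_eq_zero_of_escapeRatio hμ hxt hr_pos hr_lim hesc
  obtain ⟨K, β, κ, n₀, H⟩ := G.exists_hittingEstimates hI hμ hxt hh_low hg_low hr_pos hr_lim
    hr_mono (hatom xt) hθ0 hσ hrate' hesc
  set E : Set I := {x | ∀ᶠ n in atTop, x ∉ EAH.avoid f (Metric.ball xt (r n)) n} with hE
  have hmax : ({x | ∀ᶠ n in atTop, ψ (r n) ≤ EAH.maxProcess f (fun y => ψ (dist y xt)) n x} : Set I)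
      =ᵐ[μ] E := by
    filter_upwards [EAH.ae_dist_iterate_ne hμ.toMeasurePreserving hatom xt r] with x hx
    refine propext (eventually_congr ?_)
    filter_upwards [eventually_ge_atTop 1] with n hn
    rw [EAH.le_maxProcess_iff f hψ_anti xt x (hr_pos n hn)]
    simp only [EAH.avoid, mem_ofPred_eq, not_forall, not_not, exists_prop, Metric.mem_ball,
      (hx n _).le_iff_lt]
  rw [EAH.eventuallyAlwaysHitting_eq, measure_congr hmax, and_self, and_self, ← hE]
  refine ⟨fun hsum => ?_, fun hns => ?_⟩
  · rw [measure_congr (eventuallyEq_univ.2 (H.ae_eventually_notMem_avoid hsum)), measure_univ]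
  · rcases EAH.eventually_notMem_avoid_ae_empty_or_univ hμ (hatom xt) hr_lim with h0 | h1
    · rw [measure_congr h0, measure_empty]
    -- Full measure of the hitting set would contradict the positive probability of infinitely many
    -- failures.
    · refine absurd ?_ (H.pos_measure_frequently_avoid hns).ne'
      refine measure_mono_null (t := Eᶜ) (fun x hx hxE => ?_) (eventuallyEq_univ.1 h1)
      exact hx hxE
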